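/- **Setting.** Let $k$ be an algebraically closed field of characteristic $0$, $p$ a prime, $\Gamma=\mathbb Z/p$, and $\mathfrak g$ a finite-dimensional simple Lie algebra over $k$ on which $\Gamma$ acts by automorphisms. Let $(\,|\,)$ be the multiple of the Killing form of $\mathfrak g$ with $(H_\theta|H_\theta)=2$, where $\theta$ is the highest root (for a Cartan subalgebra and a base of the roots) and $H_\theta$ its coroot. Let $R$ be a commutative $k$-algebra, $S=\operatorname{Spec} R$, and let $\operatorname{Spec}R'\to S$ be an étale $\Gamma$-torsor (the fibre over a marking $\sigma$ of a $\Gamma$-covering of curves unramified along $\sigma$). Put $\mathcal L=R((t))$, $F^n\mathcal L=t^nR[[t]]$, let $\sigma^*\mathfrak h=(R'\otimes_k\mathfrak g)^\Gamma$ (invariants for the diagonal action), $\mathfrak h_{\mathcal L}=\mathcal L\otimes_R\sigma^*\mathfrak h$ and $F^n\mathfrak h_{\mathcal L}=F^n\mathcal L\otimes_R\sigma^*\mathfrak h$. The form $(\,|\,)$ induces $R$- and $\mathcal L$-bilinear forms on $\sigma^*\mathfrak h$ and $\mathfrak h_{\mathcal L}$. Let $\theta_{\mathcal L/S}$ be the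 module of continuous $R$-linear derivations of $\mathcal L$, $\omega$ its $\mathcal L$-dual, $d:\mathcal L\to\omega$ the universal derivation (extended to $\mathfrak h_{\mathcal L}$ as $d\otimes 1$), and $\operatorname{Res}(\sum a_it^i\,dt)=a_{-1}$. For a Lie algebra $\mathfrak b$ over $R$ with a decreasing filtration $F^n$ put $\overline U\mathfrak b=\varprojlim_n U\mathfrak b/(U\mathfrak b\circ F^n)$. * $\hat{\mathfrak l}=\mathcal L\oplus\hbar R$ with $\hbar$ central and $[f,g]=\hbar\operatorname{Res}(g\,df)$ for $f,g\in\mathcal L$; it is filtered by the $F^n\mathcal L$, $n\ge0$. * $\hat{\mathfrak h}_{\mathcal L}=\mathfrak h_{\mathcal L}\oplus cR$ with $c$ central and $[X,Y]=[X,Y]_{\mathfrak h_{\mathcal L}}+c\operatorname{Res}(dX|Y)$ for $X,Y\in\mathfrak h_{\mathcal L}$; it is filtered by the $F^n\mathfrak h_{\mathcal L}$, $n\ge 0$. * $\overline{\mathfrak l_2}\subset\overline U\hat{\mathfrak l}$ is the closure of the $R$-span $\mathfrak l_2$ of $\hbar$ and all $f\circ g$ with $f,g\in\mathcal L$. The class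 modulo $\hbar$ of an element of $\overline{\mathfrak l_2}$ is regarded as a symmetric bilinear form on $\omega$, where $f\circ g$ corresponds to $(\alpha,\beta)\mapsto\frac12\big(\operatorname{Res}(f\alpha)\operatorname{Res}(g\beta)+\operatorname{Res}(f\beta)\operatorname{Res}(g\alpha)\big)$. * $\hat\theta_{\mathcal L/S}$ is the set of pairs $(D,u)\in\theta_{\mathcal L/S}\times\overline{\mathfrak l_2}$ such that $2u$ modulo $\hbar$ is the form $(\alpha,\beta)\mapsto\operatorname{Res}(D(\alpha)\beta)$. Put $\hat C(D,u)=u$, $c_0=(0,-\hbar)$ and $T=-\hat C/\hbar:\hat\theta_{\mathcal L/S}\to\overline U\hat{\mathfrak l}[1/\hbar]$. * $\mathfrak c=\sum_i X_i\otimes Y_i\in\sigma^*\mathfrak h\otimes_R\sigma^*\mathfrak h$ is the Casimir element, i.e. $\sum_i (Z|X_i)Y_i=Z$ for all $Z$. * $\hat\gamma_{\mathfrak c}:\overline{\mathfrak l_2}\to\overline U\hat{\mathfrak h}_{\mathcal L}$ is the continuous $R$-linear map with $f\circ g\mapsto\sum_i fX_i\circ gY_i$ and $\hbar\mapsto c\dim\mathfrak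 g$; put $\hat C_{\mathfrak h}=\hat\gamma_{\mathfrak c}\hat C$. **Proposition.** There is $\check h\in k$ with $\sum_i[X_i,[Y_i,Z]]=2\check h Z$ for all $Z\in\mathfrak h_{\mathcal L}$. The map $T$ is injective and its image is closed under commutators, so that $\hat\theta_{\mathcal L/S}$ (the Virasoro algebra) has a unique structure of a Lie algebra over $R$ for which $T$ is a homomorphism of Lie algebras, and $T(c_0)=1$. For this structure the Sugawara map $$T_{\mathfrak h}=-\frac{\hat C_{\mathfrak h}}{c+\check h}:\hat\theta_{\mathcal L/S}\to\overline U\hat{\mathfrak h}_{\mathcal L}\Big[\frac1{c+\check h}\Big]$$ is a homomorphism of Lie algebras, and $T_{\mathfrak h}(c_0)=\dfrac{c\dim\mathfrak g}{c+\check h}$. -/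

import Mathlib

noncomputable section

namespace TwistedSugawara

open scoped TensorProduct LaurentSeries

/-! ### Laurent series: filtration, continuous derivations, differentials, residue -/

section Laurent

variable (R : Type*) [CommRing R]

/-- The coefficientwise `R`-algebra structure on `R((t))` (a shortcut instance, which takes precedence
over a propositionally equal one). -/
instance laurentAlgebra : Algebra R R⸨X⸩ := HahnSeries.instAlgebra

/-- `F^n R((t)) = t^n R[[t]]`. -/
def fil (n : ℤ) : Submodule R R⸨X⸩ where
  carrier := {f | ∀ i < n, f.coeff i = 0}
  zero_mem' := fun _ _ => rfl
  add_mem' := fun hf hg i hi => by simp [hf i hi, hg i hi]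
  smul_mem' := fun r f hf i hi => by simp [hf i hi]

variable {R}

theorem fil_anti {m n : ℤ} (h : m ≤ n) : fil R n ≤ fil R m :=
  fun _ hf i hi => hf i (lt_of_lt_of_le hi h)

theorem mul_mem_fil {m n : ℤ} {f g : R⸨X⸩} (hf : f ∈ fil R m) (hg : g ∈ fil R n) :
    f * g ∈ fil R (m + n) := by
  intro i hi
  rw [HahnSeries.coeff_mul]
  refine Finset.sum_eq_zero fun p hp => ?_
  have hp' := (Finset.mem_antidiagonal.mp hp)
  by_cases h : p.1 < m
  · rw [hf _ h, zero_mul]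
  · rw [hg p.2 (by omega), mul_zero]

theorem exists_mem_fil (f : R⸨X⸩) : ∃ n : ℕ, f ∈ fil R (-n) := by
  by_cases h : f = 0
  · exact ⟨0, by subst h; exact (fil R _).zero_mem⟩
  · refine ⟨(-f.order).toNat, fun i hi => HahnSeries.coeff_eq_zero_of_lt_order ?_⟩
    omega

variable (R)

/-- The `R((t))`-module `θ` of continuous `R`-linear derivations of `R((t))`. -/
def theta : Submodule R⸨X⸩ (Derivation R R⸨X⸩ R⸨X⸩) where
  carrier := {D | ∀ n : ℤ, ∃ m : ℤ, ∀ f ∈ fil R m, D f ∈ fil R n}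
  zero_mem' := fun n => ⟨n, fun _ _ => (fil R n).zero_mem⟩
  add_mem' := by
    intro D E hD hE n
    obtain ⟨m, hm⟩ := hD n
    obtain ⟨m', hm'⟩ := hE n
    exact ⟨max m m', fun f hf => (fil R n).add_mem (hm f (fil_anti (le_max_left _ _) hf))
      (hm' f (fil_anti (le_max_right _ _) hf))⟩
  smul_mem' := by
    intro g D hD n
    obtain ⟨j, hj⟩ := exists_mem_fil g
    obtain ⟨m, hm⟩ := hD (n + j)
    refine ⟨m, fun f hf => ?_⟩
    have := mul_mem_fil hj (hm f hf)
    rwa [show -(j : ℤ) + (n + j) = n by ring] at this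

/-- The module `ω` of continuous differentials: the `R((t))`-dual of `θ`. -/
abbrev Omega := theta R →ₗ[R⸨X⸩] R⸨X⸩

/-- The universal derivation `d : R((t)) → ω`, `(df)(D) = D f`. -/
def dif : R⸨X⸩ →ₗ[R] Omega R where
  toFun f :=
    { toFun := fun D => (D : Derivation R R⸨X⸩ R⸨X⸩) f
      map_add' := fun _ _ => rfl
      map_smul' := fun _ _ => rfl }
  map_add' f g := by ext D; simp
  map_smul' r f := by ext D; simp

/-- The Euler operator `t d/dt` as a linear map. -/
def eulerLin : R⸨X⸩ →ₗ[R] R⸨X⸩ where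
  toFun f := ⟨fun n => (n : R) * f.coeff n,
    f.isPWO_support.mono fun n hn => by
      simp only [Function.mem_support] at hn ⊢
      exact fun h => hn (by simp [h])⟩
  map_add' f g := by ext n; simp [mul_add]
  map_smul' r f := by ext n; simp [mul_left_comm]

theorem eulerLin_coeff (f : R⸨X⸩) (n : ℤ) : (eulerLin R f).coeff n = n * f.coeff n := rfl

theorem eulerLin_support (f : R⸨X⸩) : (eulerLin R f).support ⊆ f.support := fun n hn => by
  simp only [HahnSeries.mem_support, eulerLin_coeff] at hn ⊢
  exact fun h => hn (by simp [h])

theorem eulerLin_mul (f g : R⸨X⸩) :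
    eulerLin R (f * g) = f * eulerLin R g + g * eulerLin R f := by
  ext n
  rw [mul_comm g, HahnSeries.coeff_add, eulerLin_coeff, HahnSeries.coeff_mul,
    HahnSeries.coeff_mul_right' g.isPWO_support (eulerLin_support R g),
    HahnSeries.coeff_mul_left' f.isPWO_support (eulerLin_support R f), Finset.mul_sum,
    ← Finset.sum_add_distrib]
  refine Finset.sum_congr rfl fun p hp => ?_
  have hp' := (Finset.mem_antidiagonal.mp hp)
  rw [eulerLin_coeff, eulerLin_coeff, ← hp'.2.2]
  push_cast
  ring

/-- The derivation `d/dt = t⁻¹ (t d/dt)` of `R((t))`. -/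
def ddtDer : Derivation R R⸨X⸩ R⸨X⸩ where
  toLinearMap := LinearMap.mulLeft R (HahnSeries.single (-1) 1) ∘ₗ eulerLin R
  map_one_eq_zero' := by
    have : eulerLin R 1 = 0 := by
      ext n
      by_cases h : n = 0
      · subst h; simp [eulerLin_coeff]
      · simp [eulerLin_coeff, HahnSeries.coeff_one, h]
    simp [this]
  leibniz' f g := by
    simp only [LinearMap.comp_apply, LinearMap.mulLeft_apply, eulerLin_mul, smul_eq_mul]
    ring

theorem ddtDer_apply (f : R⸨X⸩) :
    ddtDer R f = HahnSeries.single (-1) 1 * eulerLin R f := rfl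

theorem ddtDer_coeff (f : R⸨X⸩) (n : ℤ) :
    (ddtDer R f).coeff n = ((n + 1 : ℤ) : R) * f.coeff (n + 1) := by
  have := HahnSeries.coeff_single_mul_add (r := (1 : R)) (x := eulerLin R f) (a := n + 1)
    (b := (-1 : ℤ))
  rw [show n + 1 + -1 = n by ring] at this
  rw [ddtDer_apply, this, one_mul, eulerLin_coeff]

theorem ddtDer_mem_fil {f : R⸨X⸩} {n : ℤ} (hf : f ∈ fil R n) : ddtDer R f ∈ fil R (n - 1) :=
  fun i hi => by rw [ddtDer_coeff, hf _ (by omega), mul_zero]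

/-- `d/dt` as an element of `θ`. -/
def ddt : theta R :=
  ⟨ddtDer R, fun n => ⟨n + 1, fun f hf => by simpa using ddtDer_mem_fil R hf⟩⟩

/-- The residue `Res : ω → R`; as `α = α(d/dt) dt`, it is the coefficient of `t⁻¹` in `α(d/dt)`. -/
def res : Omega R →ₗ[R] R where
  toFun α := (α (ddt R)).coeff (-1)
  map_add' _ _ := by simp
  map_smul' _ _ := by simp

theorem res_smul_dif (f g : R⸨X⸩) : res R (g • dif R f) = (g * ddtDer R f).coeff (-1) := rfl

theorem res_dif (f : R⸨X⸩) : res R (dif R f) = 0 := by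
  change (ddtDer R f).coeff (-1) = 0
  simp [ddtDer_coeff]

theorem dif_mul (f g : R⸨X⸩) : dif R (f * g) = f • dif R g + g • dif R f := by
  ext1 D
  simp [dif]

/-- The `R`-bilinear map `(f, g) ↦ g df` with values in `ω`. -/
def smulDif : R⸨X⸩ →ₗ[R] R⸨X⸩ →ₗ[R] Omega R :=
  LinearMap.mk₂ R (fun f g => g • dif R f) (fun _ _ _ => by simp) (fun c f g => by
      rw [map_smul, smul_comm])
    (fun _ _ _ => add_smul _ _ _) (fun _ _ _ => smul_assoc _ _ _)

/-- The pairing `(f, g) ↦ Res (g df)`. -/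
def resPair : R⸨X⸩ →ₗ[R] R⸨X⸩ →ₗ[R] R := (smulDif R).compr₂ (res R)

theorem resPair_apply (f g : R⸨X⸩) : resPair R f g = res R (g • dif R f) := rfl

theorem resPair_skew (f g : R⸨X⸩) : resPair R f g = - resPair R g f := by
  have h := res_dif R (f * g)
  rw [dif_mul, map_add] at h
  rw [resPair_apply, resPair_apply]
  linear_combination h

theorem resPair_cyc (f g h : R⸨X⸩) :
    resPair R f (g * h) = resPair R (f * g) h - resPair R g (f * h) := by
  simp only [resPair_apply, dif_mul, smul_add, map_add, smul_smul]
  rw [mul_comm h f, mul_comm h g]; ring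

theorem resPair_eq_zero {f g : R⸨X⸩} {j m : ℤ} (hf : f ∈ fil R m) (hg : g ∈ fil R (-j))
    (h : j < m) : resPair R f g = 0 := by
  rw [resPair_apply, res_smul_dif]
  exact mul_mem_fil hg (ddtDer_mem_fil R hf) _ (by omega)

end Laurent

/-! ### Central extensions and completed enveloping algebras -/

section CentralExtension

variable {R 𝔞 : Type*} [CommRing R] [LieRing 𝔞] [LieAlgebra R 𝔞]

variable (R 𝔞) in
/-- An `R`-valued 2-cocycle on the Lie algebra `𝔞`. -/
structure Cocycle where
  form : 𝔞 →ₗ[R] 𝔞 →ₗ[R] R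
  self : ∀ x, form x x = 0
  cyc : ∀ x y z, form x ⁅y, z⁆ = form ⁅x, y⁆ z + form y ⁅x, z⁆

/-- The central extension `𝔞 ⊕ R` defined by a cocycle `ψ`, with bracket
`[(x, r), (y, s)] = ([x, y], ψ(x, y))`. -/
def CentralExt (_ψ : Cocycle R 𝔞) := 𝔞 × R

variable (ψ : Cocycle R 𝔞)

instance : AddCommGroup (CentralExt ψ) := inferInstanceAs (AddCommGroup (𝔞 × R))
instance : Module R (CentralExt ψ) := inferInstanceAs (Module R (𝔞 × R))

/-- The (linear, non-multiplicative) inclusion `𝔞 → 𝔞 ⊕ R`. -/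
def CentralExt.inl : 𝔞 →ₗ[R] CentralExt ψ := LinearMap.inl R 𝔞 R

/-- The central generator `(0, 1)`. -/
def CentralExt.gen : CentralExt ψ := ((0 : 𝔞), (1 : R))

instance : LieRing (CentralExt ψ) where
  bracket x y := (⁅x.1, y.1⁆, ψ.form x.1 y.1)
  add_lie x y z := Prod.ext (add_lie _ _ _) (by
    change ψ.form (x.1 + y.1) z.1 = _ ; rw [map_add]; rfl)
  lie_add x y z := Prod.ext (lie_add _ _ _) (map_add _ _ _)
  lie_self x := Prod.ext (lie_self _) (ψ.self _)
  leibniz_lie x y z := Prod.ext (leibniz_lie _ _ _) (ψ.cyc _ _ _)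

theorem CentralExt.bracket_def (x y : CentralExt ψ) :
    ⁅x, y⁆ = ((⁅x.1, y.1⁆, ψ.form x.1 y.1) : 𝔞 × R) := rfl

instance : LieAlgebra R (CentralExt ψ) where
  lie_smul r x y := Prod.ext (lie_smul _ _ _) (map_smul _ _ _)

theorem CentralExt.inl_lie_inl (x y : 𝔞) :
    ⁅CentralExt.inl ψ x, CentralExt.inl ψ y⁆ =
      CentralExt.inl ψ ⁅x, y⁆ + ψ.form x y • CentralExt.gen ψ :=
  Prod.ext (by
    change ⁅x, y⁆ = ⁅x, y⁆ + ψ.form x y • (0 : 𝔞)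
    simp) (by
    change ψ.form x y = 0 + ψ.form x y * 1
    simp)

theorem CentralExt.gen_lie (x : CentralExt ψ) : ⁅CentralExt.gen ψ, x⁆ = 0 :=
  Prod.ext (zero_lie _) (by change ψ.form 0 x.1 = 0; simp)

theorem CentralExt.eq_inl_add (x : CentralExt ψ) :
    x = CentralExt.inl ψ x.1 + x.2 • CentralExt.gen ψ :=
  Prod.ext (by change x.1 = x.1 + x.2 • (0 : 𝔞); simp) (by
    change x.2 = 0 + x.2 * 1; simp)

end CentralExtension

section Completion

attribute [local instance 100] LieRing.ofAssociativeRing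

variable {R 𝔟 : Type*} [CommRing R] [LieRing 𝔟] [LieAlgebra R 𝔟]

/-- A subalgebra of the enveloping algebra which contains the Lie algebra is everything. -/
theorem mem_of_subalgebra (S : Subalgebra R (UniversalEnvelopingAlgebra R 𝔟)) (h : ∀ x, UniversalEnvelopingAlgebra.ι R x ∈ S) (u : (UniversalEnvelopingAlgebra R 𝔟)) : u ∈ S := by
  let f : 𝔟 →ₗ⁅R⁆ S :=
    { toFun := fun x => ⟨UniversalEnvelopingAlgebra.ι R x, h x⟩
      map_add' := fun x y => Subtype.ext (map_add _ _ _)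
      map_smul' := fun r x => Subtype.ext (map_smul _ _ _)
      map_lie' := fun {x y} => Subtype.ext (LieHom.map_lie _ x y) }
  have : S.val.comp (UniversalEnvelopingAlgebra.lift R f) = AlgHom.id R (UniversalEnvelopingAlgebra R 𝔟) := by
    apply UniversalEnvelopingAlgebra.hom_ext
    ext x
    simp [f]
  have h2 : S.val (UniversalEnvelopingAlgebra.lift R f u) = u := congrArg (fun g => g u) this
  rw [← h2]
  exact (UniversalEnvelopingAlgebra.lift R f u).2

variable (R 𝔟) in
/-- A decreasing filtration `F⁰ ⊇ F¹ ⊇ ⋯` of a Lie algebra for which every `ad x` is continuous. -/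
structure LieFiltration where
  F : ℕ → Submodule R 𝔟
  anti : ∀ {m n}, m ≤ n → F n ≤ F m
  lie_mem : ∀ (x : 𝔟) (n : ℕ), ∃ m, ∀ y ∈ F m, ⁅y, x⁆ ∈ F n

/-- The enveloping algebra `U𝔟`, to be topologized by the left ideals `U𝔟 ∘ Fⁿ`. -/
def FEnv (_Φ : LieFiltration R 𝔟) := UniversalEnvelopingAlgebra R 𝔟

variable (Φ : LieFiltration R 𝔟)

instance : Ring (FEnv Φ) := inferInstanceAs (Ring (UniversalEnvelopingAlgebra R 𝔟))
instance : Algebra R (FEnv Φ) := inferInstanceAs (Algebra R (UniversalEnvelopingAlgebra R 𝔟))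

/-- The canonical linear map `𝔟 → U𝔟`. -/
def FEnv.ι : 𝔟 →ₗ[R] FEnv Φ := (UniversalEnvelopingAlgebra.ι R (L := 𝔟) : 𝔟 →ₗ[R] (UniversalEnvelopingAlgebra R 𝔟))

theorem FEnv.ι_mul (x y : 𝔟) :
    FEnv.ι Φ x * FEnv.ι Φ y = FEnv.ι Φ y * FEnv.ι Φ x + FEnv.ι Φ ⁅x, y⁆ := by
  have h := LieHom.map_lie (UniversalEnvelopingAlgebra.ι R (L := 𝔟)) x y
  rw [LieRing.of_associative_ring_bracket] at h
  exact sub_eq_iff_eq_add'.mp h.symm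

theorem FEnv.mem_of_subalgebra (S : Subalgebra R (FEnv Φ)) (h : ∀ x, FEnv.ι Φ x ∈ S)
    (u : FEnv Φ) : u ∈ S :=
  TwistedSugawara.mem_of_subalgebra (R := R) (𝔟 := 𝔟) S h u

/-- The universal property of the enveloping algebra. -/
def FEnv.lift {A : Type*} [Ring A] [Algebra R A] (f : 𝔟 →ₗ⁅R⁆ A) : FEnv Φ →ₐ[R] A :=
  UniversalEnvelopingAlgebra.lift R f

theorem FEnv.lift_ι {A : Type*} [Ring A] [Algebra R A] (f : 𝔟 →ₗ⁅R⁆ A) (x : 𝔟) :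
    FEnv.lift Φ f (FEnv.ι Φ x) = f x :=
  UniversalEnvelopingAlgebra.lift_ι_apply R f x

/-- The left ideal `U𝔟 ∘ Fⁿ`. -/
def leftIdeal (n : ℕ) : Ideal (FEnv Φ) := Ideal.span (FEnv.ι Φ '' (Φ.F n : Set 𝔟))

theorem leftIdeal_anti {m n : ℕ} (h : m ≤ n) : leftIdeal Φ n ≤ leftIdeal Φ m :=
  Ideal.span_mono (Set.image_mono (Φ.anti h))

theorem leftIdeal_mul (u : FEnv Φ) (n : ℕ) :
    ∃ m, ∀ v ∈ leftIdeal Φ m, v * u ∈ leftIdeal Φ n := by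
  let S : Subalgebra R (FEnv Φ) :=
    { carrier := {u : FEnv Φ | ∀ n, ∃ m, ∀ v ∈ leftIdeal Φ m, v * u ∈ leftIdeal Φ n}
      mul_mem' := by
        intro a b ha hb n
        obtain ⟨m, hm⟩ := hb n
        obtain ⟨m', hm'⟩ := ha m
        refine ⟨m', fun v hv => ?_⟩
        have := hm _ (hm' v hv)
        rwa [mul_assoc] at this
      add_mem' := by
        intro a b ha hb n
        obtain ⟨m, hm⟩ := hb n
        obtain ⟨m', hm'⟩ := ha n
        refine ⟨max m m', fun v hv => ?_⟩
        rw [mul_add]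
        exact add_mem (hm' v (leftIdeal_anti Φ (le_max_right _ _) hv))
          (hm v (leftIdeal_anti Φ (le_max_left _ _) hv))
      algebraMap_mem' := by
        intro r n
        refine ⟨n, fun v hv => ?_⟩
        have : (v * algebraMap R (FEnv Φ) r : FEnv Φ) = algebraMap R (FEnv Φ) r * v :=
          (Algebra.commutes r v).symm
        exact (congrArg (· ∈ leftIdeal Φ n) this).mpr (Ideal.mul_mem_left _ _ hv) }
  refine FEnv.mem_of_subalgebra Φ S (fun x n => ?_) u n
  obtain ⟨m, hm⟩ := Φ.lie_mem x n
  refine ⟨max m n, fun v hv => ?_⟩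
  induction hv using Submodule.span_induction with
  | mem v hv =>
    obtain ⟨y, hy, rfl⟩ := hv
    rw [FEnv.ι_mul]
    refine add_mem (Ideal.mul_mem_left _ _ ?_) ?_
    · exact Ideal.subset_span ⟨y, Φ.anti (le_max_right m n) hy, rfl⟩
    · exact Ideal.subset_span ⟨_, hm y (Φ.anti (le_max_left m n) hy), rfl⟩
  | zero => rw [zero_mul]; exact zero_mem _
  | add a b _ _ ha hb => rw [add_mul]; exact add_mem ha hb
  | smul a b _ hb => rw [smul_eq_mul, mul_assoc]; exact Ideal.mul_mem_left _ _ hb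

theorem leftIdeal_basis :
    RingSubgroupsBasis (fun n => (leftIdeal Φ n).toAddSubgroup : ℕ → AddSubgroup (FEnv Φ)) where
  inter i j := ⟨max i j, le_inf (leftIdeal_anti Φ (le_max_left i j))
    (leftIdeal_anti Φ (le_max_right i j))⟩
  mul i := ⟨i, by
    rintro _ ⟨a, _, b, hb, rfl⟩
    exact Ideal.mul_mem_left _ _ hb⟩
  leftMul x i := ⟨i, fun _ hb => Ideal.mul_mem_left _ _ hb⟩
  rightMul x i := by
    obtain ⟨m, hm⟩ := leftIdeal_mul Φ x i
    exact ⟨m, fun v hv => hm v hv⟩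

instance : TopologicalSpace (FEnv Φ) := (leftIdeal_basis Φ).topology
instance : IsTopologicalRing (FEnv Φ) :=
  (leftIdeal_basis Φ).toRingFilterBasis.isTopologicalRing
instance : UniformSpace (FEnv Φ) := IsTopologicalAddGroup.rightUniformSpace (FEnv Φ)
instance : IsUniformAddGroup (FEnv Φ) := isUniformAddGroup_of_addCommGroup
instance : UniformContinuousConstSMul R (FEnv Φ) where
  uniformContinuous_const_smul r := by
    have : Continuous fun x : FEnv Φ => r • x := by
      simp only [Algebra.smul_def]
      exact continuous_const_mul _
    exact uniformContinuous_addMonoidHom_of_continuous (f := DistribSMul.toAddMonoidHom (FEnv Φ) r)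
      this

theorem nhds_zero_basis :
    (nhds (0 : FEnv Φ)).HasBasis (fun _ : ℕ => True) (fun n => (leftIdeal Φ n : Set (FEnv Φ))) :=
  (leftIdeal_basis Φ).hasBasis_nhds_zero

/-- The completion on the right `Ū𝔟 = lim U𝔟 / U𝔟 ∘ Fⁿ`. -/
abbrev CEnv := UniformSpace.Completion (FEnv Φ)

/-- The canonical algebra homomorphism `U𝔟 → Ū𝔟`. -/
def CEnv.of : FEnv Φ →ₐ[R] CEnv Φ :=
  { (UniformSpace.Completion.coeRingHom : FEnv Φ →+* CEnv Φ) with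
    commutes' := fun _ => rfl }

/-- The image in `Ū𝔟` of an element of the centre of `𝔟` is central. -/
theorem of_mem_center {z : 𝔟} (hz : ∀ x : 𝔟, ⁅z, x⁆ = 0) :
    CEnv.of Φ (FEnv.ι Φ z) ∈ Subring.center (CEnv Φ) := by
  have h1 : ∀ u : FEnv Φ, u * FEnv.ι Φ z = FEnv.ι Φ z * u := by
    intro u
    have h2 : ∀ x, FEnv.ι Φ x ∈ Subalgebra.centralizer R {FEnv.ι Φ z} := fun x => by
      rw [Subalgebra.mem_centralizer_iff]
      rintro _ rfl
      rw [FEnv.ι_mul, hz, map_zero, add_zero]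
    exact ((Subalgebra.mem_centralizer_iff R).mp (FEnv.mem_of_subalgebra Φ _ h2 u) _ rfl).symm
  rw [Subring.mem_center_iff]
  intro a
  induction a using UniformSpace.Completion.induction_on with
  | hp => exact isClosed_eq (continuous_mul_const _) (continuous_const_mul _)
  | ih u =>
    have := congrArg (CEnv.of Φ) (h1 u)
    rw [map_mul, map_mul] at this
    exact this

end Completion

/-! ### Inverting a central element -/

section Away

variable {A : Type*} [Ring A]

instance centralOreSet (z : Subring.center A) :
    OreLocalization.OreSet (Submonoid.powers (z : A)) where
  ore_right_cancel r₁ r₂ s h := ⟨s, by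
    have hc : ∀ r : A, (s : A) * r = r * s := by
      obtain ⟨n, hn⟩ := s.2
      intro r
      rw [← hn]
      exact ((Subring.mem_center_iff.mp (pow_mem z.2 n)) r).symm
    rw [hc, hc, h]⟩
  oreNum r _ := r
  oreDenom _ s := s
  ore_eq r s := by
    obtain ⟨n, hn⟩ := s.2
    rw [← hn]
    exact ((Subring.mem_center_iff.mp (pow_mem z.2 n)) r).symm

/-- The ring `A[z⁻¹]` for a central element `z` of `A`. -/
abbrev Away (z : Subring.center A) := OreLocalization (Submonoid.powers (z : A)) A

/-- The element `z⁻¹` of `A[z⁻¹]`. -/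
def Away.inv (z : Subring.center A) : Away z :=
  OreLocalization.oreDiv 1 ⟨z, Submonoid.mem_powers _⟩

/-- The canonical homomorphism `A → A[z⁻¹]`. -/
def Away.of (R : Type*) [CommRing R] [Algebra R A] (z : Subring.center A) : A →ₗ[R] Away z where
  toFun a := OreLocalization.numeratorRingHom a
  map_add' := map_add _
  map_smul' r a := by
    simp only [OreLocalization.numeratorRingHom_apply, RingHom.id_apply]
    rw [OreLocalization.smul_oreDiv]
    exact congrArg (fun b => OreLocalization.oreDiv b _) (smul_one_mul r a).symm

end Away

section Extend

variable {R 𝔟 : Type*} [CommRing R] [LieRing 𝔟] [LieAlgebra R 𝔟] (Φ : LieFiltration R 𝔟)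

/-- The continuous extension to `Ū𝔟` of a continuous linear map on `U𝔟`. -/
def extend {N : Type*} [AddCommGroup N] [Module R N] [UniformSpace N] [IsUniformAddGroup N]
    [CompleteSpace N] [T2Space N] [ContinuousConstSMul R N]
    (φ : FEnv Φ →ₗ[R] N) (hφ : Continuous φ) : CEnv Φ →ₗ[R] N :=
  { φ.toAddMonoidHom.extension hφ with
    map_smul' := fun r u => by
      induction u using UniformSpace.Completion.induction_on with
      | hp =>
        refine isClosed_eq ?_ ?_
        · exact (AddMonoidHom.continuous_extension _ hφ).comp (continuous_const_smul r)
        · exact (AddMonoidHom.continuous_extension _ hφ).const_smul r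
      | ih u =>
        have h := AddMonoidHom.extension_coe φ.toAddMonoidHom hφ
        change φ.toAddMonoidHom.extension hφ (r • (u : CEnv Φ)) =
          r • φ.toAddMonoidHom.extension hφ u
        rw [← UniformSpace.Completion.coe_smul, h, h]
        exact φ.map_smul r u }

theorem extend_of {N : Type*} [AddCommGroup N] [Module R N] [UniformSpace N]
    [IsUniformAddGroup N] [CompleteSpace N] [T2Space N] [ContinuousConstSMul R N]
    (φ : FEnv Φ →ₗ[R] N) (hφ : Continuous φ) (u : FEnv Φ) :
    extend Φ φ hφ (CEnv.of Φ u) = φ u :=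
  AddMonoidHom.extension_coe φ.toAddMonoidHom hφ u

/-- The extension to `Ū𝔟` of a linear map on `U𝔟` which kills some `U𝔟 ∘ Fⁿ`. -/
def extendDiscrete {N : Type*} [AddCommGroup N] [Module R N] (φ : FEnv Φ →ₗ[R] N)
    (hφ : ∃ n, ∀ u ∈ leftIdeal Φ n, φ u = 0) : CEnv Φ →ₗ[R] N :=
  letI : UniformSpace N := ⊥
  haveI : DiscreteUniformity N := ⟨rfl⟩
  haveI : IsUniformAddGroup N := ⟨DiscreteUniformity.uniformContinuous _ _⟩
  haveI : ContinuousConstSMul R N := ⟨fun _ => continuous_of_discreteTopology⟩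
  extend Φ φ (by
    obtain ⟨n, hn⟩ := hφ
    refine continuous_of_continuousAt_zero φ.toAddMonoidHom ?_
    refine ContinuousAt.congr (f := fun _ => 0) continuousAt_const ?_
    filter_upwards [(nhds_zero_basis Φ).mem_of_mem (i := n) trivial] with u hu
    exact (hn u hu).symm)

theorem extendDiscrete_of {N : Type*} [AddCommGroup N] [Module R N] (φ : FEnv Φ →ₗ[R] N)
    (hφ : ∃ n, ∀ u ∈ leftIdeal Φ n, φ u = 0) (u : FEnv Φ) :
    extendDiscrete Φ φ hφ (CEnv.of Φ u) = φ u := by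
  letI : UniformSpace N := ⊥
  haveI : DiscreteUniformity N := ⟨rfl⟩
  haveI : IsUniformAddGroup N := ⟨DiscreteUniformity.uniformContinuous _ _⟩
  haveI : ContinuousConstSMul R N := ⟨fun _ => continuous_of_discreteTopology⟩
  exact extend_of Φ φ _ u

/-- The extension to `Ū𝔟 → Ū𝔟'` of a continuous linear map `U𝔟 → U𝔟'`. -/
def extendMap {𝔟' : Type*} [LieRing 𝔟'] [LieAlgebra R 𝔟'] (Ψ : LieFiltration R 𝔟')
    (φ : FEnv Φ →ₗ[R] FEnv Ψ)
    (hφ : ∀ n, ∃ m, ∀ u ∈ leftIdeal Φ m, φ u ∈ leftIdeal Ψ n) : CEnv Φ →ₗ[R] CEnv Ψ :=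
  extend Φ ((CEnv.of Ψ).toLinearMap ∘ₗ φ) (by
    refine (UniformSpace.Completion.continuous_coe (FEnv Ψ)).comp ?_
    refine continuous_of_continuousAt_zero φ.toAddMonoidHom ?_
    rw [ContinuousAt, map_zero, ((nhds_zero_basis Φ).tendsto_iff (nhds_zero_basis Ψ))]
    intro n _
    obtain ⟨m, hm⟩ := hφ n
    exact ⟨m, trivial, hm⟩)

end Extend

/-! ### The Heisenberg algebra of `R((t))` -/

section Heisenberg

attribute [local instance 100] LieRing.ofAssociativeRing LieAlgebra.ofAssociativeAlgebra

variable (R : Type*) [CommRing R]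

theorem resPair_self (f : R⸨X⸩) : resPair R f f = 0 := by
  have h : resPair R f f = (f * eulerLin R f).coeff 0 := by
    rw [resPair_apply, res_smul_dif, ddtDer_apply, mul_left_comm]
    have := HahnSeries.coeff_single_mul_add (r := (1 : R)) (x := f * eulerLin R f) (a := 0)
      (b := (-1 : ℤ))
    rw [show (0 : ℤ) + -1 = -1 by ring] at this
    rw [this, one_mul]
  rw [h, HahnSeries.coeff_mul_right' f.isPWO_support (eulerLin_support R f)]
  refine Finset.sum_involution (fun p _ => (p.2, p.1)) ?_ ?_ ?_ ?_
  · intro p hp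
    have hp' := (Finset.mem_antidiagonal.mp hp).2.2
    rw [eulerLin_coeff, eulerLin_coeff]
    have : ((p.1 : ℤ) : R) + ((p.2 : ℤ) : R) = 0 := by rw [← Int.cast_add, hp', Int.cast_zero]
    linear_combination f.coeff p.1 * f.coeff p.2 * this
  · intro p hp h0 h1
    have hp' := (Finset.mem_antidiagonal.mp hp).2.2
    have h2 : p.2 = p.1 := congrArg Prod.fst h1
    have h3 : p.2 = 0 := by omega
    rw [eulerLin_coeff, h3] at h0
    simp at h0
  · intro p hp
    have hp' := (Finset.mem_antidiagonal.mp hp)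
    exact Finset.mem_antidiagonal.mpr ⟨hp'.2.1, hp'.1, by rw [add_comm]; exact hp'.2.2⟩
  · intro p hp
    rfl

/-- The cocycle `(f, g) ↦ Res (g df)` on the abelian Lie algebra `𝔩 = R((t))`. -/
def lCocycle : Cocycle R R⸨X⸩ where
  form := resPair R
  self := resPair_self R
  cyc x y z := by
    simp only [LieRing.of_associative_ring_bracket, mul_comm, sub_self, map_zero,
      LinearMap.zero_apply, add_zero]

/-- The Heisenberg Lie algebra `𝔩̂ = 𝔩 ⊕ ħR`, with `[f + ħr, g + ħs] = ħ Res (g df)`. -/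
abbrev LHat := CentralExt (lCocycle R)

/-- The inclusion `𝔩 → 𝔩̂`. -/
def LHat.inc : R⸨X⸩ →ₗ[R] LHat R := CentralExt.inl (lCocycle R)

/-- The central element `ħ` of `𝔩̂`. -/
def LHat.hbar : LHat R := CentralExt.gen (lCocycle R)

theorem LHat.hbar_lie (x : LHat R) : ⁅LHat.hbar R, x⁆ = 0 := CentralExt.gen_lie (lCocycle R) x

/-- The filtration `Fⁿ𝔩̂ = Fⁿ𝔩`. -/
def lFil : LieFiltration R (LHat R) where
  F n := (fil R n).map (LHat.inc R)
  anti h := Submodule.map_mono (fil_anti (by exact_mod_cast h))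
  lie_mem x n := by
    obtain ⟨j, hj⟩ := exists_mem_fil x.1
    refine ⟨j + 1, ?_⟩
    rintro _ ⟨f, hf, rfl⟩
    have h1 : ⁅LHat.inc R f, x⁆ = 0 := Prod.ext
      (by
        change f * x.1 - x.1 * f = 0
        rw [mul_comm, sub_self])
      (by
        change resPair R f x.1 = 0
        exact resPair_eq_zero R hf hj (by push_cast; omega))
    rw [h1]
    exact zero_mem _

section Quad

variable {R} {M : Type*} [AddCommGroup M] [Module R M] (B : R⸨X⸩ →ₗ[R] R⸨X⸩ →ₗ[R] M) (z : M)

/-- The action of `f + ħr` on `R × 𝔩 × M` by `(a, g, m) ↦ (0, a f, B(f, g) + a r z)`. -/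
def quadEnd (x : LHat R) : Module.End R (R × R⸨X⸩ × M) where
  toFun v := (0, v.1 • x.1, B x.1 v.2.1 + (v.1 * x.2) • z)
  map_add' v w := by
    simp only [Prod.fst_add, Prod.snd_add, map_add, add_smul, add_mul, Prod.mk_add_mk, add_zero]
    congr 2
    abel
  map_smul' r v := by
    simp only [Prod.smul_fst, Prod.smul_snd, map_smul, smul_eq_mul, mul_assoc, mul_smul,
      RingHom.id_apply, Prod.smul_mk, mul_zero, smul_add]

theorem quadEnd_apply (x : LHat R) (v : R × R⸨X⸩ × M) :
    quadEnd B z x v = (0, v.1 • x.1, B x.1 v.2.1 + (v.1 * x.2) • z) := rfl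

variable (hB : ∀ f g, B f g - B g f = resPair R f g • z)

/-- The action of `𝔩̂` on `R × 𝔩 × M`. -/
def quadHom : LHat R →ₗ⁅R⁆ Module.End R (R × R⸨X⸩ × M) where
  toFun := quadEnd B z
  map_add' x y := LinearMap.ext fun v => by
    rw [LinearMap.add_apply, quadEnd_apply, quadEnd_apply, quadEnd_apply]
    change (_, v.1 • (x.1 + y.1), B (x.1 + y.1) v.2.1 + (v.1 * (x.2 + y.2)) • z) = _
    simp only [map_add, LinearMap.add_apply, mul_add, add_smul, smul_add, Prod.mk_add_mk,
      add_zero]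
    congr 2
    abel
  map_smul' r x := LinearMap.ext fun v => by
    rw [RingHom.id_apply, LinearMap.smul_apply, quadEnd_apply, quadEnd_apply]
    change (_, v.1 • (r • x.1), B (r • x.1) v.2.1 + (v.1 * (r * x.2)) • z) = _
    simp only [map_smul, LinearMap.smul_apply, Prod.smul_mk, smul_zero, smul_add, smul_smul,
      mul_left_comm, mul_comm]
  map_lie' {x y} := LinearMap.ext fun v => by
    rw [LieRing.of_associative_ring_bracket, LinearMap.sub_apply, Module.End.mul_apply,
      Module.End.mul_apply]
    simp only [quadEnd_apply]
    change (0, v.1 • (x.1 * y.1 - y.1 * x.1),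
      B (x.1 * y.1 - y.1 * x.1) v.2.1 + (v.1 * resPair R x.1 y.1) • z) = _
    rw [mul_comm y.1, sub_self]
    simp only [smul_zero, map_zero, LinearMap.zero_apply, zero_add, zero_smul, zero_mul, add_zero,
      map_smul, Prod.mk_sub_mk, sub_zero]
    rw [← smul_sub, hB, mul_smul]

/-- The linear map `U𝔩̂ → M` with `f ∘ g ↦ B(f, g)`, `ħ ↦ z`, `1 ↦ 0`, `f ↦ 0`, for `B` with
`B(f, g) - B(g, f) = Res (g df) z`. -/
def quad : FEnv (lFil R) →ₗ[R] M :=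
  (LinearMap.snd R R⸨X⸩ M ∘ₗ LinearMap.snd R R (R⸨X⸩ × M)) ∘ₗ
    (LinearMap.applyₗ ((1, 0, 0) : R × R⸨X⸩ × M)) ∘ₗ
      (FEnv.lift (lFil R) (quadHom B z hB)).toLinearMap

theorem lift_ι (x : LHat R) (v : R × R⸨X⸩ × M) :
    FEnv.lift (lFil R) (quadHom B z hB) (FEnv.ι (lFil R) x) v =
      (0, v.1 • x.1, B x.1 v.2.1 + (v.1 * x.2) • z) := by
  rw [FEnv.lift_ι]
  rfl

theorem quad_mul (f g : R⸨X⸩) :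
    quad B z hB (FEnv.ι (lFil R) (LHat.inc R f) * FEnv.ι (lFil R) (LHat.inc R g)) = B f g := by
  change (FEnv.lift (lFil R) (quadHom B z hB)
      (FEnv.ι (lFil R) (LHat.inc R f) * FEnv.ι (lFil R) (LHat.inc R g)) (1, 0, 0)).2.2 = _
  rw [map_mul, Module.End.mul_apply, lift_ι, lift_ι]
  change B f ((1 : R) • g) + ((0 : R) * 0) • z = B f g
  simp

theorem quad_hbar : quad B z hB (FEnv.ι (lFil R) (LHat.hbar R)) = z := by
  change (FEnv.lift (lFil R) (quadHom B z hB)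
      (FEnv.ι (lFil R) (LHat.hbar R)) (1, 0, 0)).2.2 = _
  rw [lift_ι]
  simp [LHat.hbar, CentralExt.gen]

theorem quad_mem (N : Submodule R M) (n : ℕ) (h : ∀ g, ∀ s ∈ fil R n, B g s ∈ N) :
    ∀ u ∈ leftIdeal (lFil R) n, quad B z hB u ∈ N := by
  let Q : Submodule R (R × R⸨X⸩ × M) := (⊥ : Submodule R R).prod ((fil R n).prod N)
  let S : Subalgebra R (FEnv (lFil R)) :=
    { carrier := {u | ∀ v ∈ Q, FEnv.lift (lFil R) (quadHom B z hB) u v ∈ Q}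
      mul_mem' := by
        intro a b ha hb v hv
        have := ha _ (hb v hv)
        rw [← Module.End.mul_apply, ← map_mul] at this
        exact this
      add_mem' := by
        intro a b ha hb v hv
        have := add_mem (ha v hv) (hb v hv)
        rw [← LinearMap.add_apply, ← map_add] at this
        exact this
      algebraMap_mem' := by
        intro r v hv
        rw [AlgHom.commutes, Module.algebraMap_end_apply]
        exact Q.smul_mem r hv }
  have hS : ∀ u, u ∈ S := FEnv.mem_of_subalgebra _ S fun x v hv => by
    rw [lift_ι]
    obtain ⟨h0, h1, -⟩ := hv
    have h0' : v.1 = 0 := h0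
    refine ⟨rfl, ?_, ?_⟩
    · simp [h0']
    · simpa [h0'] using h _ _ h1
  have hQ : ∀ u ∈ leftIdeal (lFil R) n,
      FEnv.lift (lFil R) (quadHom B z hB) u (1, 0, 0) ∈ Q := by
    intro u hu
    induction hu using Submodule.span_induction with
    | mem u hu =>
      obtain ⟨_, ⟨f, hf, rfl⟩, rfl⟩ := hu
      rw [lift_ι]
      refine ⟨rfl, ?_, ?_⟩
      · change (1 : R) • f ∈ fil R n
        rwa [one_smul]
      · change B f 0 + ((1 : R) * 0) • z ∈ N
        simp
    | zero =>
      rw [map_zero]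
      exact zero_mem Q
    | add a b _ _ ha hb =>
      have := add_mem ha hb
      rw [← LinearMap.add_apply, ← map_add] at this
      exact this
    | smul a b _ hb =>
      have := hS a _ hb
      rw [← Module.End.mul_apply, ← map_mul] at this
      exact this
  exact fun u hu => (hQ u hu).2.2

end Quad

/-- The linear form `f ↦ Res (f α)` on `R((t))`. -/
def resMul (α : Omega R) : R⸨X⸩ →ₗ[R] R where
  toFun f := res R (f • α)
  map_add' f g := by rw [add_smul, map_add]
  map_smul' r f := by rw [smul_assoc, map_smul, RingHom.id_apply]

/-- The bilinear form `(f, g) ↦ Res (f α) Res (g β) + Res (f β) Res (g α)` on `R((t))`. -/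
def symForm (α β : Omega R) : R⸨X⸩ →ₗ[R] R⸨X⸩ →ₗ[R] R :=
  (LinearMap.mul R R).compl₁₂ (resMul R α) (resMul R β) +
    (LinearMap.mul R R).compl₁₂ (resMul R β) (resMul R α)

theorem symForm_apply (α β : Omega R) (f g : R⸨X⸩) : symForm R α β f g =
    res R (f • α) * res R (g • β) + res R (f • β) * res R (g • α) := rfl

/-- The continuous linear form on `Ū𝔩̂` which sends `f ∘ g` to
`Res (f α) Res (g β) + Res (f β) Res (g α)` and `ħ` to `0`. On the closure of the span of `ħ` and the
`f ∘ g` it is twice the value at `(α, β)` of the symmetric bilinear form on `ω` given by the class modulo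
`ħ`. -/
def pairing (α β : Omega R) : CEnv (lFil R) →ₗ[R] R :=
  extendDiscrete (lFil R) (quad (symForm R α β) 0 (fun f g => by
    rw [symForm_apply, symForm_apply, smul_zero]; ring)) (by
    obtain ⟨a, ha⟩ := exists_mem_fil (α (ddt R))
    obtain ⟨b, hb⟩ := exists_mem_fil (β (ddt R))
    refine ⟨max a b, fun u hu => ?_⟩
    refine quad_mem (symForm R α β) 0 _ (⊥ : Submodule R R) (max a b) (fun g s hs => ?_) u hu
    have h1 : res R (s • α) = 0 := mul_mem_fil hs ha _ (by push_cast; omega)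
    have h2 : res R (s • β) = 0 := mul_mem_fil hs hb _ (by push_cast; omega)
    rw [symForm_apply, h1, h2, mul_zero, mul_zero, add_zero]
    exact zero_mem _)

end Heisenberg

/-! ### The normalized Killing form, the covering, and the twisted loop algebra -/

section Twisted

instance baseChangeLieAlgebra (k R R' 𝔤 : Type*) [CommRing k] [CommRing R] [CommRing R']
    [Algebra k R] [Algebra k R'] [Algebra R R'] [IsScalarTower k R R'] [LieRing 𝔤]
    [LieAlgebra k 𝔤] : LieAlgebra R (R' ⊗[k] 𝔤) where
  lie_smul r x y := by
    rw [← algebraMap_smul R' r y, lie_smul, algebraMap_smul]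

variable (k 𝔤 R R' Γ : Type*) [Field k] [IsAlgClosed k] [CharZero k]
  [LieRing 𝔤] [LieAlgebra k 𝔤] [FiniteDimensional k 𝔤] [LieAlgebra.IsSimple k 𝔤]
  [CommRing R] [Algebra k R] [CommRing R'] [Algebra k R'] [Algebra R R'] [IsScalarTower k R R']
  [Group Γ] [Fintype Γ]

/-- A choice of a maximal torus, a base and the highest root of a simple Lie algebra, which
normalizes its Killing form. -/
structure RootDatum where
  H : LieSubalgebra k 𝔤
  [cartan : H.IsCartanSubalgebra]
  base : (LieAlgebra.IsKilling.rootSystem H).Base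
  θ : H.root
  highest : ∀ α : H.root,
    (LieAlgebra.IsKilling.rootSystem H).root θ - (LieAlgebra.IsKilling.rootSystem H).root α ∈
      AddSubmonoid.closure ((LieAlgebra.IsKilling.rootSystem H).root '' base.support)

attribute [instance] RootDatum.cartan

/-- The coroot `H_θ` of the highest root. -/
def RootDatum.hθ {k 𝔤 : Type*} [Field k] [IsAlgClosed k] [CharZero k] [LieRing 𝔤]
    [LieAlgebra k 𝔤] [FiniteDimensional k 𝔤] [LieAlgebra.IsSimple k 𝔤] (P : RootDatum k 𝔤) : 𝔤 :=
  (LieAlgebra.IsKilling.coroot P.θ.1 : P.H)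

/-- The multiple `( | )` of the Killing form with `(H_θ | H_θ) = 2`. -/
def RootDatum.form {k 𝔤 : Type*} [Field k] [IsAlgClosed k] [CharZero k] [LieRing 𝔤]
    [LieAlgebra k 𝔤] [FiniteDimensional k 𝔤] [LieAlgebra.IsSimple k 𝔤] (P : RootDatum k 𝔤) :
    LinearMap.BilinForm k 𝔤 :=
  (2 / killingForm k 𝔤 P.hθ P.hθ) • killingForm k 𝔤

/-- The data near `σ(S)`, `S = Spec R`: the étale `Γ`-torsor `Spec R' → Spec R` obtained by
restricting the covering to `σ(S)` (an étale `Γ`-torsor of affine schemes is the same as a Galois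
extension of rings with group `Γ`), and an action of `Γ` on `𝔤` by automorphisms. -/
structure TwistDatum extends RootDatum k 𝔤 where
  ρ : Γ → 𝔤 ≃ₗ⁅k⁆ 𝔤
  ρ_mul : ∀ a b X, ρ (a * b) X = ρ a (ρ b X)
  τ : Γ →* (R' ≃ₐ[R] R')
  algebraMap_injective : Function.Injective (algebraMap R R')
  invariant : ∀ x : R', (∀ γ, τ γ x = x) → ∃ r : R, algebraMap R R' r = x
  galois : ∃ (n : ℕ) (x y : Fin n → R'),
    ∑ i, x i * y i = 1 ∧ ∀ γ, γ ≠ 1 → ∑ i, x i * τ γ (y i) = 0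

variable {k 𝔤 R R' Γ} (P : TwistDatum k 𝔤 R R' Γ)

namespace TwistDatum

/-- The diagonal action of `Γ` on `R' ⊗ 𝔤`. -/
def act (γ : Γ) : R' ⊗[k] 𝔤 →ₗ[R] R' ⊗[k] 𝔤 :=
  TensorProduct.AlgebraTensorModule.map (P.τ γ).toLinearMap (P.ρ γ : 𝔤 →ₗ[k] 𝔤)

theorem act_tmul (γ : Γ) (a : R') (X : 𝔤) : P.act γ (a ⊗ₜ X) = P.τ γ a ⊗ₜ P.ρ γ X := rfl

theorem act_act (γ δ : Γ) (x : R' ⊗[k] 𝔤) : P.act γ (P.act δ x) = P.act (γ * δ) x := by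
  induction x with
  | zero => simp only [map_zero]
  | tmul a X => rw [act_tmul, act_tmul, act_tmul, P.ρ_mul, map_mul]; rfl
  | add x y hx hy => rw [map_add, map_add, map_add, hx, hy]

theorem act_lie (γ : Γ) (x y : R' ⊗[k] 𝔤) : P.act γ ⁅x, y⁆ = ⁅P.act γ x, P.act γ y⁆ := by
  induction x with
  | zero => simp only [map_zero, zero_lie]
  | add x x' hx hx' => rw [add_lie, map_add, hx, hx', map_add, add_lie]
  | tmul a X =>
    induction y with
    | zero => simp only [map_zero, lie_zero]
    | add x x' hx hx' => rw [lie_add, map_add, hx, hx', map_add, lie_add]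
    | tmul b Y =>
      rw [LieAlgebra.ExtendScalars.bracket_tmul, act_tmul, act_tmul, act_tmul,
        LieAlgebra.ExtendScalars.bracket_tmul, map_mul, LieEquiv.map_lie]

/-- The Lie algebra `σ^*𝔥 = (R' ⊗ 𝔤)^Γ` over `R`. -/
def hσ : LieSubalgebra R (R' ⊗[k] 𝔤) where
  carrier := {x | ∀ γ, P.act γ x = x}
  zero_mem' _ := map_zero _
  add_mem' hx hy γ := by rw [map_add, hx γ, hy γ]
  smul_mem' r x hx γ := by rw [map_smul, hx γ]
  lie_mem' hx hy γ := by rw [act_lie, hx γ, hy γ]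

/-- The `R'`-bilinear extension of the normalized Killing form. -/
def formE : LinearMap.BilinForm R' (R' ⊗[k] 𝔤) := LinearMap.BilinForm.baseChange R' P.form

theorem formE_tmul (a b : R') (X Y : 𝔤) :
    P.formE (a ⊗ₜ X) (b ⊗ₜ Y) = P.form X Y • (a * b) := rfl

theorem form_ρ (γ : Γ) (X Y : 𝔤) : P.form (P.ρ γ X) (P.ρ γ Y) = P.form X Y := by
  simp only [RootDatum.form, LinearMap.smul_apply, LieAlgebra.killingForm_of_equiv_apply]

theorem formE_act (γ : Γ) (x y : R' ⊗[k] 𝔤) :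
    P.formE (P.act γ x) (P.act γ y) = P.τ γ (P.formE x y) := by
  induction x with
  | zero => simp only [map_zero, LinearMap.zero_apply]
  | add x x' hx hx' =>
    rw [map_add, map_add, LinearMap.add_apply, hx, hx', map_add, LinearMap.add_apply, map_add]
  | tmul a X =>
    induction y with
    | zero => simp only [map_zero]
    | add x x' hx hx' => rw [map_add, map_add, hx, hx', map_add, map_add]
    | tmul b Y =>
      rw [act_tmul, act_tmul, formE_tmul, formE_tmul, form_ρ, ← map_mul,
        ← algebraMap_smul R, ← algebraMap_smul R (P.form X Y) (a * b)]
      exact (map_smul (P.τ γ) _ _).symm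

theorem exists_formσ (x y : P.hσ) : ∃ r : R, algebraMap R R' r = P.formE x.1 y.1 :=
  P.invariant _ fun γ => by rw [← formE_act, x.2 γ, y.2 γ]

/-- The `R`-bilinear form `( | )` on `σ^*𝔥`, obtained from `formE` by taking `Γ`-invariants. -/
def formσ : P.hσ →ₗ[R] P.hσ →ₗ[R] R :=
  LinearMap.mk₂ R (fun x y => (P.exists_formσ x y).choose)
    (fun x x' y => P.algebraMap_injective (by
      rw [map_add, (P.exists_formσ _ _).choose_spec, (P.exists_formσ _ _).choose_spec,
        (P.exists_formσ _ _).choose_spec]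
      exact LinearMap.map_add₂ _ _ _ _))
    (fun r x y => P.algebraMap_injective (by
      rw [smul_eq_mul, map_mul, (P.exists_formσ _ _).choose_spec,
        (P.exists_formσ _ _).choose_spec]
      change P.formE (r • x.1) y.1 = _
      rw [← algebraMap_smul R' r x.1, map_smul, LinearMap.smul_apply, smul_eq_mul]))
    (fun x y y' => P.algebraMap_injective (by
      rw [map_add, (P.exists_formσ _ _).choose_spec, (P.exists_formσ _ _).choose_spec,
        (P.exists_formσ _ _).choose_spec]
      exact map_add _ _ _))
    (fun r x y => P.algebraMap_injective (by
      rw [smul_eq_mul, map_mul, (P.exists_formσ _ _).choose_spec,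
        (P.exists_formσ _ _).choose_spec]
      change P.formE x.1 (r • y.1) = _
      rw [← algebraMap_smul R' r y.1, map_smul, smul_eq_mul]))

theorem algebraMap_formσ (x y : P.hσ) : algebraMap R R' (P.formσ x y) = P.formE x.1 y.1 :=
  (P.exists_formσ x y).choose_spec

theorem form_symm (X Y : 𝔤) : P.form X Y = P.form Y X := by
  simp only [RootDatum.form, LinearMap.smul_apply]
  rw [killingForm, LieModule.traceForm_comm k 𝔤 𝔤 X Y]

theorem form_lie (X Y Z : 𝔤) : P.form ⁅X, Y⁆ Z = P.form X ⁅Y, Z⁆ := by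
  simp only [RootDatum.form, LinearMap.smul_apply]
  rw [killingForm, LieModule.traceForm_apply_lie_apply]

theorem formE_symm (x y : R' ⊗[k] 𝔤) : P.formE x y = P.formE y x := by
  induction x with
  | zero => simp only [map_zero, LinearMap.zero_apply]
  | add x x' hx hx' => rw [map_add, LinearMap.add_apply, hx, hx', map_add]
  | tmul a X =>
    induction y with
    | zero => simp only [map_zero, LinearMap.zero_apply]
    | add x x' hx hx' => rw [map_add, map_add, LinearMap.add_apply, hx, hx']
    | tmul b Y => rw [formE_tmul, formE_tmul, form_symm, mul_comm]

theorem formE_lie (x y z : R' ⊗[k] 𝔤) : P.formE ⁅x, y⁆ z = P.formE x ⁅y, z⁆ := by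
  induction x with
  | zero => simp only [map_zero, LinearMap.zero_apply, zero_lie]
  | add x x' hx hx' => rw [add_lie, map_add, LinearMap.add_apply, hx, hx', map_add]; rfl
  | tmul a X =>
    induction y with
    | zero => simp only [map_zero, LinearMap.zero_apply, zero_lie, lie_zero]
    | add x x' hx hx' => rw [lie_add, map_add, LinearMap.add_apply, hx, hx', add_lie, map_add]
    | tmul b Y =>
      induction z with
      | zero => simp only [map_zero, lie_zero]
      | add x x' hx hx' => rw [lie_add, map_add, hx, hx', map_add]
      | tmul c Z =>
        rw [LieAlgebra.ExtendScalars.bracket_tmul, LieAlgebra.ExtendScalars.bracket_tmul,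
          formE_tmul, formE_tmul, form_lie, mul_assoc]

theorem formσ_symm (x y : P.hσ) : P.formσ x y = P.formσ y x :=
  P.algebraMap_injective (by rw [algebraMap_formσ, algebraMap_formσ, formE_symm])

theorem formσ_lie (x y z : P.hσ) : P.formσ ⁅x, y⁆ z = P.formσ x ⁅y, z⁆ :=
  P.algebraMap_injective (by
    rw [algebraMap_formσ, algebraMap_formσ]; exact P.formE_lie x.1 y.1 z.1)

/-! #### The Casimir element -/

/-- The map `X ⊗ Y ↦ (Z | X) Y`. -/
def contract (Z : P.hσ) : P.hσ ⊗[R] P.hσ →ₗ[R] P.hσ :=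
  TensorProduct.lift (LinearMap.lsmul R P.hσ ∘ₗ P.formσ Z)

theorem contract_tmul (Z X Y : P.hσ) : P.contract Z (X ⊗ₜ Y) = P.formσ Z X • Y := rfl

/-- An element of `σ^*𝔥 ⊗ σ^*𝔥` is a Casimir element if it corresponds to the identity under the
identification of `σ^*𝔥 ⊗ σ^*𝔥` with `End(σ^*𝔥)` provided by `( | )`. -/
def IsCasimir (c : P.hσ ⊗[R] P.hσ) : Prop := ∀ Z, P.contract Z c = Z

theorem form_nondegenerate : P.form.Nondegenerate := by
  have h : killingForm k 𝔤 P.hθ P.hθ ≠ 0 := by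
    have h0 : P.θ.1.IsNonZero := P.H.isNonZero_coe_root P.θ
    have h1 : killingForm k 𝔤 P.hθ P.hθ = _ :=
      LieAlgebra.IsKilling.traceForm_coroot P.θ.1 (LieAlgebra.IsKilling.coroot P.θ.1)
    rw [h1, LieAlgebra.IsKilling.root_apply_coroot h0, nsmul_eq_mul, smul_eq_mul]
    have := LieAlgebra.IsKilling.root_apply_cartanEquivDual_symm_ne_zero h0
    exact mul_ne_zero (by norm_num) (mul_ne_zero (inv_ne_zero this) two_ne_zero)
  have h2 : (2 / killingForm k 𝔤 P.hθ P.hθ) ≠ 0 := div_ne_zero two_ne_zero h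
  obtain ⟨h3, h4⟩ := LieAlgebra.IsKilling.killingForm_nondegenerate k 𝔤
  constructor
  · intro x hx
    exact h3 x fun y => (mul_eq_zero.mp (hx y)).resolve_left h2
  · intro x hx
    exact h4 x fun y => (mul_eq_zero.mp (hx y)).resolve_left h2

/-- Averaging over `Γ`. -/
def avg (x : R' ⊗[k] 𝔤) : P.hσ := ⟨∑ γ, P.act γ x, fun δ => by
  rw [map_sum]
  simp only [act_act]
  exact Fintype.sum_equiv (Equiv.mulLeft δ) _ _ fun _ => rfl⟩

theorem act_smul (γ : Γ) (u : R') (x : R' ⊗[k] 𝔤) : P.act γ (u • x) = P.τ γ u • P.act γ x := by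
  induction x with
  | zero => simp only [map_zero, smul_zero]
  | add x x' hx hx' => rw [smul_add, map_add, hx, hx', map_add, smul_add]
  | tmul a X =>
    rw [TensorProduct.smul_tmul', act_tmul, act_tmul, TensorProduct.smul_tmul', smul_eq_mul,
      map_mul, smul_eq_mul]

theorem formE_avg (Z : P.hσ) (x : R' ⊗[k] 𝔤) :
    P.formE Z.1 (P.avg x).1 = ∑ γ, P.τ γ (P.formE Z.1 x) := by
  change P.formE Z.1 (∑ γ, P.act γ x) = _
  rw [map_sum]
  exact Finset.sum_congr rfl fun γ _ => by rw [← formE_act, Z.2 γ]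

theorem sum_smul_avg {n : ℕ} {x y : Fin n → R'} (h1 : ∑ i, x i * y i = 1)
    (h2 : ∀ γ, γ ≠ 1 → ∑ i, x i * P.τ γ (y i) = 0) (Y : 𝔤) :
    ∑ i, x i • (P.avg (y i ⊗ₜ Y)).1 = 1 ⊗ₜ[k] Y := by
  have h3 : ∀ i, x i • (P.avg (y i ⊗ₜ Y)).1 = ∑ γ, (x i * P.τ γ (y i)) ⊗ₜ[k] P.ρ γ Y := by
    intro i
    change x i • ∑ γ, P.act γ (y i ⊗ₜ Y) = _
    rw [Finset.smul_sum]
    rfl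
  have h4 : P.ρ 1 Y = Y := (P.ρ 1).injective ((P.ρ_mul 1 1 Y).symm.trans
    (congrArg (fun g => P.ρ g Y) (one_mul 1)))
  simp only [h3]
  rw [Finset.sum_comm, Finset.sum_eq_single 1]
  · simp only [map_one, AlgEquiv.one_apply]
    rw [← TensorProduct.sum_tmul, h1, h4]
  · intro γ _ hγ
    rw [← TensorProduct.sum_tmul, h2 γ hγ, TensorProduct.zero_tmul]
  · exact fun h => absurd (Finset.mem_univ _) h

theorem isSymm : P.form.IsSymm := ⟨P.form_symm⟩

theorem sum_formE_smul {ι : Type*} [Fintype ι] [DecidableEq ι] (b : Module.Basis ι k 𝔤)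
    (x : R' ⊗[k] 𝔤) :
    ∑ a, P.formE x (1 ⊗ₜ b a) •
      ((1 : R') ⊗ₜ[k] (LinearMap.BilinForm.dualBasis P.form P.form_nondegenerate b) a) = x := by
  induction x with
  | zero => simp only [map_zero, LinearMap.zero_apply, zero_smul, Finset.sum_const_zero]
  | add x y hx hy =>
    simp only [map_add, LinearMap.add_apply, add_smul, Finset.sum_add_distrib]
    rw [hx, hy]
  | tmul r X =>
    conv_rhs => rw [← (LinearMap.BilinForm.dualBasis P.form P.form_nondegenerate b).sum_repr X,
      TensorProduct.tmul_sum]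
    refine Finset.sum_congr rfl fun a _ => ?_
    rw [formE_tmul, LinearMap.BilinForm.dualBasis_repr_apply, TensorProduct.tmul_smul,
      TensorProduct.smul_tmul', mul_one, smul_eq_mul, mul_one, TensorProduct.smul_tmul']

theorem exists_isCasimir_and :
    ∃ c, P.IsCasimir c ∧ TensorProduct.lift P.formσ c = Module.finrank k 𝔤 := by
  obtain ⟨n, x, y, h1, h2⟩ := P.galois
  let b := Module.finBasis k 𝔤
  let b' := LinearMap.BilinForm.dualBasis P.form P.form_nondegenerate b
  let r : R := algebraMap k R (Fintype.card Γ : k)⁻¹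
  have hr : r * (Fintype.card Γ : R) = 1 := by
    have : (Fintype.card Γ : k) ≠ 0 := by
      have := Fintype.card_ne_zero (α := Γ)
      exact_mod_cast this
    rw [← map_natCast (algebraMap k R), ← map_mul, inv_mul_cancel₀ this, map_one]
  refine ⟨r • ∑ a, ∑ i, P.avg (x i ⊗ₜ b a) ⊗ₜ P.avg (y i ⊗ₜ b' a), fun Z => ?_, ?_⟩
  · have h3 : P.contract Z (∑ a, ∑ i, P.avg (x i ⊗ₜ b a) ⊗ₜ P.avg (y i ⊗ₜ b' a)) =
        (Fintype.card Γ : R) • Z := by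
      apply Subtype.ext
      have h4 : ∀ a i, ((P.formσ Z (P.avg (x i ⊗ₜ b a)) • P.avg (y i ⊗ₜ b' a) : P.hσ) :
          R' ⊗[k] 𝔤) =
          ∑ γ, P.act γ (P.formE Z.1 (1 ⊗ₜ b a) • x i • (P.avg (y i ⊗ₜ b' a)).1) := by
        intro a i
        change P.formσ Z (P.avg (x i ⊗ₜ b a)) • (P.avg (y i ⊗ₜ b' a)).1 = _
        rw [← algebraMap_smul R', algebraMap_formσ, formE_avg, Finset.sum_smul]
        refine Finset.sum_congr rfl fun γ _ => ?_
        rw [smul_smul, act_smul, (P.avg (y i ⊗ₜ b' a)).2 γ]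
        congr 2
        rw [show x i ⊗ₜ[k] b a = x i • ((1 : R') ⊗ₜ[k] b a) by
          rw [TensorProduct.smul_tmul', smul_eq_mul, mul_one], map_smul, smul_eq_mul, mul_comm]
      simp only [map_sum, contract_tmul]
      rw [AddSubmonoidClass.coe_finsetSum]
      simp only [AddSubmonoidClass.coe_finsetSum, h4]
      have h5 : ∀ a, ∑ i, ∑ γ, P.act γ (P.formE Z.1 (1 ⊗ₜ b a) • x i •
          (P.avg (y i ⊗ₜ b' a)).1) =
          ∑ γ, P.act γ (P.formE Z.1 (1 ⊗ₜ b a) • ((1 : R') ⊗ₜ[k] b' a)) := by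
        intro a
        rw [Finset.sum_comm]
        refine Finset.sum_congr rfl fun γ _ => ?_
        rw [← map_sum, ← Finset.smul_sum, P.sum_smul_avg h1 h2]
      simp only [h5]
      rw [Finset.sum_comm]
      simp only [← map_sum]
      rw [Finset.sum_congr rfl fun γ _ => by rw [P.sum_formE_smul b Z.1, Z.2 γ]]
      rw [Finset.sum_const, Finset.card_univ, ← Nat.cast_smul_eq_nsmul R]
      rfl
    rw [map_smul, h3, smul_smul, hr, one_smul]
  · have h3 : TensorProduct.lift P.formσ
        (∑ a, ∑ i, P.avg (x i ⊗ₜ b a) ⊗ₜ P.avg (y i ⊗ₜ b' a)) =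
        (Fintype.card Γ : R) * Module.finrank k 𝔤 := by
      apply P.algebraMap_injective
      simp only [map_sum, TensorProduct.lift.tmul, algebraMap_formσ]
      have h4 : ∀ a i, P.formE (P.avg (x i ⊗ₜ b a)).1 (P.avg (y i ⊗ₜ b' a)).1 =
          ∑ γ, P.τ γ (P.formE (1 ⊗ₜ b a) (x i • (P.avg (y i ⊗ₜ b' a)).1)) := by
        intro a i
        rw [formE_symm, formE_avg]
        refine Finset.sum_congr rfl fun γ _ => ?_
        congr 1
        rw [show x i ⊗ₜ[k] b a = x i • ((1 : R') ⊗ₜ[k] b a) by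
          rw [TensorProduct.smul_tmul', smul_eq_mul, mul_one], map_smul, map_smul, formE_symm]
      simp only [h4]
      have h5 : ∀ a, ∑ i, ∑ γ, P.τ γ (P.formE (1 ⊗ₜ b a) (x i • (P.avg (y i ⊗ₜ b' a)).1)) =
          (Fintype.card Γ : R') := by
        intro a
        rw [Finset.sum_comm]
        have h6 : ∀ γ : Γ, ∑ i, P.τ γ (P.formE (1 ⊗ₜ b a) (x i • (P.avg (y i ⊗ₜ b' a)).1)) =
            1 := by
          intro γ
          rw [← map_sum, ← map_sum, P.sum_smul_avg h1 h2, formE_tmul,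
            LinearMap.BilinForm.apply_dualBasis_right _ P.isSymm, if_pos rfl, one_smul, one_mul,
            map_one]
        rw [Finset.sum_congr rfl fun γ _ => h6 γ, Finset.sum_const, Finset.card_univ,
          nsmul_eq_mul, mul_one]
      rw [Finset.sum_congr rfl fun a _ => h5 a, Finset.sum_const, Finset.card_univ,
        Fintype.card_fin, nsmul_eq_mul, map_mul, map_natCast, map_natCast, mul_comm]
    rw [map_smul, h3, smul_eq_mul, ← mul_assoc, hr, one_mul]

theorem exists_isCasimir : ∃ c, P.IsCasimir c := ⟨_, P.exists_isCasimir_and.choose_spec.1⟩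

/-- The Casimir element `𝔠` (it is unique). -/
def casimir : P.hσ ⊗[R] P.hσ := P.exists_isCasimir.choose

theorem casimir_spec : P.IsCasimir P.casimir := P.exists_isCasimir.choose_spec

variable {P}

/-- A Casimir element is unique and symmetric. -/
theorem IsCasimir.eq_comm {c c' : P.hσ ⊗[R] P.hσ} (hc : P.IsCasimir c) (hc' : P.IsCasimir c') :
    c = TensorProduct.comm R P.hσ P.hσ c' := by
  let F : P.hσ ⊗[R] P.hσ →ₗ[R] P.hσ ⊗[R] P.hσ →ₗ[R] P.hσ ⊗[R] P.hσ :=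
    TensorProduct.lift (LinearMap.mk₂ R (fun X Y =>
      (TensorProduct.mk R P.hσ P.hσ).flip Y ∘ₗ P.contract X)
      (fun X X' Y => by
        apply LinearMap.ext; intro z
        induction z with
        | zero => simp
        | add a b ha hb => rw [map_add, ha, hb, map_add]
        | tmul a b => simp [contract_tmul, add_smul])
      (fun r X Y => by
        apply LinearMap.ext; intro z
        induction z with
        | zero => simp
        | add a b ha hb => rw [map_add, ha, hb, map_add]
        | tmul a b => simp [contract_tmul, smul_smul, TensorProduct.smul_tmul'])
      (fun X Y Y' => by
        apply LinearMap.ext; intro z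
        simp)
      (fun r X Y => by
        apply LinearMap.ext; intro z
        simp))
  have h1 : ∀ d, F d c' = d := by
    intro d
    induction d with
    | zero => simp
    | add a b ha hb => rw [map_add, LinearMap.add_apply, ha, hb]
    | tmul X Y =>
      change P.contract X c' ⊗ₜ Y = X ⊗ₜ Y
      rw [hc' X]
  have h2 : ∀ d, F c d = TensorProduct.comm R P.hσ P.hσ d := by
    intro d
    induction d with
    | zero => simp
    | add a b ha hb => rw [map_add, ha, hb, map_add]
    | tmul X' Y' =>
      have h3 : ∀ e, F e (X' ⊗ₜ Y') = Y' ⊗ₜ P.contract X' e := by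
        intro e
        induction e with
        | zero => simp
        | add a b ha hb => rw [map_add, LinearMap.add_apply, ha, hb, map_add,
            TensorProduct.tmul_add]
        | tmul X Y =>
          change (P.formσ X X' • Y') ⊗ₜ Y = Y' ⊗ₜ (P.formσ X' X • Y)
          rw [formσ_symm, TensorProduct.smul_tmul]
      rw [h3, hc X', TensorProduct.comm_tmul]
  rw [← h2, h1]

variable (P)

theorem casimir_symm : TensorProduct.comm R P.hσ P.hσ P.casimir = P.casimir :=
  (P.casimir_spec.eq_comm P.casimir_spec).symm

theorem formσ_casimir : TensorProduct.lift P.formσ P.casimir = Module.finrank k 𝔤 := by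
  obtain ⟨c, hc, h⟩ := P.exists_isCasimir_and
  rw [hc.eq_comm P.casimir_spec, casimir_symm] at h
  exact h

/-- As `R` is a `k`-algebra, it has no 2-torsion. -/
theorem eq_zero_of_add_self {M : Type*} [AddCommGroup M] [Module R M] {x : M}
    (_P : TwistDatum k 𝔤 R R' Γ) (h : x + x = 0) : x = 0 := by
  have h1 : algebraMap k R 2⁻¹ * 2 = 1 := by
    rw [← map_ofNat (algebraMap k R), ← map_mul, inv_mul_cancel₀ two_ne_zero, map_one]
  rw [← one_smul R x, ← h1, mul_smul, two_smul, h, smul_zero]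

/-! #### The twisted loop algebra and its central extension -/

/-- The twisted loop algebra `𝔥_𝓛 = 𝓛 ⊗ σ^*𝔥`. -/
def hL := R⸨X⸩ ⊗[R] P.hσ

instance : LieRing P.hL := inferInstanceAs (LieRing (R⸨X⸩ ⊗[R] P.hσ))
instance : LieAlgebra R P.hL :=
  inferInstanceAs (LieAlgebra R (R⸨X⸩ ⊗[R] P.hσ))

/-- The element `f X = f ⊗ X` of `𝔥_𝓛`. -/
def tmul : R⸨X⸩ →ₗ[R] P.hσ →ₗ[R] P.hL := TensorProduct.mk R R⸨X⸩ P.hσ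

theorem tmul_lie_tmul (f g : R⸨X⸩) (X Y : P.hσ) :
    ⁅P.tmul f X, P.tmul g Y⁆ = P.tmul (f * g) ⁅X, Y⁆ := rfl

theorem hL_induction {p : P.hL → Prop} (z : P.hL) (zero : p 0) (tmul : ∀ f X, p (P.tmul f X))
    (add : ∀ x y, p x → p y → p (x + y)) : p z :=
  TensorProduct.induction_on (motive := p) z zero tmul add

/-- The pairing `(dX | Y)` of `𝔥_𝓛` with values in `ω`. -/
def dForm : P.hL →ₗ[R] P.hL →ₗ[R] Omega R :=
  (TensorProduct.map₂ (smulDif R) P.formσ).compr₂ (TensorProduct.rid R (Omega R)).toLinearMap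

theorem dForm_tmul (f g : R⸨X⸩) (X Y : P.hσ) :
    P.dForm (P.tmul f X) (P.tmul g Y) = P.formσ X Y • g • dif R f := rfl

/-- The bilinear form `Res (dX | Y)` on `𝔥_𝓛`. -/
def resForm : P.hL →ₗ[R] P.hL →ₗ[R] R := P.dForm.compr₂ (res R)

theorem resForm_tmul (f g : R⸨X⸩) (X Y : P.hσ) :
    P.resForm (P.tmul f X) (P.tmul g Y) = P.formσ X Y * resPair R f g := by
  change res R (P.dForm (P.tmul f X) (P.tmul g Y)) = _
  rw [dForm_tmul, map_smul]
  rfl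

theorem resForm_skew (x y : P.hL) : P.resForm x y = - P.resForm y x := by
  induction x using P.hL_induction with
  | zero => simp only [map_zero, LinearMap.zero_apply, neg_zero]
  | add x x' hx hx' => rw [map_add, LinearMap.add_apply, hx, hx', map_add, neg_add]
  | tmul f X =>
    induction y using P.hL_induction with
    | zero => simp only [map_zero, LinearMap.zero_apply, neg_zero]
    | add x x' hx hx' => rw [map_add, map_add, LinearMap.add_apply, hx, hx', neg_add]
    | tmul g Y => rw [resForm_tmul, resForm_tmul, formσ_symm, resPair_skew, mul_neg]

theorem resForm_cyc (x y z : P.hL) :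
    P.resForm x ⁅y, z⁆ = P.resForm ⁅x, y⁆ z + P.resForm y ⁅x, z⁆ := by
  induction x using P.hL_induction with
  | zero => simp only [map_zero, LinearMap.zero_apply, zero_lie, add_zero]
  | add x x' hx hx' =>
    simp only [map_add, LinearMap.add_apply, hx, hx', add_lie]
    abel
  | tmul f X =>
    induction y using P.hL_induction with
    | zero => simp only [map_zero, LinearMap.zero_apply, zero_lie, lie_zero, add_zero]
    | add x x' hx hx' =>
      simp only [map_add, LinearMap.add_apply, hx, hx', add_lie, lie_add]
      abel
    | tmul g Y =>
      induction z using P.hL_induction with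
      | zero => simp only [map_zero, lie_zero, add_zero]
      | add x x' hx hx' =>
        simp only [map_add, hx, hx', lie_add]
        abel
      | tmul h Z =>
        simp only [tmul_lie_tmul, resForm_tmul, resPair_cyc R f g h]
        rw [← P.formσ_lie Y X Z, ← P.formσ_lie X Y Z, ← lie_skew Y X, map_neg,
          LinearMap.neg_apply]
        ring

/-- The cocycle `(X, Y) ↦ Res (dX | Y)` on `𝔥_𝓛`. -/
def hCocycle : Cocycle R P.hL where
  form := P.resForm
  self x := P.eq_zero_of_add_self (by
    nth_rewrite 1 [P.resForm_skew x x]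
    exact neg_add_cancel _)
  cyc := P.resForm_cyc

/-- The central extension `ĥ_𝓛 = 𝔥_𝓛 ⊕ cR`, with `[X, Y] = [X, Y]_{𝔥_𝓛} + c Res (dX | Y)`. -/
abbrev hHat := CentralExt P.hCocycle

/-- The inclusion `𝔥_𝓛 → ĥ_𝓛`. -/
def inc : P.hL →ₗ[R] P.hHat := CentralExt.inl P.hCocycle

/-- The central element `c` of `ĥ_𝓛`. -/
def cc : P.hHat := CentralExt.gen P.hCocycle

/-- The filtration `Fⁿ𝔥_𝓛 = Fⁿ𝓛 ⊗ σ^*𝔥`. -/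
def hLFil (n : ℕ) : Submodule R P.hL := Submodule.span R {z | ∃ f ∈ fil R n, ∃ X, z = P.tmul f X}

theorem tmul_mem_hLFil {n : ℕ} {f : R⸨X⸩} (hf : f ∈ fil R n) (X : P.hσ) :
    P.tmul f X ∈ P.hLFil n := Submodule.subset_span ⟨f, hf, X, rfl⟩

theorem hLFil_anti {m n : ℕ} (h : m ≤ n) : P.hLFil n ≤ P.hLFil m :=
  Submodule.span_mono fun _ ⟨f, hf, X, e⟩ => ⟨f, fil_anti (by exact_mod_cast h) hf, X, e⟩

theorem hLFil_lie (z : P.hL) (n : ℕ) :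
    ∃ m, ∀ w ∈ P.hLFil m, ⁅w, z⁆ ∈ P.hLFil n ∧ P.resForm w z = 0 := by
  induction z using P.hL_induction with
  | zero => exact ⟨0, fun w _ => ⟨by rw [lie_zero]; exact zero_mem _, map_zero _⟩⟩
  | add a b ha hb =>
    obtain ⟨m, hm⟩ := ha
    obtain ⟨m', hm'⟩ := hb
    refine ⟨max m m', fun w hw => ?_⟩
    obtain ⟨h1, h2⟩ := hm w (P.hLFil_anti (le_max_left _ _) hw)
    obtain ⟨h3, h4⟩ := hm' w (P.hLFil_anti (le_max_right _ _) hw)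
    exact ⟨by rw [lie_add]; exact add_mem h1 h3, by rw [map_add, h2, h4, add_zero]⟩
  | tmul g Y =>
    obtain ⟨j, hj⟩ := exists_mem_fil g
    refine ⟨n + j + 1, fun w hw => ?_⟩
    induction hw using Submodule.span_induction with
    | zero => exact ⟨by rw [zero_lie]; exact zero_mem _, by rw [map_zero, LinearMap.zero_apply]⟩
    | add a b _ _ ha hb =>
      exact ⟨by rw [add_lie]; exact add_mem ha.1 hb.1, by
        rw [map_add, LinearMap.add_apply, ha.2, hb.2, add_zero]⟩
    | smul r a _ ha =>
      exact ⟨by rw [smul_lie]; exact Submodule.smul_mem _ r ha.1, by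
        rw [map_smul, LinearMap.smul_apply, ha.2, smul_zero]⟩
    | mem w hw =>
      obtain ⟨f, hf, X, rfl⟩ := hw
      refine ⟨?_, ?_⟩
      · rw [tmul_lie_tmul]
        exact P.tmul_mem_hLFil (fil_anti (by push_cast; omega) (mul_mem_fil hf hj)) _
      · rw [resForm_tmul, resPair_eq_zero R hf hj (by push_cast; omega), mul_zero]

/-- The filtration `Fⁿĥ_𝓛 = Fⁿ𝔥_𝓛`. -/
def hFil : LieFiltration R P.hHat where
  F n := (P.hLFil n).map P.inc
  anti h := Submodule.map_mono (P.hLFil_anti h)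
  lie_mem x n := by
    obtain ⟨m, hm⟩ := P.hLFil_lie x.1 n
    refine ⟨m, ?_⟩
    rintro _ ⟨w, hw, rfl⟩
    obtain ⟨h1, h2⟩ := hm w hw
    exact ⟨⁅w, x.1⁆, h1, Prod.ext rfl h2.symm⟩

/-- The canonical map `𝔥_𝓛 → Uĥ_𝓛`. -/
def emb : P.hL →ₗ[R] FEnv P.hFil := FEnv.ι P.hFil ∘ₗ P.inc

/-- For `e = ∑ X ⊗ Y` in `σ^*𝔥 ⊗ σ^*𝔥`, the element `∑ f X ∘ g Y` of `Uĥ_𝓛`. -/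
def tensorWith (f g : R⸨X⸩) : P.hσ ⊗[R] P.hσ →ₗ[R] FEnv P.hFil :=
  TensorProduct.lift ((LinearMap.mul R (FEnv P.hFil)).compl₁₂
    (P.emb ∘ₗ P.tmul f) (P.emb ∘ₗ P.tmul g))

theorem tensorWith_tmul (f g : R⸨X⸩) (X Y : P.hσ) :
    P.tensorWith f g (X ⊗ₜ Y) = P.emb (P.tmul f X) * P.emb (P.tmul g Y) := rfl

/-- The map `γ_𝔠 : 𝔩 ⊗ 𝔩 → Uĥ_𝓛` given by tensoring with the Casimir element: for
`𝔠 = ∑ X ⊗ Y` it sends `f ⊗ g` to `∑ f X ∘ g Y`. -/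
def gammaForm : R⸨X⸩ →ₗ[R] R⸨X⸩ →ₗ[R] FEnv P.hFil :=
  LinearMap.mk₂ R (fun f g => P.tensorWith f g P.casimir)
    (fun f f' g => by
      rw [← LinearMap.add_apply]
      congr 1
      ext X Y
      simp [tensorWith_tmul, add_mul])
    (fun r f g => by
      rw [← LinearMap.smul_apply]
      congr 1
      ext X Y
      simp [tensorWith_tmul])
    (fun f g g' => by
      rw [← LinearMap.add_apply]
      congr 1
      ext X Y
      simp [tensorWith_tmul, mul_add])
    (fun r f g => by
      rw [← LinearMap.smul_apply]
      congr 1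
      ext X Y
      simp [tensorWith_tmul])

/-- The map `X ⊗ Y ↦ [X, Y]`. -/
def lieMap : P.hσ ⊗[R] P.hσ →ₗ[R] P.hσ :=
  TensorProduct.lift (LieModule.toEnd R P.hσ P.hσ : P.hσ →ₗ[R] Module.End R P.hσ)

theorem lieMap_comm (e : P.hσ ⊗[R] P.hσ) :
    P.lieMap (TensorProduct.comm R P.hσ P.hσ e) = - P.lieMap e := by
  induction e with
  | zero => simp
  | add a b ha hb => rw [map_add, map_add, ha, hb, map_add, neg_add]
  | tmul X Y =>
    change ⁅Y, X⁆ = -⁅X, Y⁆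
    exact (lie_skew Y X).symm

theorem lieMap_casimir : P.lieMap P.casimir = 0 := by
  refine P.eq_zero_of_add_self ?_
  nth_rewrite 1 [← P.casimir_symm]
  rw [lieMap_comm]
  exact neg_add_cancel _

theorem gammaForm_sub (f g : R⸨X⸩) :
    P.gammaForm f g - P.gammaForm g f =
      resPair R f g • ((Module.finrank k 𝔤 : R) • FEnv.ι P.hFil P.cc) := by
  have h : ∀ e, P.tensorWith f g e - P.tensorWith g f (TensorProduct.comm R P.hσ P.hσ e) =
      P.emb (P.tmul (f * g) (P.lieMap e)) +
      (resPair R f g * TensorProduct.lift P.formσ e) • FEnv.ι P.hFil P.cc := by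
    intro e
    induction e with
    | zero => simp
    | add a b ha hb =>
      simp only [map_add, mul_add, add_smul]
      rw [add_sub_add_comm, ha, hb]
      abel
    | tmul X Y =>
      rw [TensorProduct.comm_tmul, tensorWith_tmul, tensorWith_tmul]
      have h1 : P.emb (P.tmul f X) * P.emb (P.tmul g Y) = P.emb (P.tmul g Y) * P.emb (P.tmul f X) +
          FEnv.ι P.hFil ⁅P.inc (P.tmul f X), P.inc (P.tmul g Y)⁆ := FEnv.ι_mul _ _ _
      have h2 : ⁅P.inc (P.tmul f X), P.inc (P.tmul g Y)⁆ = P.inc (P.tmul (f * g) ⁅X, Y⁆) +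
          P.resForm (P.tmul f X) (P.tmul g Y) • P.cc := CentralExt.inl_lie_inl _ _ _
      rw [h1, h2, map_add, map_smul, resForm_tmul, mul_comm (P.formσ X Y)]
      rw [add_sub_cancel_left]
      rfl
  have h3 := h P.casimir
  rw [casimir_symm, lieMap_casimir, formσ_casimir, map_zero, map_zero, zero_add,
    mul_smul] at h3
  exact h3

/-- The linear map `U𝔩̂ → Uĥ_𝓛` with `f ∘ g ↦ γ_𝔠(f ⊗ g)`, `ħ ↦ c dim 𝔤` (and `1 ↦ 0`, `f ↦ 0`). -/
def gammaU : FEnv (lFil R) →ₗ[R] FEnv P.hFil :=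
  quad P.gammaForm ((Module.finrank k 𝔤 : R) • FEnv.ι P.hFil P.cc) P.gammaForm_sub

theorem gammaU_mem (n : ℕ) : ∀ u ∈ leftIdeal (lFil R) n, P.gammaU u ∈ leftIdeal P.hFil n := by
  refine quad_mem _ _ P.gammaForm_sub (Submodule.restrictScalars R (leftIdeal P.hFil n)) n ?_
  intro g s hs
  have h : ∀ e, P.tensorWith g s e ∈ leftIdeal P.hFil n := fun e => by
    induction e with
    | zero => rw [map_zero]; exact zero_mem _
    | add a b ha hb => rw [map_add]; exact add_mem ha hb
    | tmul X Y =>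
      have h1 : P.emb (P.tmul s Y) ∈ leftIdeal P.hFil n :=
        Ideal.subset_span ⟨_, ⟨_, P.tmul_mem_hLFil hs Y, rfl⟩, rfl⟩
      rw [tensorWith_tmul]
      exact (leftIdeal P.hFil n).mul_mem_left _ h1
  exact h P.casimir

/-- The continuous extension of `gammaU` to the completions; its restriction to the closure of `𝔩₂` is
`γ̂_𝔠`. -/
def gammaHat : CEnv (lFil R) →ₗ[R] CEnv P.hFil :=
  extendMap (lFil R) P.hFil P.gammaU fun n => ⟨n, P.gammaU_mem n⟩

theorem gammaHat_of (u : FEnv (lFil R)) :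
    P.gammaHat (CEnv.of _ u) = CEnv.of _ (P.gammaU u) := extend_of _ _ _ u

end TwistDatum
end Twisted

/-! ### The Virasoro algebra -/

section Virasoro

variable (R : Type*) [CommRing R]

/-- The submodule `𝔩₂` of `U𝔩̂` spanned by the `f ∘ g` and `ħ`. -/
def lTwo : Submodule R (FEnv (lFil R)) :=
  Submodule.span R ({u | ∃ f g : R⸨X⸩, u = FEnv.ι (lFil R) (LHat.inc R f) *
    FEnv.ι (lFil R) (LHat.inc R g)} ∪ {FEnv.ι (lFil R) (LHat.hbar R)})

/-- The closure of `𝔩₂` in `Ū𝔩̂`. -/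
def lTwoBar : Submodule R (CEnv (lFil R)) :=
  ((lTwo R).map (CEnv.of (lFil R)).toLinearMap).topologicalClosure

/-- The Virasoro algebra `θ̂`: the pairs `(D, u)` with `D ∈ θ`, `u ∈ closure(𝔩₂)` and
`C(D) = u` modulo `ħ`, where `2 C(D)` is the symmetric form `(α, β) ↦ Res (D(α) β)` on `ω`. -/
def Vir : Submodule R (theta R × CEnv (lFil R)) where
  carrier := {x | x.2 ∈ lTwoBar R ∧ ∀ α β : Omega R, pairing R α β x.2 = res R (α x.1 • β)}
  zero_mem' := ⟨zero_mem _, fun α β => by simp⟩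
  add_mem' := fun {x y} hx hy => ⟨add_mem hx.1 hy.1, fun α β => by
    rw [Prod.snd_add, map_add, hx.2, hy.2, Prod.fst_add, map_add, add_smul, map_add]⟩
  smul_mem' := fun r x hx => ⟨Submodule.smul_mem _ r hx.1, fun α β => by
    have h : α (r • x.1) = r • α x.1 := by
      rw [← algebraMap_smul R⸨X⸩ r x.1, map_smul, algebraMap_smul]
    rw [Prod.smul_snd, map_smul, hx.2, Prod.smul_fst, h, smul_assoc]
    exact (map_smul (res R) r (α x.1 • β)).symm⟩

/-- The injection `Ĉ(D, u) = u`. -/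
def cHat : Vir R →ₗ[R] CEnv (lFil R) := LinearMap.snd R (theta R) (CEnv (lFil R)) ∘ₗ (Vir R).subtype

theorem pairing_hbar (α β : Omega R) :
    pairing R α β (CEnv.of (lFil R) (FEnv.ι (lFil R) (LHat.hbar R))) = 0 :=
  (extendDiscrete_of _ _ _ _).trans (quad_hbar _ _ _)

/-- The central element `c₀ = (0, -ħ)` of `θ̂`. -/
def virC : Vir R := ⟨(0, -CEnv.of (lFil R) (FEnv.ι (lFil R) (LHat.hbar R))), by
  refine ⟨neg_mem (Submodule.le_topologicalClosure _ ?_), fun α β => ?_⟩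
  · exact ⟨_, Submodule.subset_span (Or.inr rfl), rfl⟩
  · rw [map_neg, pairing_hbar, map_zero, zero_smul, map_zero, neg_zero]⟩

/-- The element `ħ` of the centre of `Ū𝔩̂`. -/
def hbarC : Subring.center (CEnv (lFil R)) :=
  ⟨CEnv.of (lFil R) (FEnv.ι (lFil R) (LHat.hbar R)), of_mem_center _ (LHat.hbar_lie R)⟩

/-- The map `T = -Ĉ/ħ : θ̂ → Ū𝔩̂[1/ħ]`. -/
def virT : Vir R →ₗ[R] Away (hbarC R) :=
  -(LinearMap.mulLeft R (Away.inv (hbarC R)) ∘ₗ Away.of R (hbarC R) ∘ₗ cHat R)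

end Virasoro

/-! ### The Sugawara representation -/

section Sugawara

variable {k 𝔤 R R' Γ : Type*} [Field k] [IsAlgClosed k] [CharZero k]
  [LieRing 𝔤] [LieAlgebra k 𝔤] [FiniteDimensional k 𝔤] [LieAlgebra.IsSimple k 𝔤]
  [CommRing R] [Algebra k R] [CommRing R'] [Algebra k R'] [Algebra R R'] [IsScalarTower k R R']
  [Group Γ] [Fintype Γ] (P : TwistDatum k 𝔤 R R' Γ)

namespace TwistDatum

/-- For `e = ∑ X ⊗ Y` the element `ad(e) Z = ∑ [X, [Y, Z]]` of `𝔥_𝓛`. -/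
def adTensor (Z : P.hL) : P.hσ ⊗[R] P.hσ →ₗ[R] P.hL :=
  TensorProduct.lift (LinearMap.mk₂ R (fun X Y => ⁅P.tmul 1 X, ⁅P.tmul 1 Y, Z⁆⁆)
    (fun X X' Y => by rw [map_add, add_lie]) (fun r X Y => by rw [map_smul, smul_lie])
    (fun X Y Y' => by rw [map_add, add_lie, lie_add])
    (fun r X Y => by rw [map_smul, smul_lie, lie_smul]))

/-- The scalar `ȟ ∈ k` with `ad(𝔠) Z = 2ȟ Z` for all `Z` in `𝔥_𝓛`. -/
def hCheck : k :=
  Classical.epsilon fun h : k => ∀ Z, P.adTensor Z P.casimir = (2 * algebraMap k R h) • Z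

/-- The element `c` of `Ūĥ_𝓛`. -/
def cBar : CEnv P.hFil := CEnv.of P.hFil (FEnv.ι P.hFil P.cc)

/-- The element `c + ȟ` of the centre of `Ūĥ_𝓛`. -/
def cPlus : Subring.center (CEnv P.hFil) :=
  ⟨P.cBar + algebraMap R (CEnv P.hFil) (algebraMap k R P.hCheck),
    add_mem (of_mem_center _ (CentralExt.gen_lie _))
      (Subring.mem_center_iff.mpr fun a => (Algebra.commutes _ a).symm)⟩

/-- The map `Ĉ_𝔥 = γ̂_𝔠 Ĉ : θ̂ → Ūĥ_𝓛`. -/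
def cHatH : Vir R →ₗ[R] CEnv P.hFil := P.gammaHat ∘ₗ cHat R

/-- The Sugawara map `T_𝔥 = -Ĉ_𝔥/(c + ȟ) : θ̂ → Ūĥ_𝓛[1/(c + ȟ)]`. -/
def sugawara : Vir R →ₗ[R] Away P.cPlus :=
  -(LinearMap.mulLeft R (Away.inv P.cPlus) ∘ₗ Away.of R P.cPlus ∘ₗ P.cHatH)

end TwistDatum
end Sugawara

end TwistedSugawara

end

/-!
Write a continuous derivation as `D = δ d/dt`. An element `(D, u)` of `θ̂` acts on the generators of
the two completed enveloping algebras by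

* `[u, h] = -ħ D(h)` for `h` in `R((t))` (`vir_commutator_ell`), and
* `[γ̂_𝔠(u), h Z] = -(c + ȟ) D(h) Z` for `Z` in `σ^*𝔥` (`cHatH_commutator_loop`).

Let `D` act on the closure of `𝔩₂` by the Leibniz rule (`lieHat`). Both relations then extend by
continuity to `[u, v] = -ħ D(v)` and `[γ̂_𝔠(u), γ̂_𝔠(v)] = -(c + ȟ) γ̂_𝔠(D(v))` for all `v` in the
closure of `𝔩₂` (`vir_commutator`, `gammaHat_commutator`). Since `([D, E], D(v))` is in `θ̂` for
`(E, v)` in `θ̂` (`exists_vir_lieHat`), this pair is the bracket of `(D, u)` and `(E, v)` for which both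
`T` and the Sugawara map are homomorphisms; its bilinearity follows from the injectivity of `T`.

The first relation is read off from coefficients: `[f ∘ g, h]` is `ħ` times
`Res (h dg) f + Res (h df) g`, whose coefficients are values of the symmetric form of `f ∘ g`. For the
second relation, the commutator of `∑ f X_i ∘ g Y_i` with `h Z` has a part of this kind, multiplied by
`c`, and a part `A(f, gh) - A(fh, g)` with `A(f, g) = ∑ f X_i ∘ g [Y_i, Z]` (`anomaly`), by invariance
of the Casimir element. The latter is symmetric in `f` and `g`, hence is determined modulo each left
ideal `U ∘ Fⁿ` by finitely many coefficients of `δ` (`two_smul_quad_eq_sum`). For `h = t^p` the resulting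
finite sum telescopes, and moving the boundary terms to normal order by means of
`A(f, g) + A(g, f) = 2ȟ fg Z` gives `-ȟ D(t^p) Z` (`anomalyU_tpow_add_mem`). Here `ȟ` is obtained from
the observation that the contraction of the Casimir operator of `𝔤` with the invariant form is the
Killing form (`sum_lie_lie`).

For the injectivity of `T` one has to see that `ħ^N u = 0` implies `(D, u) = 0`. The relation
`[u, h] = -ħ D(h)` and the Fock representation, in which `ħ` acts as the identity, give `D = 0`; then
`u` is in `ħ R` modulo each `U ∘ Fⁿ`, and the vacuum vector of the Fock space shows that it vanishes
(`vir_eq_zero_of_hbar_pow_mul`).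
-/

noncomputable section

namespace TwistedSugawara

open scoped TensorProduct LaurentSeries

/-! ### The topology of the completed enveloping algebra -/

section Completion

variable {R 𝔟 : Type*} [CommRing R] [LieRing 𝔟] [LieAlgebra R 𝔟] (Φ : LieFiltration R 𝔟)

/-- The closed left ideal of `Ū𝔟` generated by `Fⁿ`, as an `R`-submodule; these form a basis of
neighbourhoods of `0`. -/
def cIdeal (n : ℕ) : Submodule R (CEnv Φ) :=
  (((leftIdeal Φ n).restrictScalars R).map (CEnv.of Φ).toLinearMap).topologicalClosure

theorem isClosed_cIdeal (n : ℕ) : IsClosed (cIdeal Φ n : Set (CEnv Φ)) :=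
  Submodule.isClosed_topologicalClosure _

theorem of_mem_cIdeal {n : ℕ} {x : FEnv Φ} (hx : x ∈ leftIdeal Φ n) : CEnv.of Φ x ∈ cIdeal Φ n :=
  Submodule.le_topologicalClosure _ ⟨x, hx, rfl⟩

theorem cIdeal_induction {n : ℕ} {p : CEnv Φ → Prop} (hp : IsClosed {e | p e})
    (h : ∀ x ∈ leftIdeal Φ n, p (CEnv.of Φ x)) {e : CEnv Φ} (he : e ∈ cIdeal Φ n) : p e := by
  refine closure_minimal ?_ hp he
  rintro _ ⟨x, hx, rfl⟩
  exact h x hx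

theorem cEnv_induction {p : CEnv Φ → Prop} (hp : IsClosed {e | p e})
    (h : ∀ x, p (CEnv.of Φ x)) (e : CEnv Φ) : p e :=
  UniformSpace.Completion.induction_on e hp h

theorem cIdeal_anti {m n : ℕ} (h : m ≤ n) : cIdeal Φ n ≤ cIdeal Φ m := fun _ he =>
  cIdeal_induction Φ (p := fun e => e ∈ cIdeal Φ m) (isClosed_cIdeal Φ m)
    (fun _ hx => of_mem_cIdeal Φ (leftIdeal_anti Φ h hx)) he

theorem nhds_zero_basis_cIdeal :
    (nhds (0 : CEnv Φ)).HasBasis (fun _ : ℕ => True) (fun n => (cIdeal Φ n : Set (CEnv Φ))) := by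
  have := (nhds_zero_basis Φ).hasBasis_of_isDenseInducing
    (UniformSpace.Completion.isDenseInducing_coe (α := FEnv Φ))
  exact this

theorem eq_zero_of_forall_mem_cIdeal {e : CEnv Φ} (h : ∀ n, e ∈ cIdeal Φ n) : e = 0 := by
  by_contra hne
  have : {e}ᶜ ∈ nhds (0 : CEnv Φ) := isOpen_compl_singleton.mem_nhds (fun h => hne h.symm)
  obtain ⟨n, -, hn⟩ := (nhds_zero_basis_cIdeal Φ).mem_iff.mp this
  exact hn (h n) rfl

theorem of_mem_cIdeal_iff {n : ℕ} {x : FEnv Φ} : CEnv.of Φ x ∈ cIdeal Φ n ↔ x ∈ leftIdeal Φ n := by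
  refine ⟨fun h => ?_, of_mem_cIdeal Φ⟩
  have hcl : IsClosed ((leftIdeal Φ n).toAddSubgroup : Set (FEnv Φ)) :=
    AddSubgroup.isClosed_of_isOpen _ (AddSubgroup.isOpen_of_mem_nhds _
      (g := 0) ((nhds_zero_basis Φ).mem_of_mem trivial))
  have h1 : x ∈ closure ((leftIdeal Φ n).toAddSubgroup : Set (FEnv Φ)) := by
    rw [(UniformSpace.Completion.isDenseInducing_coe
      (α := FEnv Φ)).isInducing.closure_eq_preimage_closure_image]
    exact h
  rw [hcl.closure_eq] at h1
  exact h1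

/-- Elements of the closure of a submodule of `U𝔟` are approximated by elements of that submodule. -/
theorem exists_sub_of_mem_cIdeal_of_mem_closure {M : Submodule R (FEnv Φ)} {u : CEnv Φ}
    (hu : u ∈ (M.map (CEnv.of Φ).toLinearMap).topologicalClosure) (n : ℕ) :
    ∃ x ∈ M, u - CEnv.of Φ x ∈ cIdeal Φ n := by
  have h1 : {v | u - v ∈ cIdeal Φ n} ∈ nhds u := by
    have h2 : Filter.Tendsto (fun v => u - v) (nhds u) (nhds 0) := by
      have : Continuous fun v : CEnv Φ => u - v := continuous_const.sub continuous_id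
      simpa using this.tendsto u
    exact h2 ((nhds_zero_basis_cIdeal Φ).mem_of_mem trivial)
  obtain ⟨v, hv, x, hx, rfl⟩ := mem_closure_iff_nhds.mp hu _ h1
  exact ⟨x, hx, hv⟩

theorem mul_mem_cIdeal {n : ℕ} (a : CEnv Φ) {e : CEnv Φ} (he : e ∈ cIdeal Φ n) :
    a * e ∈ cIdeal Φ n := by
  refine cIdeal_induction Φ (p := fun e => a * e ∈ cIdeal Φ n)
    ((isClosed_cIdeal Φ n).preimage (continuous_const_mul a)) (fun x hx => ?_) he
  refine cEnv_induction Φ (p := fun a => a * CEnv.of Φ x ∈ cIdeal Φ n)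
    ((isClosed_cIdeal Φ n).preimage (continuous_mul_const _)) (fun y => ?_) a
  rw [← map_mul]
  exact of_mem_cIdeal Φ ((leftIdeal Φ n).mul_mem_left y hx)

theorem exists_mul_right_mem_cIdeal (a : CEnv Φ) (n : ℕ) :
    ∃ m, ∀ e ∈ cIdeal Φ m, e * a ∈ cIdeal Φ n := by
  have h := ((continuous_mul_const a).tendsto (0 : CEnv Φ))
  rw [zero_mul] at h
  obtain ⟨m, -, hm⟩ := ((nhds_zero_basis_cIdeal Φ).tendsto_iff (nhds_zero_basis_cIdeal Φ)).mp h n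
    trivial
  exact ⟨m, hm⟩

theorem continuous_extend {N : Type*} [AddCommGroup N] [Module R N] [UniformSpace N]
    [IsUniformAddGroup N] [CompleteSpace N] [T2Space N] [ContinuousConstSMul R N]
    (φ : FEnv Φ →ₗ[R] N) (hφ : Continuous φ) : Continuous (extend Φ φ hφ) :=
  AddMonoidHom.continuous_extension φ.toAddMonoidHom hφ

theorem continuous_extendMap {𝔟' : Type*} [LieRing 𝔟'] [LieAlgebra R 𝔟'] (Ψ : LieFiltration R 𝔟')
    (φ : FEnv Φ →ₗ[R] FEnv Ψ) (hφ : ∀ n, ∃ m, ∀ u ∈ leftIdeal Φ m, φ u ∈ leftIdeal Ψ n) :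
    Continuous (extendMap Φ Ψ φ hφ) := by
  unfold extendMap
  exact continuous_extend _ _ _

theorem extendMap_of {𝔟' : Type*} [LieRing 𝔟'] [LieAlgebra R 𝔟'] (Ψ : LieFiltration R 𝔟')
    (φ : FEnv Φ →ₗ[R] FEnv Ψ) (hφ : ∀ n, ∃ m, ∀ u ∈ leftIdeal Φ m, φ u ∈ leftIdeal Ψ n)
    (u : FEnv Φ) : extendMap Φ Ψ φ hφ (CEnv.of Φ u) = CEnv.of Ψ (φ u) := extend_of _ _ _ u

theorem extendMap_mem_cIdeal {𝔟' : Type*} [LieRing 𝔟'] [LieAlgebra R 𝔟'] (Ψ : LieFiltration R 𝔟')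
    (φ : FEnv Φ →ₗ[R] FEnv Ψ) (hφ : ∀ n, ∃ m, ∀ u ∈ leftIdeal Φ m, φ u ∈ leftIdeal Ψ n)
    {m n : ℕ} (h : ∀ u ∈ leftIdeal Φ m, φ u ∈ leftIdeal Ψ n) {e : CEnv Φ} (he : e ∈ cIdeal Φ m) :
    extendMap Φ Ψ φ hφ e ∈ cIdeal Ψ n := by
  refine cIdeal_induction Φ (p := fun e => extendMap Φ Ψ φ hφ e ∈ cIdeal Ψ n)
    ((isClosed_cIdeal Ψ n).preimage (continuous_extendMap Φ Ψ φ hφ)) (fun x hx => ?_) he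
  rw [extendMap_of]
  exact of_mem_cIdeal Ψ (h x hx)

theorem extendDiscrete_eq_zero {N : Type*} [AddCommGroup N] [Module R N] (φ : FEnv Φ →ₗ[R] N)
    (hφ : ∃ n, ∀ u ∈ leftIdeal Φ n, φ u = 0) {n : ℕ} (h : ∀ u ∈ leftIdeal Φ n, φ u = 0)
    {e : CEnv Φ} (he : e ∈ cIdeal Φ n) : extendDiscrete Φ φ hφ e = 0 := by
  let _ : UniformSpace N := ⊥
  have _ : DiscreteUniformity N := ⟨rfl⟩
  have _ : IsUniformAddGroup N := ⟨DiscreteUniformity.uniformContinuous _ _⟩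
  have _ : ContinuousConstSMul R N := ⟨fun _ => continuous_of_discreteTopology⟩
  refine cIdeal_induction Φ (p := fun e => extendDiscrete Φ φ hφ e = 0)
    (isClosed_eq (by unfold extendDiscrete; exact continuous_extend _ _ _) continuous_const)
    (fun x hx => ?_) he
  rw [extendDiscrete_of, h x hx]

end Completion

/-! ### Derivations and differentials of Laurent series in coordinates -/

section Laurent

variable {R : Type*} [CommRing R]

/-- The monomial `t^k`. -/
def tpow (R : Type*) [CommRing R] (k : ℤ) : R⸨X⸩ := HahnSeries.single k 1

theorem tpow_mul (k l : ℤ) : tpow R k * tpow R l = tpow R (k + l) := by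
  simp [tpow, HahnSeries.single_mul_single]

theorem tpow_mem_fil (k : ℤ) : tpow R k ∈ fil R k := fun i hi => by
  rw [tpow, HahnSeries.coeff_single_of_ne (by omega)]

theorem coeff_tpow_mul (k : ℤ) (f : R⸨X⸩) (i : ℤ) : (tpow R k * f).coeff i = f.coeff (i - k) := by
  have := HahnSeries.coeff_single_mul_add (r := (1 : R)) (x := f) (a := i - k) (b := k)
  rwa [sub_add_cancel, one_mul] at this

theorem ddtDer_tpow (k : ℤ) : ddtDer R (tpow R k) = (k : R) • tpow R (k - 1) := by
  ext n
  rw [ddtDer_coeff, HahnSeries.coeff_smul, smul_eq_mul, tpow, tpow, HahnSeries.coeff_single,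
    HahnSeries.coeff_single]
  by_cases h : n = k - 1
  · subst h; simp
  · rw [if_neg h, if_neg (by omega), mul_zero, mul_zero]

theorem sum_tpow_coeff (s : Finset ℤ) (c : ℤ → R) (i : ℤ) :
    (∑ k ∈ s, c k • tpow R k).coeff i = if i ∈ s then c i else 0 := by
  classical
  rw [HahnSeries.coeff_sum]
  simp only [HahnSeries.coeff_smul, tpow, HahnSeries.coeff_single, smul_eq_mul, mul_ite, mul_one,
    mul_zero]
  rw [Finset.sum_ite_eq]

/-- A Laurent series is a Laurent polynomial modulo `Fⁿ`. -/
theorem sub_sum_tpow_mem_fil {f : R⸨X⸩} {m n : ℤ} (hf : f ∈ fil R m) :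
    f - ∑ k ∈ Finset.Ico m n, f.coeff k • tpow R k ∈ fil R n := by
  intro i hi
  rw [HahnSeries.coeff_sub, sum_tpow_coeff]
  split_ifs with h
  · exact sub_self _
  · rw [Finset.mem_Ico] at h
    rw [hf i (by omega), sub_zero]

theorem exists_mem_fil_of_le (f : R⸨X⸩) : ∃ N₀ : ℕ, ∀ N : ℕ, N₀ ≤ N → f ∈ fil R (-N) := by
  obtain ⟨N, hN⟩ := exists_mem_fil f
  exact ⟨N, fun M hM => fil_anti (by omega) hN⟩

theorem tpow_zero : tpow R 0 = 1 := rfl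

/-- A continuous derivation which kills `t` is zero. -/
theorem theta_eq_zero (D : theta R) (h : D.1 (tpow R 1) = 0) : D = 0 := by
  have h1 : ∀ n : ℕ, D.1 (tpow R n) = 0 := by
    intro n
    induction n with
    | zero => exact D.1.map_one_eq_zero
    | succ n ih =>
      rw [show ((n + 1 : ℕ) : ℤ) = n + 1 by push_cast; rfl, ← tpow_mul, D.1.leibniz, ih, h]
      simp
  have h2 : ∀ k : ℤ, D.1 (tpow R k) = 0 := by
    intro k
    obtain ⟨n, rfl | rfl⟩ := k.eq_nat_or_neg
    · exact h1 n
    · have h3 : D.1 (tpow R (n : ℤ) * tpow R (-n : ℤ)) = 0 := by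
        rw [tpow_mul, add_neg_cancel]
        exact D.1.map_one_eq_zero
      rw [D.1.leibniz, h1, smul_zero, add_zero, smul_eq_mul] at h3
      have h4 := congrArg (fun x => tpow R (-n : ℤ) * x) h3
      simpa only [← mul_assoc, tpow_mul, neg_add_cancel, tpow_zero, one_mul, mul_zero] using h4
  -- `D` kills Laurent polynomials, and these are dense
  refine Subtype.ext (Derivation.ext fun f => ?_)
  ext i
  obtain ⟨m, hm⟩ := D.2 (i + 1)
  obtain ⟨N, hN⟩ := exists_mem_fil f
  have h3 := hm _ (sub_sum_tpow_mem_fil (n := m) hN) i (by omega)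
  rw [map_sub, map_sum, Finset.sum_eq_zero fun k _ => by
    rw [Derivation.map_smul, h2, smul_zero], sub_zero] at h3
  exact h3

theorem ddtDer_tpow_one : ddtDer R (tpow R 1) = 1 := by
  rw [ddtDer_tpow]; simp [tpow_zero]

/-- Every continuous derivation is a multiple of `d/dt`. -/
theorem theta_eq_smul_ddt (D : theta R) : D = D.1 (tpow R 1) • ddt R := by
  rw [← sub_eq_zero]
  apply theta_eq_zero
  change D.1 (tpow R 1) - D.1 (tpow R 1) * ddtDer R (tpow R 1) = 0
  rw [ddtDer_tpow_one, mul_one, sub_self]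

theorem theta_apply (D : theta R) (f : R⸨X⸩) : D.1 f = D.1 (tpow R 1) * ddtDer R f :=
  congrArg (fun E : theta R => E.1 f) (theta_eq_smul_ddt D)

theorem omega_apply (α : Omega R) (D : theta R) : α D = D.1 (tpow R 1) * α (ddt R) := by
  conv_lhs => rw [theta_eq_smul_ddt D, map_smul, smul_eq_mul]

theorem res_smul (f : R⸨X⸩) (α : Omega R) : res R (f • α) = (f * α (ddt R)).coeff (-1) := rfl

/-- The differential `t^{-k-1} dt`, which is dual to `t^k` for the residue pairing. -/
def tau (R : Type*) [CommRing R] (k : ℤ) : Omega R := tpow R (-k - 1) • dif R (tpow R 1)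

theorem tau_ddt (k : ℤ) : tau R k (ddt R) = tpow R (-k - 1) := by
  change tpow R (-k - 1) * ddtDer R (tpow R 1) = _
  rw [ddtDer_tpow_one, mul_one]

theorem res_smul_tau (f : R⸨X⸩) (k : ℤ) : res R (f • tau R k) = f.coeff k := by
  rw [res_smul, tau_ddt, mul_comm, coeff_tpow_mul]
  congr 1
  ring

/-- The values of the symmetric form attached to `D` are the coefficients of `D t`. -/
theorem res_tau_smul_tau (D : theta R) (k l : ℤ) :
    res R (tau R k D • tau R l) = (D.1 (tpow R 1)).coeff (k + l + 1) := by
  rw [res_smul_tau, omega_apply, tau_ddt, mul_comm, coeff_tpow_mul]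
  congr 1
  ring

end Laurent

/-! ### Quadratic elements and their symmetric forms -/

section Quadratic

variable {R : Type*} [CommRing R]

/-- The linear map `R((t)) → U𝔩̂`. -/
def ell (R : Type*) [CommRing R] : R⸨X⸩ →ₗ[R] FEnv (lFil R) := FEnv.ι (lFil R) ∘ₗ LHat.inc R

/-- The element `ħ` of `U𝔩̂`. -/
abbrev hbarF (R : Type*) [CommRing R] : FEnv (lFil R) := FEnv.ι (lFil R) (LHat.hbar R)

theorem hbarF_mul (x : FEnv (lFil R)) : hbarF R * x = x * hbarF R := by
  have h2 : ∀ x, FEnv.ι (lFil R) x ∈ Subalgebra.centralizer R {hbarF R} := fun x => by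
    rw [Subalgebra.mem_centralizer_iff]
    rintro _ rfl
    rw [FEnv.ι_mul, LHat.hbar_lie, map_zero, add_zero]
  exact (Subalgebra.mem_centralizer_iff R).mp (FEnv.mem_of_subalgebra _ _ h2 x) _ rfl

theorem ell_mul (f g : R⸨X⸩) :
    ell R f * ell R g = ell R g * ell R f + resPair R f g • hbarF R := by
  have h1 : ⁅LHat.inc R f, LHat.inc R g⁆ = resPair R f g • LHat.hbar R := by
    let _ : LieRing R⸨X⸩ := LieRing.ofAssociativeRing
    let _ : LieAlgebra R R⸨X⸩ := LieAlgebra.ofAssociativeAlgebra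
    have h := CentralExt.inl_lie_inl (lCocycle R) f g
    have h2 : ⁅f, g⁆ = 0 := by rw [LieRing.of_associative_ring_bracket, mul_comm, sub_self]
    rw [h2, map_zero, zero_add] at h
    exact h
  have h := FEnv.ι_mul (lFil R) (LHat.inc R f) (LHat.inc R g)
  rw [h1, map_smul] at h
  exact h

theorem ell_mem_leftIdeal {f : R⸨X⸩} {n : ℕ} (hf : f ∈ fil R n) : ell R f ∈ leftIdeal (lFil R) n :=
  Ideal.subset_span ⟨_, ⟨f, hf, rfl⟩, rfl⟩

theorem lTwo_induction {p : FEnv (lFil R) → Prop} (zero : p 0) (add : ∀ x y, p x → p y → p (x + y))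
    (smul : ∀ (r : R) x, p x → p (r • x)) (mul : ∀ f g, p (ell R f * ell R g)) (hbar : p (hbarF R))
    {u : FEnv (lFil R)} (hu : u ∈ lTwo R) : p u := by
  induction hu using Submodule.span_induction with
  | zero => exact zero
  | add x y _ _ hx hy => exact add x y hx hy
  | smul r x _ hx => exact smul r x hx
  | mem x hx =>
    rcases hx with ⟨f, g, rfl⟩ | rfl
    · exact mul f g
    · exact hbar

theorem lTwo_ext {M : Type*} [AddCommGroup M] [Module R M] {φ ψ : FEnv (lFil R) →ₗ[R] M}
    (mul : ∀ f g, φ (ell R f * ell R g) = ψ (ell R f * ell R g)) (hbar : φ (hbarF R) = ψ (hbarF R))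
    {u : FEnv (lFil R)} (hu : u ∈ lTwo R) : φ u = ψ u := by
  refine lTwo_induction (p := fun u => φ u = ψ u) ?_ ?_ ?_ mul hbar hu
  · rw [map_zero, map_zero]
  · intro x y hx hy; rw [map_add, map_add, hx, hy]
  · intro r x hx; rw [map_smul, map_smul, hx]

theorem ell_mul_ell_mem_lTwo (f g : R⸨X⸩) : ell R f * ell R g ∈ lTwo R :=
  Submodule.subset_span (Or.inl ⟨f, g, rfl⟩)

theorem of_mem_lTwoBar {u : FEnv (lFil R)} (hu : u ∈ lTwo R) :
    CEnv.of (lFil R) u ∈ lTwoBar R := Submodule.le_topologicalClosure _ ⟨u, hu, rfl⟩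

theorem lTwoBar_induction {p : CEnv (lFil R) → Prop} (hp : IsClosed {u | p u})
    (h : ∀ u ∈ lTwo R, p (CEnv.of (lFil R) u)) {u : CEnv (lFil R)} (hu : u ∈ lTwoBar R) : p u := by
  refine closure_minimal ?_ hp hu
  rintro _ ⟨x, hx, rfl⟩
  exact h x hx

theorem exists_mem_lTwo_sub_mem {u : CEnv (lFil R)} (hu : u ∈ lTwoBar R) (n : ℕ) :
    ∃ x ∈ lTwo R, u - CEnv.of (lFil R) x ∈ cIdeal (lFil R) n :=
  exists_sub_of_mem_cIdeal_of_mem_closure _ hu n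

theorem pairing_mul (α β : Omega R) (f g : R⸨X⸩) :
    pairing R α β (CEnv.of (lFil R) (ell R f * ell R g)) = symForm R α β f g :=
  (extendDiscrete_of _ _ _ _).trans (quad_mul _ _ _ f g)

theorem res_smul_eq_zero {s : R⸨X⸩} {α : Omega R} {n : ℤ} (hs : s ∈ fil R n)
    (hα : α (ddt R) ∈ fil R (-n)) : res R (s • α) = 0 :=
  mul_mem_fil hs hα _ (by omega)

theorem pairing_eq_zero {α β : Omega R} {n : ℕ} (hα : α (ddt R) ∈ fil R (-n))
    (hβ : β (ddt R) ∈ fil R (-n)) {e : CEnv (lFil R)} (he : e ∈ cIdeal (lFil R) n) :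
    pairing R α β e = 0 := by
  refine extendDiscrete_eq_zero (n := n) _ _ _ (fun u hu => ?_) he
  refine quad_mem (symForm R α β) 0 _ (⊥ : Submodule R R) n (fun g s hs => ?_) u hu
  rw [symForm_apply, res_smul_eq_zero hs hα, res_smul_eq_zero hs hβ, mul_zero, mul_zero, add_zero]
  exact zero_mem _

/-- The value of a form at `α` and `β` depends only on the class modulo `Fⁿ`, where `n` bounds the
poles of `α` and `β`. -/
theorem pairing_eq_of_sub_mem {α β : Omega R} {n : ℕ} (hα : α (ddt R) ∈ fil R (-n))
    (hβ : β (ddt R) ∈ fil R (-n)) {u v : CEnv (lFil R)} (h : u - v ∈ cIdeal (lFil R) n) :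
    pairing R α β u = pairing R α β v := by
  rw [← sub_eq_zero, ← map_sub, pairing_eq_zero hα hβ h]

theorem symForm_tau (k l : ℤ) (f g : R⸨X⸩) : symForm R (tau R k) (tau R l) f g =
    f.coeff k * g.coeff l + f.coeff l * g.coeff k := by
  rw [symForm_apply, res_smul_tau, res_smul_tau, res_smul_tau, res_smul_tau]

/-- A symmetric bilinear map satisfies the hypothesis of `quad` with `ħ ↦ 0`. -/
theorem sub_zero_of_symm {M : Type*} [AddCommGroup M] [Module R M]
    {B : R⸨X⸩ →ₗ[R] R⸨X⸩ →ₗ[R] M} (hB : ∀ f g, B f g = B g f) (f g : R⸨X⸩) :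
    B f g - B g f = resPair R f g • (0 : M) := by
  rw [hB, sub_self, smul_zero]

/-- A symmetric bilinear map on `R((t))` which kills `Fⁿ` is determined by its values on monomials,
so that its value on an element of `𝔩₂` can be computed from the symmetric form of that element. -/
theorem two_smul_quad_eq_sum {M : Type*} [AddCommGroup M] [Module R M]
    {B : R⸨X⸩ →ₗ[R] R⸨X⸩ →ₗ[R] M} (hB : ∀ f g, B f g = B g f) {n : ℤ}
    (hn : ∀ f, ∀ s ∈ fil R n, B f s = 0) {u : FEnv (lFil R)} (hu : u ∈ lTwo R) :
    ∃ N₀ : ℕ, ∀ N : ℕ, N₀ ≤ N → (2 : R) • quad B 0 (sub_zero_of_symm hB) u =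
      ∑ k ∈ Finset.Ico (-N : ℤ) n, ∑ l ∈ Finset.Ico (-N : ℤ) n,
        pairing R (tau R k) (tau R l) (CEnv.of (lFil R) u) • B (tpow R k) (tpow R l) := by
  refine lTwo_induction (p := fun u => ∃ N₀ : ℕ, ∀ N : ℕ, N₀ ≤ N →
      (2 : R) • quad B 0 (sub_zero_of_symm hB) u =
      ∑ k ∈ Finset.Ico (-N : ℤ) n, ∑ l ∈ Finset.Ico (-N : ℤ) n,
        pairing R (tau R k) (tau R l) (CEnv.of (lFil R) u) • B (tpow R k) (tpow R l))
    ?_ ?_ ?_ ?_ ?_ hu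
  · exact ⟨0, fun N _ => by simp⟩
  · rintro x y ⟨N₁, h₁⟩ ⟨N₂, h₂⟩
    refine ⟨max N₁ N₂, fun N hN => ?_⟩
    rw [map_add, smul_add, h₁ N (le_of_max_le_left hN), h₂ N (le_of_max_le_right hN)]
    simp only [map_add, add_smul, Finset.sum_add_distrib]
  · rintro r x ⟨N₁, h₁⟩
    refine ⟨N₁, fun N hN => ?_⟩
    rw [map_smul, smul_comm, h₁ N hN]
    simp only [map_smul, smul_eq_mul, mul_smul, Finset.smul_sum]
  · intro f g
    obtain ⟨N₁, h₁⟩ := exists_mem_fil_of_le f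
    obtain ⟨N₂, h₂⟩ := exists_mem_fil_of_le g
    refine ⟨max N₁ N₂, fun N hN => ?_⟩
    -- the expansion of `B a b` in monomials, truncated at `Fⁿ`
    have hexp : ∀ a b : R⸨X⸩, a ∈ fil R (-N) → b ∈ fil R (-N) →
        B a b = ∑ k ∈ Finset.Ico (-N : ℤ) n, ∑ l ∈ Finset.Ico (-N : ℤ) n,
          (a.coeff k * b.coeff l) • B (tpow R k) (tpow R l) := by
      intro a b ha hb
      have e1 : ∀ c, B c b = B c (∑ l ∈ Finset.Ico (-N : ℤ) n, b.coeff l • tpow R l) := fun c => by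
        rw [← sub_eq_zero, ← map_sub, hn _ _ (sub_sum_tpow_mem_fil hb)]
      have e2 : ∀ c, B a c = B (∑ l ∈ Finset.Ico (-N : ℤ) n, a.coeff l • tpow R l) c := fun c => by
        rw [hB, hB _ c, ← sub_eq_zero, ← map_sub, hn _ _ (sub_sum_tpow_mem_fil ha)]
      rw [e1, e2]
      simp only [map_sum, LinearMap.sum_apply, map_smul, LinearMap.smul_apply, mul_smul]
      rw [Finset.sum_comm]
      simp only [Finset.smul_sum]
      exact Finset.sum_congr rfl fun k _ => Finset.sum_congr rfl fun l _ => smul_comm _ _ _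
    have hf := h₁ N (le_of_max_le_left hN)
    have hg := h₂ N (le_of_max_le_right hN)
    rw [show quad B 0 (sub_zero_of_symm hB) (ell R f * ell R g) = B f g from
      quad_mul _ _ _ f g, two_smul]
    simp only [pairing_mul, symForm_tau, add_smul, Finset.sum_add_distrib]
    congr 1
    · exact hexp f g hf hg
    · rw [hB, hexp g f hg hf]
      exact Finset.sum_congr rfl fun k _ => Finset.sum_congr rfl fun l _ => by rw [mul_comm]
  · refine ⟨0, fun N _ => ?_⟩
    rw [show quad B 0 (sub_zero_of_symm hB) (hbarF R) = 0 from quad_hbar _ _ _, smul_zero]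
    symm
    exact Finset.sum_eq_zero fun k _ => Finset.sum_eq_zero fun l _ => by
      rw [pairing_hbar, zero_smul]

end Quadratic

/-! ### The action of `θ̂` on the Heisenberg algebra -/

section Heisenberg

variable {R : Type*} [CommRing R]

theorem resPair_theta_right (D : theta R) (f g : R⸨X⸩) :
    resPair R f (D.1 g) = (D.1 (tpow R 1) * ddtDer R f * ddtDer R g).coeff (-1) := by
  rw [resPair_apply, res_smul_dif, theta_apply D g]
  congr 1
  ring

/-- Continuous derivations preserve the residue pairing. -/
theorem resPair_theta (D : theta R) (f g : R⸨X⸩) :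
    resPair R (D.1 f) g + resPair R f (D.1 g) = 0 := by
  rw [resPair_skew, resPair_theta_right, resPair_theta_right, mul_right_comm, neg_add_cancel]

/-- The bilinear map `(f, g) ↦ Res (h dg) f + Res (h df) g`, which describes `ħ⁻¹ [f ∘ g, h]`. -/
def adForm (h : R⸨X⸩) : R⸨X⸩ →ₗ[R] R⸨X⸩ →ₗ[R] R⸨X⸩ :=
  let l : R⸨X⸩ →ₗ[R] R⸨X⸩ →ₗ[R] R⸨X⸩ := LinearMap.lsmul R R⸨X⸩ ∘ₗ (resPair R).flip h
  l + l.flip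

theorem adForm_apply (h f g : R⸨X⸩) :
    adForm h f g = resPair R f h • g + resPair R g h • f := rfl

theorem adForm_symm (h f g : R⸨X⸩) : adForm h f g = adForm h g f := by
  rw [adForm_apply, adForm_apply, add_comm]

/-- The linear map `U𝔩̂ → 𝔩` with `[u, h] = ħ adQuad h u` for `u` in `𝔩₂`. -/
def adQuad (h : R⸨X⸩) : FEnv (lFil R) →ₗ[R] R⸨X⸩ :=
  quad (adForm h) 0 (sub_zero_of_symm (adForm_symm h))

theorem adQuad_mul (h f g : R⸨X⸩) : adQuad h (ell R f * ell R g) = adForm h f g := quad_mul _ _ _ f g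

theorem adQuad_hbar (h : R⸨X⸩) : adQuad h (hbarF R) = 0 := quad_hbar _ _ _

theorem lTwo_commutator (h : R⸨X⸩) {u : FEnv (lFil R)} (hu : u ∈ lTwo R) :
    u * ell R h - ell R h * u = hbarF R * ell R (adQuad h u) := by
  refine lTwo_ext (φ := LinearMap.mulRight R (ell R h) - LinearMap.mulLeft R (ell R h))
    (ψ := LinearMap.mulLeft R (hbarF R) ∘ₗ ell R ∘ₗ adQuad h) (fun f g => ?_) ?_ hu
  · change ell R f * ell R g * ell R h - ell R h * (ell R f * ell R g) =
      hbarF R * ell R (adQuad h (ell R f * ell R g))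
    rw [adQuad_mul, adForm_apply, mul_assoc, ell_mul g h, mul_add, ← mul_assoc, ell_mul f h,
      map_add, map_smul, map_smul, hbarF_mul, mul_smul_comm, add_mul, smul_mul_assoc, hbarF_mul,
      add_mul, smul_mul_assoc, smul_mul_assoc, mul_assoc]
    abel
  · change hbarF R * ell R h - ell R h * hbarF R = hbarF R * ell R (adQuad h (hbarF R))
    rw [adQuad_hbar, map_zero, mul_zero, hbarF_mul, sub_self]

/-- The coefficients of `[u, h]/ħ` are values of the symmetric form of `u`. -/
theorem adQuad_coeff (h : R⸨X⸩) (i : ℤ) {u : FEnv (lFil R)} (hu : u ∈ lTwo R) :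
    (adQuad h u).coeff i = -pairing R (dif R h) (tau R i) (CEnv.of (lFil R) u) := by
  let c : R⸨X⸩ →ₗ[R] R :=
    { toFun := fun f => f.coeff i, map_add' := fun _ _ => rfl, map_smul' := fun _ _ => rfl }
  refine lTwo_ext (φ := c ∘ₗ adQuad h)
    (ψ := -(pairing R (dif R h) (tau R i) ∘ₗ (CEnv.of (lFil R)).toLinearMap)) (fun f g => ?_) ?_ hu
  · change (adQuad h (ell R f * ell R g)).coeff i =
      -pairing R (dif R h) (tau R i) (CEnv.of (lFil R) (ell R f * ell R g))
    rw [adQuad_mul, pairing_mul, symForm_apply, res_smul_tau, res_smul_tau, adForm_apply,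
      HahnSeries.coeff_add, HahnSeries.coeff_smul, HahnSeries.coeff_smul, resPair_skew R f h,
      resPair_skew R g h, resPair_apply, resPair_apply, smul_eq_mul, smul_eq_mul]
    ring
  · change (adQuad h (hbarF R)).coeff i = -pairing R _ _ (CEnv.of (lFil R) (hbarF R))
    rw [adQuad_hbar, pairing_hbar, neg_zero]
    rfl

theorem res_dif_smul (h : R⸨X⸩) (D : theta R) (β : Omega R) :
    res R (dif R h D • β) = res R (D.1 h • β) := rfl

/-- If `u` in `𝔩₂` approximates the second component of `(D, u')` in `θ̂`, then `adQuad h u`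
approximates `-D h`. -/
theorem adQuad_add_mem_fil (x : Vir R) {h : R⸨X⸩} {m n : ℕ} (hnm : n ≤ m)
    (hh : ddtDer R h ∈ fil R (-m)) {u : FEnv (lFil R)} (hu : u ∈ lTwo R)
    (hxu : x.1.2 - CEnv.of (lFil R) u ∈ cIdeal (lFil R) m) :
    adQuad h u + x.1.1.1 h ∈ fil R n := by
  intro i hi
  have hτ : tau R i (ddt R) ∈ fil R (-m) := by
    rw [tau_ddt]
    exact fil_anti (by omega) (tpow_mem_fil _)
  rw [HahnSeries.coeff_add, adQuad_coeff h i hu, ← pairing_eq_of_sub_mem hh hτ hxu, x.2.2,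
    res_dif_smul, res_smul_tau, neg_add_cancel]

theorem of_hbarF_comm (a : CEnv (lFil R)) :
    CEnv.of (lFil R) (hbarF R) * a = a * CEnv.of (lFil R) (hbarF R) :=
  (Subring.mem_center_iff.mp (of_mem_center (lFil R) (LHat.hbar_lie R)) a).symm

/-- For `(D, u)` in `θ̂` and `h` in `𝔩`, one has `[u, h] = -ħ D(h)`. -/
theorem vir_commutator_ell (x : Vir R) (h : R⸨X⸩) :
    x.1.2 * CEnv.of (lFil R) (ell R h) - CEnv.of (lFil R) (ell R h) * x.1.2 =
      -(CEnv.of (lFil R) (hbarF R) * CEnv.of (lFil R) (ell R (x.1.1.1 h))) := by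
  rw [← sub_eq_zero]
  refine eq_zero_of_forall_mem_cIdeal _ fun n => ?_
  obtain ⟨m₁, h₁⟩ := exists_mul_right_mem_cIdeal (lFil R) (CEnv.of (lFil R) (ell R h)) n
  obtain ⟨m₂, h₂⟩ := exists_mem_fil_of_le (ddtDer R h)
  let m := max n (max m₁ m₂)
  have hnm : n ≤ m := le_max_left _ _
  have hm₁ : m₁ ≤ m := (le_max_left _ _).trans (le_max_right _ _)
  have hm₂ : m₂ ≤ m := (le_max_right _ _).trans (le_max_right _ _)
  obtain ⟨u, hu, hxu⟩ := exists_mem_lTwo_sub_mem x.2.1 m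
  have e1 := h₁ _ (cIdeal_anti _ hm₁ hxu)
  have e2 := mul_mem_cIdeal _ (CEnv.of (lFil R) (ell R h)) (cIdeal_anti _ hnm hxu)
  have e3 : CEnv.of (lFil R) (hbarF R * ell R (adQuad h u + x.1.1.1 h)) ∈ cIdeal (lFil R) n :=
    of_mem_cIdeal _ ((leftIdeal _ n).mul_mem_left _ (ell_mem_leftIdeal
      (adQuad_add_mem_fil x hnm (h₂ m hm₂) hu hxu)))
  have e4 := congrArg (CEnv.of (lFil R)) (lTwo_commutator h hu)
  have e5 := add_mem (sub_mem e1 e2) e3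
  rw [map_add, mul_add, map_add, ← e4] at e5
  simp only [map_mul, map_sub] at e5
  convert e5 using 1
  noncomm_ring

/-- The bilinear map `(f, g) ↦ D f ∘ g + f ∘ D g`. -/
def lieForm (D : theta R) : R⸨X⸩ →ₗ[R] R⸨X⸩ →ₗ[R] FEnv (lFil R) :=
  (LinearMap.mul R (FEnv (lFil R))).compl₁₂ (ell R ∘ₗ D.1.toLinearMap) (ell R) +
    (LinearMap.mul R (FEnv (lFil R))).compl₁₂ (ell R) (ell R ∘ₗ D.1.toLinearMap)

theorem lieForm_apply (D : theta R) (f g : R⸨X⸩) :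
    lieForm D f g = ell R (D.1 f) * ell R g + ell R f * ell R (D.1 g) := rfl

theorem lieForm_symm (D : theta R) (f g : R⸨X⸩) : lieForm D f g = lieForm D g f := by
  rw [lieForm_apply, lieForm_apply, ell_mul (D.1 f), ell_mul f, add_add_add_comm, ← add_smul,
    resPair_theta, zero_smul, add_zero, add_comm]

/-- A linear map on `U𝔩̂` which on `𝔩₂` is the action of a continuous derivation. -/
def lieU (D : theta R) : FEnv (lFil R) →ₗ[R] FEnv (lFil R) :=
  quad (lieForm D) 0 (sub_zero_of_symm (lieForm_symm D))

theorem lieU_mul (D : theta R) (f g : R⸨X⸩) :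
    lieU D (ell R f * ell R g) = ell R (D.1 f) * ell R g + ell R f * ell R (D.1 g) :=
  quad_mul _ _ _ f g

theorem lieU_hbar (D : theta R) : lieU D (hbarF R) = 0 := quad_hbar _ _ _

theorem exists_lieU_mem (D : theta R) (n : ℕ) :
    ∃ m, ∀ u ∈ leftIdeal (lFil R) m, lieU D u ∈ leftIdeal (lFil R) n := by
  obtain ⟨m, hm⟩ := D.2 n
  refine ⟨max n m.toNat, quad_mem _ _ _ ((leftIdeal (lFil R) n).restrictScalars R) _
    fun g s hs => ?_⟩
  rw [lieForm_apply]
  refine add_mem ((leftIdeal (lFil R) n).mul_mem_left _ ?_)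
    ((leftIdeal (lFil R) n).mul_mem_left _ ?_)
  · exact ell_mem_leftIdeal (fil_anti (by push_cast; omega) hs)
  · exact ell_mem_leftIdeal (hm _ (fil_anti (by push_cast; omega) hs))

/-- A continuous linear map on `Ū𝔩̂` which on the closure of `𝔩₂` is the action of a continuous
derivation. -/
def lieHat (D : theta R) : CEnv (lFil R) →ₗ[R] CEnv (lFil R) :=
  extendMap (lFil R) (lFil R) (lieU D) (exists_lieU_mem D)

theorem lieHat_of (D : theta R) (u : FEnv (lFil R)) :
    lieHat D (CEnv.of (lFil R) u) = CEnv.of (lFil R) (lieU D u) := extendMap_of _ _ _ _ u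

theorem continuous_lieHat (D : theta R) : Continuous (lieHat D) := continuous_extendMap _ _ _ _

theorem lieU_mem_lTwo (D : theta R) {u : FEnv (lFil R)} (hu : u ∈ lTwo R) : lieU D u ∈ lTwo R := by
  refine lTwo_induction (p := fun u => lieU D u ∈ lTwo R) ?_ ?_ ?_ (fun f g => ?_) ?_ hu
  · rw [map_zero]; exact zero_mem _
  · intro x y hx hy; rw [map_add]; exact add_mem hx hy
  · intro r x hx; rw [map_smul]; exact Submodule.smul_mem _ r hx
  · rw [lieU_mul]; exact add_mem (ell_mul_ell_mem_lTwo _ _) (ell_mul_ell_mem_lTwo _ _)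
  · rw [lieU_hbar]; exact zero_mem _

theorem lieHat_mem_lTwoBar (D : theta R) {u : CEnv (lFil R)} (hu : u ∈ lTwoBar R) :
    lieHat D u ∈ lTwoBar R := by
  refine lTwoBar_induction (p := fun u => lieHat D u ∈ lTwoBar R)
    (isClosed_closure.preimage (continuous_lieHat D)) (fun v hv => ?_) hu
  rw [lieHat_of]
  exact of_mem_lTwoBar (lieU_mem_lTwo D hv)

/-- For `(D, u)` in `θ̂`, the commutator with `u` is `-ħ` times the action of `D`. -/
theorem vir_commutator (x : Vir R) {v : CEnv (lFil R)} (hv : v ∈ lTwoBar R) :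
    x.1.2 * v - v * x.1.2 = -(CEnv.of (lFil R) (hbarF R) * lieHat x.1.1 v) := by
  refine lTwoBar_induction
    (p := fun v => x.1.2 * v - v * x.1.2 = -(CEnv.of (lFil R) (hbarF R) * lieHat x.1.1 v))
    (isClosed_eq ((continuous_const_mul _).sub (continuous_mul_const _))
      ((continuous_const_mul _).comp (continuous_lieHat _)).neg) (fun v hv => ?_) hv
  rw [lieHat_of]
  refine lTwo_ext
    (φ := (LinearMap.mulLeft R x.1.2 - LinearMap.mulRight R x.1.2) ∘ₗ
      (CEnv.of (lFil R)).toLinearMap)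
    (ψ := -(LinearMap.mulLeft R (CEnv.of (lFil R) (hbarF R)) ∘ₗ (CEnv.of (lFil R)).toLinearMap ∘ₗ
      lieU x.1.1)) (fun f g => ?_) ?_ hv
  · change x.1.2 * CEnv.of (lFil R) (ell R f * ell R g) - CEnv.of (lFil R) (ell R f * ell R g) *
      x.1.2 = -(CEnv.of (lFil R) (hbarF R) * CEnv.of (lFil R) (lieU x.1.1 (ell R f * ell R g)))
    rw [lieU_mul, map_mul, map_add, map_mul, map_mul]
    have h1 := vir_commutator_ell x f
    have h2 := vir_commutator_ell x g
    rw [sub_eq_iff_eq_add] at h1 h2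
    have h3 := of_hbarF_comm (CEnv.of (lFil R) (ell R f))
    rw [← mul_assoc, h1, add_mul, mul_assoc (CEnv.of (lFil R) (ell R f)), h2, mul_add, mul_neg,
      ← mul_assoc (CEnv.of (lFil R) (ell R f)) (CEnv.of (lFil R) (hbarF R)), ← h3]
    noncomm_ring
  · change x.1.2 * CEnv.of (lFil R) (hbarF R) - CEnv.of (lFil R) (hbarF R) * x.1.2 =
      -(CEnv.of (lFil R) (hbarF R) * CEnv.of (lFil R) (lieU x.1.1 (hbarF R)))
    rw [lieU_hbar, map_zero, mul_zero, neg_zero, of_hbarF_comm, sub_self]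

/-- `Res (D(f) α) = -Res (f d(α(D)))`: the Lie derivative of a differential `α` along `D` is
`d(α(D))`. -/
theorem res_theta_smul (D : theta R) (f : R⸨X⸩) (α : Omega R) :
    res R (D.1 f • α) = -res R (f • dif R (α D)) := by
  rw [← resPair_apply, resPair_skew, neg_neg, resPair_apply, res_smul, res_smul_dif, theta_apply,
    omega_apply α D]
  congr 1
  ring

theorem pairing_lieHat_of (D : theta R) (α β : Omega R) {u : FEnv (lFil R)} (hu : u ∈ lTwo R) :
    pairing R α β (lieHat D (CEnv.of (lFil R) u)) =
      -pairing R (dif R (α D)) β (CEnv.of (lFil R) u) -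
        pairing R α (dif R (β D)) (CEnv.of (lFil R) u) := by
  refine lTwo_ext
    (φ := pairing R α β ∘ₗ lieHat D ∘ₗ (CEnv.of (lFil R)).toLinearMap)
    (ψ := -(pairing R (dif R (α D)) β ∘ₗ (CEnv.of (lFil R)).toLinearMap) -
        pairing R α (dif R (β D)) ∘ₗ (CEnv.of (lFil R)).toLinearMap) (fun f g => ?_) ?_ hu
  · change pairing R α β (lieHat D (CEnv.of (lFil R) (ell R f * ell R g))) =
      -pairing R (dif R (α D)) β (CEnv.of (lFil R) (ell R f * ell R g)) -
        pairing R α (dif R (β D)) (CEnv.of (lFil R) (ell R f * ell R g))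
    rw [lieHat_of, lieU_mul, map_add, map_add]
    simp only [pairing_mul, symForm_apply, res_theta_smul]
    ring
  · change pairing R α β (lieHat D (CEnv.of (lFil R) (hbarF R))) =
      -pairing R (dif R (α D)) β (CEnv.of (lFil R) (hbarF R)) -
        pairing R α (dif R (β D)) (CEnv.of (lFil R) (hbarF R))
    rw [lieHat_of, lieU_hbar, map_zero, map_zero, pairing_hbar, pairing_hbar, neg_zero, sub_zero]

/-- The action of `D` on forms is dual to the Lie derivative of differentials. -/
theorem pairing_lieHat (D : theta R) (α β : Omega R) {u : CEnv (lFil R)} (hu : u ∈ lTwoBar R) :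
    pairing R α β (lieHat D u) = -pairing R (dif R (α D)) β u - pairing R α (dif R (β D)) u := by
  obtain ⟨n₁, h₁⟩ := exists_mem_fil_of_le (α (ddt R))
  obtain ⟨n₂, h₂⟩ := exists_mem_fil_of_le (β (ddt R))
  obtain ⟨n₃, h₃⟩ := exists_mem_fil_of_le (dif R (α D) (ddt R))
  obtain ⟨n₄, h₄⟩ := exists_mem_fil_of_le (dif R (β D) (ddt R))
  let n := n₁ + n₂ + n₃ + n₄
  obtain ⟨m, hm⟩ := exists_lieU_mem D n
  obtain ⟨v, hv, huv⟩ := exists_mem_lTwo_sub_mem hu (max n m)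
  have e1 : lieHat D u - lieHat D (CEnv.of (lFil R) v) ∈ cIdeal (lFil R) n := by
    rw [← map_sub]
    exact extendMap_mem_cIdeal _ _ _ _ hm (cIdeal_anti _ (le_max_right _ _) huv)
  have e2 := cIdeal_anti _ (le_max_left n m) huv
  rw [pairing_eq_of_sub_mem (h₁ n (by omega)) (h₂ n (by omega)) e1, pairing_lieHat_of D α β hv,
    pairing_eq_of_sub_mem (h₃ n (by omega)) (h₂ n (by omega)) e2,
    pairing_eq_of_sub_mem (h₁ n (by omega)) (h₄ n (by omega)) e2]

/-- The bracket of `θ̂`: for `(D, u)` and `(E, v)` in `θ̂`, the pair `([D, E], D v)` is in `θ̂`. -/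
theorem exists_vir_lieHat (x y : Vir R) : ∃ z : Vir R, z.1.2 = lieHat x.1.1 y.1.2 := by
  -- `δ ε' - ε δ'` is the coefficient of the commutator of `δ d/dt` and `ε d/dt`
  let δ := x.1.1.1 (tpow R 1)
  let ε := y.1.1.1 (tpow R 1)
  refine ⟨⟨((δ * ddtDer R ε - ε * ddtDer R δ) • ddt R, lieHat x.1.1 y.1.2),
    lieHat_mem_lTwoBar _ y.2.1, fun α β => ?_⟩, rfl⟩
  have h1 : α x.1.1 = δ * α (ddt R) := omega_apply α _
  have h2 : α y.1.1 = ε * α (ddt R) := omega_apply α _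
  have h3 : β x.1.1 = δ * β (ddt R) := omega_apply β _
  have h4 : res R (α y.1.1 • dif R (β x.1.1)) = -res R (β x.1.1 • dif R (α y.1.1)) :=
    resPair_skew R _ _
  have h5 : α ((δ * ddtDer R ε - ε * ddtDer R δ) • ddt R) =
      (δ * ddtDer R ε - ε * ddtDer R δ) * α (ddt R) := map_smul α _ _
  change pairing R α β (lieHat x.1.1 y.1.2) =
    res R (α ((δ * ddtDer R ε - ε * ddtDer R δ) • ddt R) • β)
  rw [pairing_lieHat _ α β y.2.1, y.2.2, y.2.2, h4, sub_neg_eq_add, res_dif_smul, theta_apply y.1.1,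
    res_smul_dif, res_smul, res_smul, h1, h2, h3, h5, Derivation.leibniz, Derivation.leibniz,
    ← HahnSeries.coeff_neg, ← HahnSeries.coeff_add]
  congr 1
  simp only [smul_eq_mul]
  change -(ε * _ * _) + _ = _
  ring

end Heisenberg

/-! ### The Fock representation -/

section Fock

attribute [local instance] LieRing.ofAssociativeRing LieAlgebra.ofAssociativeAlgebra

variable {R : Type*} [CommRing R]

theorem resPair_tpow (k l : ℤ) :
    resPair R (tpow R k) (tpow R l) = if k + l = 0 then (k : R) else 0 := by
  rw [resPair_apply, res_smul_dif, ddtDer_tpow, mul_smul_comm, tpow_mul, HahnSeries.coeff_smul,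
    tpow, HahnSeries.coeff_single]
  by_cases h : k + l = 0
  · rw [if_pos h, if_pos (by omega), smul_eq_mul, mul_one]
  · rw [if_neg h, if_neg (by omega), smul_zero]

theorem sum_Ico_symm {M : Type*} [AddCommMonoid M] (h : ℤ → M) (N : ℕ) :
    ∑ k ∈ Finset.Ico (-N : ℤ) (N + 1), h k =
      h 0 + ∑ i ∈ Finset.range N, (h (i + 1) + h (-i - 1)) := by
  induction N with
  | zero => simp [show Finset.Ico (0 : ℤ) 1 = {0} from rfl]
  | succ N ih =>
    have hs : Finset.Ico (-((N : ℤ) + 1)) (N + 1 + 1) =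
        insert ((N : ℤ) + 1) (insert (-(N : ℤ) - 1) (Finset.Ico (-N : ℤ) (N + 1))) := by
      ext k
      simp only [Finset.mem_insert, Finset.mem_Ico]
      omega
    have h1 : -(N : ℤ) - 1 ∉ Finset.Ico (-N : ℤ) (N + 1) := by
      rw [Finset.mem_Ico]
      omega
    have h2 : (N : ℤ) + 1 ∉ insert (-(N : ℤ) - 1) (Finset.Ico (-N : ℤ) (N + 1)) := by
      rw [Finset.mem_insert, Finset.mem_Ico]
      omega
    rw [Finset.sum_range_succ, ← add_assoc, ← ih, Nat.cast_succ, hs, Finset.sum_insert h2,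
      Finset.sum_insert h1, ← add_assoc, add_comm]

theorem resPair_eq_sum {f g : R⸨X⸩} {N : ℕ} (hf : f ∈ fil R (-N)) (hg : g ∈ fil R (-N)) :
    resPair R f g = ∑ i ∈ Finset.range N, (g.coeff (-i - 1) * ((i + 1) * f.coeff (i + 1)) -
      f.coeff (-i - 1) * ((i + 1) * g.coeff (i + 1))) := by
  have e1 : ∀ a b : R⸨X⸩, a ∈ fil R (-N) → b ∈ fil R (-N) → resPair R a b =
      ∑ k ∈ Finset.Ico (-N : ℤ) (N + 1), a.coeff k * resPair R (tpow R k) b := by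
    intro a b ha hb
    have := resPair_eq_zero R (sub_sum_tpow_mem_fil (n := N + 1) ha) hb (by omega)
    rw [map_sub, LinearMap.sub_apply, sub_eq_zero] at this
    rw [this, map_sum, LinearMap.sum_apply]
    exact Finset.sum_congr rfl fun k _ => by rw [map_smul, LinearMap.smul_apply, smul_eq_mul]
  have e2 : resPair R f g =
      ∑ k ∈ Finset.Ico (-N : ℤ) (N + 1), f.coeff k * (k * g.coeff (-k)) := by
    rw [e1 f g hf hg]
    refine Finset.sum_congr rfl fun k hk => ?_
    rw [Finset.mem_Ico] at hk
    rw [resPair_skew, e1 g _ hg (fil_anti (by omega) (tpow_mem_fil k)), Finset.sum_eq_single (-k)]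
    · rw [resPair_tpow, if_pos (by ring)]
      push_cast
      ring
    · intro l _ hl
      rw [resPair_tpow, if_neg (by omega), mul_zero]
    · intro h
      rw [Finset.mem_Ico] at h
      omega
  rw [e2, sum_Ico_symm, Int.cast_zero, zero_mul, mul_zero, zero_add]
  refine Finset.sum_congr rfl fun i _ => ?_
  rw [show (-((i : ℤ) + 1)) = -i - 1 by ring, show (-(-(i : ℤ) - 1)) = i + 1 by ring]
  push_cast
  ring

/-- The coefficients of `t^{-1}, t^{-2}, …`. -/
def polar (R : Type*) [CommRing R] : R⸨X⸩ →ₗ[R] ℕ →₀ R where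
  toFun f := Finsupp.ofSupportFinite (fun i => f.coeff (-i - 1)) (by
    obtain ⟨N, hN⟩ := exists_mem_fil f
    refine (Finset.range N).finite_toSet.subset fun i hi => ?_
    by_contra h
    rw [Finset.mem_coe, Finset.mem_range] at h
    exact hi (hN _ (by omega)))
  map_add' _ _ := Finsupp.ext fun _ => rfl
  map_smul' _ _ := Finsupp.ext fun _ => rfl

/-- Creation operators on the Fock space `R[x₀, x₁, …]`: `t^{-i-1}` acts as multiplication by
`x_i`. -/
def creation (R : Type*) [CommRing R] : R⸨X⸩ →ₗ[R] MvPolynomial ℕ R :=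
  Finsupp.linearCombination R (MvPolynomial.X : ℕ → MvPolynomial ℕ R) ∘ₗ polar R

theorem creation_eq_sum {f : R⸨X⸩} {N : ℕ} (hf : f ∈ fil R (-N)) :
    creation R f = ∑ i ∈ Finset.range N, f.coeff (-i - 1) • MvPolynomial.X i := by
  change Finsupp.linearCombination R MvPolynomial.X (polar R f) = _
  rw [Finsupp.linearCombination_apply]
  refine Finsupp.sum_of_support_subset _ (fun i hi => ?_) _ fun i _ => zero_smul _ _
  by_contra h
  rw [Finset.mem_range] at h
  exact (Finsupp.mem_support_iff.mp hi) (hf _ (by omega))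

/-- Annihilation operators on the Fock space: `t^{i+1}` acts as `(i + 1) ∂/∂x_i`. -/
def annihilation (f : R⸨X⸩) : Derivation R (MvPolynomial ℕ R) (MvPolynomial ℕ R) :=
  MvPolynomial.mkDerivation R fun i => MvPolynomial.C ((i + 1) * f.coeff (i + 1))

theorem annihilation_X (f : R⸨X⸩) (i : ℕ) :
    annihilation f (MvPolynomial.X i) = MvPolynomial.C ((i + 1) * f.coeff (i + 1)) :=
  MvPolynomial.mkDerivation_X _ _ _

theorem annihilation_creation (f : R⸨X⸩) {g : R⸨X⸩} {N : ℕ} (hg : g ∈ fil R (-N)) :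
    annihilation f (creation R g) = MvPolynomial.C
      (∑ i ∈ Finset.range N, g.coeff (-i - 1) * ((i + 1) * f.coeff (i + 1))) := by
  rw [creation_eq_sum hg, map_sum, map_sum]
  refine Finset.sum_congr rfl fun i _ => ?_
  rw [Derivation.map_smul, annihilation_X, MvPolynomial.smul_eq_C_mul, ← map_mul]

theorem annihilation_comm (f g : R⸨X⸩) (p : MvPolynomial ℕ R) :
    annihilation f (annihilation g p) = annihilation g (annihilation f p) := by
  have h : ⁅annihilation f, annihilation g⁆ = 0 := MvPolynomial.derivation_ext fun i => by
    rw [Derivation.commutator_apply, annihilation_X, annihilation_X, MvPolynomial.derivation_C,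
      MvPolynomial.derivation_C, sub_zero]
    rfl
  have h2 := congrArg (fun D => D p) h
  rw [Derivation.commutator_apply] at h2
  exact sub_eq_zero.mp h2

theorem annihilation_creation_sub (f g : R⸨X⸩) :
    annihilation f (creation R g) - annihilation g (creation R f) =
      MvPolynomial.C (resPair R f g) := by
  obtain ⟨N₁, h₁⟩ := exists_mem_fil_of_le f
  obtain ⟨N₂, h₂⟩ := exists_mem_fil_of_le g
  have hf := h₁ _ (le_max_left N₁ N₂)
  have hg := h₂ _ (le_max_right N₁ N₂)
  rw [annihilation_creation f hg, annihilation_creation g hf, resPair_eq_sum hf hg, ← map_sub,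
    Finset.sum_sub_distrib]

/-- The operator on the Fock space by which `f + ħ r` acts; `ħ` acts as the identity. -/
def fockEnd (x : LHat R) : Module.End R (MvPolynomial ℕ R) :=
  LinearMap.mulLeft R (creation R x.1) + (annihilation x.1).toLinearMap + x.2 • LinearMap.id

theorem fockEnd_apply (x : LHat R) (p : MvPolynomial ℕ R) :
    fockEnd x p = creation R x.1 * p + annihilation x.1 p + x.2 • p := rfl

theorem annihilation_add (f g : R⸨X⸩) : annihilation (f + g) = annihilation f + annihilation g :=
  MvPolynomial.derivation_ext fun i => by
    rw [Derivation.add_apply, annihilation_X, annihilation_X, annihilation_X, HahnSeries.coeff_add,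
      mul_add, map_add]

theorem annihilation_smul (r : R) (f : R⸨X⸩) : annihilation (r • f) = r • annihilation f :=
  MvPolynomial.derivation_ext fun i => by
    rw [Derivation.smul_apply, annihilation_X, annihilation_X, HahnSeries.coeff_smul, smul_eq_mul,
      mul_left_comm, map_mul, MvPolynomial.smul_eq_C_mul]

/-- The Fock representation of the Heisenberg algebra. -/
def fockHom (R : Type*) [CommRing R] : LHat R →ₗ⁅R⁆ Module.End R (MvPolynomial ℕ R) where
  toFun := fockEnd
  map_add' x y := LinearMap.ext fun p => by
    rw [LinearMap.add_apply, fockEnd_apply, fockEnd_apply, fockEnd_apply]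
    change creation R (x.1 + y.1) * p + annihilation (x.1 + y.1) p + (x.2 + y.2) • p = _
    rw [map_add, annihilation_add, Derivation.add_apply, add_mul, add_smul]
    abel
  map_smul' r x := LinearMap.ext fun p => by
    rw [RingHom.id_apply, LinearMap.smul_apply, fockEnd_apply, fockEnd_apply]
    change creation R (r • x.1) * p + annihilation (r • x.1) p + (r * x.2) • p = _
    rw [map_smul, annihilation_smul, Derivation.smul_apply, smul_add, smul_add, smul_mul_assoc,
      mul_smul]
  map_lie' {x y} := LinearMap.ext fun p => by
    rw [LieRing.of_associative_ring_bracket, LinearMap.sub_apply, Module.End.mul_apply,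
      Module.End.mul_apply]
    change creation R (x.1 * y.1 - y.1 * x.1) * p + annihilation (x.1 * y.1 - y.1 * x.1) p +
      resPair R x.1 y.1 • p = _
    have h0 : annihilation (0 : R⸨X⸩) = 0 := by
      rw [← zero_smul R (0 : R⸨X⸩), annihilation_smul, zero_smul]
    rw [mul_comm y.1, sub_self, map_zero, h0, MvPolynomial.smul_eq_C_mul,
      ← annihilation_creation_sub]
    simp only [fockEnd_apply, map_add, Derivation.leibniz, smul_eq_mul,
      MvPolynomial.derivation_C,
      annihilation_comm x.1 y.1, MvPolynomial.smul_eq_C_mul, Derivation.zero_apply]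
    ring

/-- The Fock space as a representation of `U𝔩̂`. -/
def fock (R : Type*) [CommRing R] : FEnv (lFil R) →ₐ[R] Module.End R (MvPolynomial ℕ R) :=
  FEnv.lift (lFil R) (fockHom R)

theorem fock_ι (x : LHat R) : fock R (FEnv.ι (lFil R) x) = fockEnd x := FEnv.lift_ι _ _ x

theorem fock_hbarF : fock R (hbarF R) = 1 := by
  rw [fock_ι]
  refine LinearMap.ext fun p => ?_
  rw [fockEnd_apply]
  change creation R 0 * p + annihilation 0 p + (1 : R) • p = p
  rw [map_zero, zero_mul, zero_add, one_smul, ← zero_smul R (0 : R⸨X⸩), annihilation_smul,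
    zero_smul, Derivation.zero_apply, zero_add]

/-- The vacuum vector is killed by `R[[t]]`. -/
theorem fock_vacuum {u : FEnv (lFil R)} (hu : u ∈ leftIdeal (lFil R) 0) : fock R u 1 = 0 := by
  induction hu using Submodule.span_induction with
  | zero => rw [map_zero, LinearMap.zero_apply]
  | add a b _ _ ha hb => rw [map_add, LinearMap.add_apply, ha, hb, add_zero]
  | smul a b _ hb => rw [smul_eq_mul, map_mul, Module.End.mul_apply, hb, map_zero]
  | mem u hu =>
    obtain ⟨_, ⟨f, hf, rfl⟩, rfl⟩ := hu
    rw [fock_ι, fockEnd_apply]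
    change creation R f * 1 + annihilation f 1 + (0 : R) • 1 = _
    have hf' : f ∈ fil R (-(0 : ℕ)) := hf
    rw [creation_eq_sum hf', Derivation.map_one_eq_zero]
    simp

/-- `ħ` acts as the identity on the Fock space, so the multiples of its powers are seen on the vacuum
vector. -/
theorem eq_zero_of_smul_hbarF_pow_mem {r : R} {N : ℕ}
    (h : r • hbarF R ^ N ∈ leftIdeal (lFil R) 0) : r = 0 := by
  have h1 := fock_vacuum h
  rw [map_smul, map_pow, fock_hbarF, one_pow, LinearMap.smul_apply, Module.End.one_apply,
    MvPolynomial.smul_eq_C_mul, mul_one] at h1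
  exact (MvPolynomial.C_injective ℕ R) (h1.trans (map_zero _).symm)

end Fock

/-! ### Absence of torsion -/

section Torsion

variable {R : Type*} [CommRing R]

/-- If `f` is `ħ`-torsion in `Ū𝔩̂`, then commutators with monomials show that the coefficients of `f`
vanish, except for that of the central monomial `t⁰`. -/
theorem hbarF_pow_mul_ell_eq_zero (hR : ∀ n : ℕ, n ≠ 0 → IsUnit (n : R)) {f : R⸨X⸩} {N : ℕ}
    (h : CEnv.of (lFil R) (hbarF R ^ N * ell R f) = 0) {p : ℤ} (hp : p ≠ 0) : f.coeff p = 0 := by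
  have hc : hbarF R ^ N * (resPair R f (tpow R (-p)) • hbarF R) =
      hbarF R ^ N * ell R f * ell R (tpow R (-p)) -
        ell R (tpow R (-p)) * (hbarF R ^ N * ell R f) := by
    have h1 : Commute (hbarF R ^ N) (ell R (tpow R (-p))) :=
      Commute.pow_left (hbarF_mul _) N
    rw [← mul_assoc (ell R _), ← h1.eq, mul_assoc, mul_assoc, ← mul_sub, ell_mul,
      add_sub_cancel_left]
  have h2 : CEnv.of (lFil R) (resPair R f (tpow R (-p)) • hbarF R ^ (N + 1)) = 0 := by
    rw [pow_succ, ← mul_smul_comm, hc, map_sub, map_mul, map_mul _ (ell R (tpow R (-p))), h,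
      zero_mul, mul_zero, sub_zero]
  have h3 : resPair R f (tpow R (-p)) = 0 :=
    eq_zero_of_smul_hbarF_pow_mem ((of_mem_cIdeal_iff _).mp (h2 ▸ zero_mem _))
  rw [resPair_skew, neg_eq_zero, resPair_apply, res_smul_dif, ddtDer_tpow, mul_smul_comm,
    HahnSeries.coeff_smul, mul_comm, coeff_tpow_mul, smul_eq_mul,
    show -1 - (-p - 1) = p by ring] at h3
  have h4 : IsUnit (((-p : ℤ)) : R) := by
    obtain ⟨n, rfl | rfl⟩ := p.eq_nat_or_neg
    · rw [Int.cast_neg, IsUnit.neg_iff]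
      exact_mod_cast hR n (by omega)
    · rw [neg_neg]
      exact_mod_cast hR n (by omega)
  exact (h4.mul_right_eq_zero).mp h3

/-- There is no `ħ`-torsion in the image of `θ̂`. -/
theorem vir_eq_zero_of_hbar_pow_mul (hR : ∀ n : ℕ, n ≠ 0 → IsUnit (n : R)) (x : Vir R) {N : ℕ}
    (h : CEnv.of (lFil R) (hbarF R) ^ N * x.1.2 = 0) : x = 0 := by
  have hD : ∀ f, CEnv.of (lFil R) (hbarF R ^ (N + 1) * ell R (x.1.1.1 f)) = 0 := by
    intro f
    have h1 : Commute (CEnv.of (lFil R) (hbarF R) ^ N) (CEnv.of (lFil R) (ell R f)) :=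
      Commute.pow_left (of_hbarF_comm _) N
    have h2 := congrArg (fun a => CEnv.of (lFil R) (hbarF R) ^ N * a) (vir_commutator_ell x f)
    simp only [mul_sub, mul_neg, ← mul_assoc] at h2
    rw [h, zero_mul, h1.eq, mul_assoc, h, mul_zero, sub_zero, ← pow_succ] at h2
    rw [map_mul, map_pow, ← neg_eq_zero, ← h2]
  have hx1 : x.1.1 = 0 := by
    refine theta_eq_zero _ (HahnSeries.ext (funext fun i => ?_))
    by_cases hi : i = 0
    · subst hi
      -- the constant coefficient of `D t` is seen in `D t²`
      have h1 := hbarF_pow_mul_ell_eq_zero hR (hD (tpow R 2)) one_ne_zero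
      rw [theta_apply, ddtDer_tpow, mul_smul_comm, HahnSeries.coeff_smul, mul_comm, coeff_tpow_mul,
        smul_eq_mul] at h1
      norm_num at h1
      exact (((hR 2 two_ne_zero)).mul_right_eq_zero).mp (by exact_mod_cast h1)
    · exact hbarF_pow_mul_ell_eq_zero hR (hD (tpow R 1)) hi
  refine Subtype.ext (Prod.ext hx1 ?_)
  change x.1.2 = 0
  refine eq_zero_of_forall_mem_cIdeal _ fun n => ?_
  obtain ⟨u, hu, hxu⟩ := exists_mem_lTwo_sub_mem x.2.1 n
  -- the vanishing of the form of `u` modulo `Fⁿ` puts `u` in `ħR` modulo `Fⁿ`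
  let W : Submodule R (FEnv (lFil R)) :=
    (leftIdeal (lFil R) n).restrictScalars R ⊔ Submodule.span R {hbarF R}
  let B : R⸨X⸩ →ₗ[R] R⸨X⸩ →ₗ[R] (FEnv (lFil R) ⧸ W) :=
    ((LinearMap.mul R (FEnv (lFil R))).compl₁₂ (ell R) (ell R)).compr₂ W.mkQ
  have hBa : ∀ f g, B f g = W.mkQ (ell R f * ell R g) := fun _ _ => rfl
  have hħ : W.mkQ (hbarF R) = 0 := by
    rw [Submodule.mkQ_apply, Submodule.Quotient.mk_eq_zero]
    exact Submodule.mem_sup_right (Submodule.mem_span_singleton_self _)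
  have hB : ∀ f g, B f g = B g f := fun f g => by
    rw [hBa, hBa, ell_mul, map_add, map_smul, hħ, smul_zero, add_zero]
  have hBn : ∀ f, ∀ s ∈ fil R n, B f s = 0 := fun f s hs => by
    rw [hBa, Submodule.mkQ_apply, Submodule.Quotient.mk_eq_zero]
    exact Submodule.mem_sup_left ((leftIdeal (lFil R) n).mul_mem_left _ (ell_mem_leftIdeal hs))
  obtain ⟨M, hM⟩ := two_smul_quad_eq_sum hB hBn hu
  have h1 := hM M le_rfl
  rw [Finset.sum_eq_zero fun k hk => Finset.sum_eq_zero fun l hl => ?_] at h1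
  swap
  · have hτ : ∀ i ∈ Finset.Ico (-M : ℤ) n, tau R i (ddt R) ∈ fil R (-n) := fun i hi => by
      rw [tau_ddt]
      exact fil_anti (by have := (Finset.mem_Ico.mp hi).2; omega) (tpow_mem_fil _)
    rw [← pairing_eq_of_sub_mem (hτ k hk) (hτ l hl) hxu, x.2.2, hx1, map_zero, zero_smul, map_zero,
      zero_smul]
  have h2 : quad B 0 (sub_zero_of_symm hB) u = W.mkQ u :=
    lTwo_ext (φ := quad B 0 (sub_zero_of_symm hB)) (ψ := W.mkQ) (fun f g => quad_mul _ _ _ f g)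
      ((quad_hbar _ _ _).trans hħ.symm) hu
  have h3 : u ∈ W := by
    obtain ⟨c, hc⟩ := (hR 2 two_ne_zero).exists_left_inv
    rw [Nat.cast_ofNat] at hc
    rw [← Submodule.Quotient.mk_eq_zero, ← Submodule.mkQ_apply, ← h2, ← one_smul R (quad _ _ _ u),
      ← hc, mul_smul, h1, smul_zero]
  obtain ⟨v, hv, w, hw, rfl⟩ := Submodule.mem_sup.mp h3
  obtain ⟨r, rfl⟩ := Submodule.mem_span_singleton.mp hw
  have hv' : v ∈ leftIdeal (lFil R) n := hv
  have h4 : x.1.2 - CEnv.of (lFil R) (r • hbarF R) ∈ cIdeal (lFil R) n := by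
    have := add_mem hxu (of_mem_cIdeal _ hv')
    rw [map_add] at this
    convert this using 1
    abel
  have h5 : CEnv.of (lFil R) (r • hbarF R ^ (N + 1)) ∈ cIdeal (lFil R) n := by
    have := neg_mem (mul_mem_cIdeal _ (CEnv.of (lFil R) (hbarF R) ^ N) h4)
    rwa [mul_sub, h, zero_sub, neg_neg, ← map_pow, ← map_mul, mul_smul_comm, ← pow_succ] at this
  have h6 : r = 0 := eq_zero_of_smul_hbarF_pow_mem
    (leftIdeal_anti _ (Nat.zero_le n) ((of_mem_cIdeal_iff _).mp h5))
  rwa [h6, zero_smul, map_zero, sub_zero] at h4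

end Torsion

/-! ### The Casimir element -/

section Casimir

variable {k 𝔤 R R' Γ : Type*} [Field k] [IsAlgClosed k] [CharZero k]
  [LieRing 𝔤] [LieAlgebra k 𝔤] [FiniteDimensional k 𝔤] [LieAlgebra.IsSimple k 𝔤]
  [CommRing R] [Algebra k R] [CommRing R'] [Algebra k R'] [Algebra R R'] [IsScalarTower k R R']
  [Group Γ] [Fintype Γ] (P : TwistDatum k 𝔤 R R' Γ)

namespace TwistDatum

theorem repr_eq_form_dualBasis {ι : Type*} [Fintype ι] [DecidableEq ι] (b : Module.Basis ι k 𝔤)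
    (X : 𝔤) (a : ι) :
    b.repr X a = P.form (LinearMap.BilinForm.dualBasis P.form P.form_nondegenerate b a) X := by
  conv_rhs => rw [← b.sum_repr X, map_sum]
  simp only [map_smul, LinearMap.BilinForm.apply_dualBasis_left, smul_eq_mul, mul_ite, mul_one,
    mul_zero]
  rw [Finset.sum_ite_eq' , if_pos (Finset.mem_univ _)]

/-- The Casimir operator of `𝔤` in the adjoint representation is a scalar: its contraction with the
invariant form is the trace form. -/
theorem sum_lie_lie {ι : Type*} [Fintype ι] [DecidableEq ι] (b : Module.Basis ι k 𝔤) (Z : 𝔤) :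
    ∑ a, ⁅LinearMap.BilinForm.dualBasis P.form P.form_nondegenerate b a, ⁅b a, Z⁆⁆ =
      (killingForm k 𝔤 P.hθ P.hθ / 2) • Z := by
  -- in the degenerate case the normalized form is zero, so that `𝔤` is zero by nondegeneracy
  by_cases h0 : killingForm k 𝔤 P.hθ P.hθ = 0
  · have h1 : ∀ X : 𝔤, X = 0 := fun X => P.form_nondegenerate.1 X fun Y => by
      simp [RootDatum.form, h0]
    exact (h1 _).trans (h1 _).symm
  · rw [← sub_eq_zero]
    refine P.form_nondegenerate.1 _ fun Y => ?_
    have h1 : ∀ a, P.form ⁅LinearMap.BilinForm.dualBasis P.form P.form_nondegenerate b a, ⁅b a, Z⁆⁆ Y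
        = b.repr (⁅Y, ⁅Z, b a⁆⁆) a := fun a => by
      rw [P.repr_eq_form_dualBasis, form_lie, ← lie_skew Z (b a), lie_neg, lie_skew]
    have h2 : ∑ a, b.repr (⁅Y, ⁅Z, b a⁆⁆) a = killingForm k 𝔤 Y Z := by
      rw [killingForm_apply_apply, LinearMap.trace_eq_matrix_trace k b, Matrix.trace]
      exact Finset.sum_congr rfl fun a _ => by
        rw [Matrix.diag_apply, LinearMap.toMatrix_apply]
        rfl
    rw [map_sub, LinearMap.sub_apply, map_sum, LinearMap.sum_apply, Finset.sum_congr rfl fun a _ =>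
      h1 a, h2, map_smul, LinearMap.smul_apply, form_symm, RootDatum.form, LinearMap.smul_apply,
      LinearMap.smul_apply, smul_eq_mul, smul_eq_mul]
    field_simp
    ring

/-- The map `X ⊗ Y ↦ (V | X) Y` with values in `R' ⊗ 𝔤`, for `V` in `R' ⊗ 𝔤`. -/
def contractE (V : R' ⊗[k] 𝔤) : P.hσ ⊗[R] P.hσ →ₗ[R] R' ⊗[k] 𝔤 :=
  TensorProduct.lift (LinearMap.mk₂ R (fun X Y => P.formE V X.1 • Y.1)
    (fun X X' Y => by
      rw [← add_smul, ← map_add]; rfl)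
    (fun r X Y => by
      change P.formE V (r • X.1) • Y.1 = _
      rw [← algebraMap_smul R' r X.1, map_smul, smul_eq_mul, mul_smul, algebraMap_smul])
    (fun X Y Y' => smul_add _ _ _)
    (fun r X Y => smul_comm _ _ _))

theorem contractE_tmul (V : R' ⊗[k] 𝔤) (X Y : P.hσ) :
    P.contractE V (X ⊗ₜ Y) = P.formE V X.1 • Y.1 := rfl

theorem contractE_add (V V' : R' ⊗[k] 𝔤) (e : P.hσ ⊗[R] P.hσ) :
    P.contractE (V + V') e = P.contractE V e + P.contractE V' e := by
  induction e with
  | zero => simp only [map_zero, add_zero]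
  | add a b ha hb => rw [map_add, ha, hb, map_add, map_add]; abel
  | tmul X Y => rw [contractE_tmul, contractE_tmul, contractE_tmul, map_add, LinearMap.add_apply,
      add_smul]

theorem contractE_smul (r : R') (V : R' ⊗[k] 𝔤) (e : P.hσ ⊗[R] P.hσ) :
    P.contractE (r • V) e = r • P.contractE V e := by
  induction e with
  | zero => simp only [map_zero, smul_zero]
  | add a b ha hb => rw [map_add, ha, hb, map_add, smul_add]
  | tmul X Y => rw [contractE_tmul, contractE_tmul, map_smul, LinearMap.smul_apply, smul_eq_mul,
      mul_smul]

theorem contractE_coe (Z : P.hσ) (e : P.hσ ⊗[R] P.hσ) : P.contractE Z.1 e = (P.contract Z e).1 := by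
  induction e with
  | zero => rw [map_zero, map_zero]; rfl
  | add a b ha hb => rw [map_add, ha, hb, map_add]; rfl
  | tmul X Y =>
    rw [contractE_tmul, contract_tmul, ← algebraMap_formσ, algebraMap_smul]
    rfl

/-- `R' ⊗ 𝔤` is spanned over `R'` by the invariants, so that the Casimir element of `σ^*𝔥` is also
the Casimir element of `R' ⊗ 𝔤`. -/
theorem contractE_casimir (V : R' ⊗[k] 𝔤) : P.contractE V P.casimir = V := by
  induction V with
  | zero => rw [← zero_smul R' (0 : R' ⊗[k] 𝔤), contractE_smul, zero_smul, zero_smul]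
  | add V V' h h' => rw [contractE_add, h, h']
  | tmul r Y =>
    obtain ⟨n, x, y, h1, h2⟩ := P.galois
    have h3 : P.contractE (1 ⊗ₜ Y) P.casimir = 1 ⊗ₜ Y := by
      rw [← P.sum_smul_avg h1 h2 Y]
      let F : (R' ⊗[k] 𝔤) →+ R' ⊗[k] 𝔤 := AddMonoidHom.mk' (fun V => P.contractE V P.casimir)
        fun V V' => P.contractE_add V V' _
      change F _ = _
      rw [map_sum]
      refine Finset.sum_congr rfl fun i _ => ?_
      change P.contractE _ _ = _
      rw [contractE_smul, contractE_coe, P.casimir_spec]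
    rw [show r ⊗ₜ[k] Y = r • ((1 : R') ⊗ₜ[k] Y) by
      rw [TensorProduct.smul_tmul', smul_eq_mul, mul_one], contractE_smul, h3]

/-- The map `Y ↦ [Y, Z]`. -/
def adR (Z : P.hσ) : P.hσ →ₗ[R] P.hσ where
  toFun Y := ⁅Y, Z⁆
  map_add' Y Y' := add_lie Y Y' Z
  map_smul' r Y := smul_lie r Y Z

theorem adR_apply (Y Z : P.hσ) : P.adR Z Y = ⁅Y, Z⁆ := rfl

/-- The element `∑ [X, [Y, Z]]` for `e = ∑ X ⊗ Y`, expanded in a basis of `𝔤`. -/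
theorem lieMap_lTensor_adR_coe {ι : Type*} [Fintype ι] [DecidableEq ι] (b : Module.Basis ι k 𝔤)
    (Z : P.hσ) (e : P.hσ ⊗[R] P.hσ) :
    (P.lieMap ((P.adR Z).lTensor P.hσ e)).1 =
      ∑ a, ⁅(1 : R') ⊗ₜ[k] LinearMap.BilinForm.dualBasis P.form P.form_nondegenerate b a,
        ⁅P.contractE (1 ⊗ₜ b a) e, Z.1⁆⁆ := by
  induction e with
  | zero =>
    simp only [map_zero, zero_lie, lie_zero, Finset.sum_const_zero]
    rfl
  | add x y hx hy =>
    simp only [map_add, add_lie, lie_add, Finset.sum_add_distrib]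
    rw [← hx, ← hy]
    rfl
  | tmul X Y =>
    change ⁅X.1, ⁅Y.1, Z.1⁆⁆ = _
    conv_lhs => rw [← P.sum_formE_smul b X.1, sum_lie]
    refine Finset.sum_congr rfl fun a _ => ?_
    rw [contractE_tmul, smul_lie, smul_lie, lie_smul, formE_symm]

/-- The Casimir element of `σ^*𝔥` acts as the same scalar as that of `𝔤`. -/
theorem lieMap_lTensor_adR_casimir (Z : P.hσ) :
    P.lieMap ((P.adR Z).lTensor P.hσ P.casimir) =
      algebraMap k R (killingForm k 𝔤 P.hθ P.hθ / 2) • Z := by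
  let b := Module.finBasis k 𝔤
  have h : ∀ V : R' ⊗[k] 𝔤,
      ∑ a, ⁅(1 : R') ⊗ₜ[k] LinearMap.BilinForm.dualBasis P.form P.form_nondegenerate b a,
        ⁅(1 : R') ⊗ₜ[k] b a, V⁆⁆ = (killingForm k 𝔤 P.hθ P.hθ / 2) • V := by
    intro V
    induction V with
    | zero => simp only [lie_zero, Finset.sum_const_zero, smul_zero]
    | add x y hx hy => simp only [lie_add, Finset.sum_add_distrib, hx, hy, smul_add]
    | tmul r Y =>
      simp only [LieAlgebra.ExtendScalars.bracket_tmul, one_mul]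
      rw [← TensorProduct.tmul_sum, P.sum_lie_lie b, TensorProduct.tmul_smul]
  apply Subtype.ext
  rw [P.lieMap_lTensor_adR_coe b]
  simp only [contractE_casimir]
  rw [h]
  exact (algebraMap_smul R _ Z.1).symm

theorem adTensor_tmul (f : R⸨X⸩) (Z : P.hσ) (e : P.hσ ⊗[R] P.hσ) :
    P.adTensor (P.tmul f Z) e = P.tmul f (P.lieMap ((P.adR Z).lTensor P.hσ e)) := by
  induction e with
  | zero => simp only [map_zero]
  | add a b ha hb => simp only [map_add, ha, hb]
  | tmul X Y =>
    change ⁅P.tmul 1 X, ⁅P.tmul 1 Y, P.tmul f Z⁆⁆ = P.tmul f ⁅X, ⁅Y, Z⁆⁆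
    rw [tmul_lie_tmul, tmul_lie_tmul, one_mul, one_mul]

theorem adTensor_add (Z Z' : P.hL) (e : P.hσ ⊗[R] P.hσ) :
    P.adTensor (Z + Z') e = P.adTensor Z e + P.adTensor Z' e := by
  induction e with
  | zero => simp only [map_zero, add_zero]
  | add a b ha hb => rw [map_add, ha, hb, map_add, map_add]; abel
  | tmul X Y =>
    change ⁅P.tmul 1 X, ⁅P.tmul 1 Y, Z + Z'⁆⁆ =
      ⁅P.tmul 1 X, ⁅P.tmul 1 Y, Z⁆⁆ + ⁅P.tmul 1 X, ⁅P.tmul 1 Y, Z'⁆⁆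
    rw [lie_add, lie_add]

theorem adTensor_zero (e : P.hσ ⊗[R] P.hσ) : P.adTensor 0 e = 0 := by
  have := P.adTensor_add 0 0 e
  rwa [add_zero, left_eq_add] at this

theorem adTensor_casimir (Z : P.hL) :
    P.adTensor Z P.casimir = (2 * algebraMap k R P.hCheck) • Z := by
  have h : ∃ h : k, ∀ Z, P.adTensor Z P.casimir = (2 * algebraMap k R h) • Z := by
    refine ⟨killingForm k 𝔤 P.hθ P.hθ / 2 / 2, fun Z => ?_⟩
    induction Z using P.hL_induction with
    | zero => rw [adTensor_zero, smul_zero]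
    | add x y hx hy => rw [adTensor_add, hx, hy, smul_add]
    | tmul f Z =>
      rw [adTensor_tmul, lieMap_lTensor_adR_casimir, map_smul, ← map_ofNat (algebraMap k R) 2,
        ← map_mul, mul_div_cancel₀ _ two_ne_zero]
  exact Classical.epsilon_spec h Z

theorem tmul_lieMap_casimir (f : R⸨X⸩) (Z : P.hσ) :
    P.tmul f (P.lieMap ((P.adR Z).lTensor P.hσ P.casimir)) =
      (2 * algebraMap k R P.hCheck) • P.tmul f Z := by
  rw [← adTensor_tmul, adTensor_casimir]

/-- The map `X ⊗ Y ↦ Y ⊗ contract X e`. Its value at the Casimir element recovers `e`. -/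
def contractTensor (e : P.hσ ⊗[R] P.hσ) : P.hσ ⊗[R] P.hσ →ₗ[R] P.hσ ⊗[R] P.hσ :=
  TensorProduct.lift (LinearMap.mk₂ R (fun X Y => Y ⊗ₜ P.contract X e)
    (fun X X' Y => by
      rw [← TensorProduct.tmul_add]
      congr 1
      induction e with
      | zero => simp only [map_zero, add_zero]
      | add a b ha hb => rw [map_add, ha, hb, map_add, map_add]; abel
      | tmul A B => rw [contract_tmul, contract_tmul, contract_tmul, map_add, LinearMap.add_apply,
          add_smul])
    (fun r X Y => by
      rw [← TensorProduct.tmul_smul]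
      congr 1
      induction e with
      | zero => simp only [map_zero, smul_zero]
      | add a b ha hb => rw [map_add, ha, hb, map_add, smul_add]
      | tmul A B => rw [contract_tmul, contract_tmul, map_smul, LinearMap.smul_apply, smul_assoc])
    (fun X Y Y' => TensorProduct.add_tmul _ _ _)
    (fun r X Y => TensorProduct.smul_tmul' _ _ _))

theorem contractTensor_tmul (e : P.hσ ⊗[R] P.hσ) (X Y : P.hσ) :
    P.contractTensor e (X ⊗ₜ Y) = Y ⊗ₜ P.contract X e := rfl

theorem contractTensor_casimir (e : P.hσ ⊗[R] P.hσ) : P.contractTensor e P.casimir = e := by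
  induction e with
  | zero =>
    refine LinearMap.congr_fun (g := 0) (TensorProduct.ext' fun X Y => ?_) P.casimir
    rw [contractTensor_tmul, map_zero, TensorProduct.tmul_zero]; rfl
  | add a b ha hb =>
    conv_rhs => rw [← ha, ← hb, ← LinearMap.add_apply]
    refine LinearMap.congr_fun (TensorProduct.ext' fun X Y => ?_) P.casimir
    rw [LinearMap.add_apply, contractTensor_tmul, contractTensor_tmul, contractTensor_tmul, map_add,
      TensorProduct.tmul_add]
  | tmul A B =>
    have h : ∀ d, P.contractTensor (A ⊗ₜ B) d = P.contract A d ⊗ₜ B := fun d => by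
      induction d with
      | zero => simp only [map_zero, TensorProduct.zero_tmul]
      | add a b ha hb => rw [map_add, ha, hb, map_add, TensorProduct.add_tmul]
      | tmul X Y =>
        rw [contractTensor_tmul, contract_tmul, contract_tmul, formσ_symm, TensorProduct.smul_tmul]
    rw [h, P.casimir_spec]

/-- An element of `σ^*𝔥 ⊗ σ^*𝔥` is determined by its contractions. -/
theorem eq_zero_of_contract_eq_zero {e : P.hσ ⊗[R] P.hσ} (h : ∀ X, P.contract X e = 0) : e = 0 := by
  rw [← P.contractTensor_casimir e]
  refine LinearMap.congr_fun (g := 0) (TensorProduct.ext' fun X Y => ?_) P.casimir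
  rw [contractTensor_tmul, h, TensorProduct.tmul_zero]
  rfl

/-- The Casimir element is invariant: `∑ [X, Z] ⊗ Y + X ⊗ [Y, Z] = 0`. -/
theorem casimir_invariant (Z : P.hσ) :
    (P.adR Z).rTensor P.hσ P.casimir = -(P.adR Z).lTensor P.hσ P.casimir := by
  rw [← add_eq_zero_iff_eq_neg]
  refine P.eq_zero_of_contract_eq_zero fun X => ?_
  have h1 : ∀ e, P.contract X ((P.adR Z).rTensor P.hσ e) = P.contract ⁅Z, X⁆ e := fun e => by
    induction e with
    | zero => simp only [map_zero]
    | add a b ha hb => simp only [map_add, ha, hb]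
    | tmul A B =>
      rw [LinearMap.rTensor_tmul, contract_tmul, contract_tmul, adR_apply, formσ_symm, formσ_lie,
        formσ_symm]
  have h2 : ∀ e, P.contract X ((P.adR Z).lTensor P.hσ e) = ⁅P.contract X e, Z⁆ := fun e => by
    induction e with
    | zero => simp only [map_zero, zero_lie]
    | add a b ha hb => simp only [map_add, ha, hb, add_lie]
    | tmul A B =>
      rw [LinearMap.lTensor_tmul, contract_tmul, contract_tmul, adR_apply, smul_lie]
  rw [map_add, h1, h2, P.casimir_spec, P.casimir_spec, ← lie_skew X Z, add_neg_cancel]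

end TwistDatum
end Casimir

/-! ### A telescoping sum -/

section Telescope

variable {M : Type*} [AddCommGroup M]

/-- A telescoping sum: for a function `G` on `ℤ × ℤ` which vanishes for `m ≤ l` and for `k + l < C`,
the difference of its sums over a large square shifted vertically and horizontally by `q` is computed
by the symmetrization of `G`. -/
theorem sum_shift_sub_sum_shift {G : ℤ → ℤ → M} {ν : ℤ → M} {A m n C : ℤ} {q : ℕ}
    (hsym : ∀ k l, G k l + G l k = ν (k + l)) (hm : ∀ k l, m ≤ l → G k l = 0)
    (hC : ∀ k l, k + l < C → G k l = 0) (hmn : m ≤ n) (hAn : A ≤ n) (hA : A + n + q ≤ C) :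
    ∑ k ∈ Finset.Ico A n, ∑ l ∈ Finset.Ico (A + q) (n + q), G k l -
      ∑ k ∈ Finset.Ico (A + q) (n + q), ∑ l ∈ Finset.Ico A n, G k l =
      -(q • ∑ s ∈ Finset.Ico C (2 * m), ν s) := by
  have e1 : ∀ k ∈ Finset.Ico A n, ∑ l ∈ Finset.Ico (A + q) (n + q), G k l =
      ∑ l ∈ Finset.Ico A m, G k l := by
    intro k hk
    rw [Finset.mem_Ico] at hk
    trans ∑ l ∈ Finset.Ico A (n + q), G k l
    · refine Finset.sum_subset (Finset.Ico_subset_Ico (by omega) le_rfl) fun l hl hl' => ?_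
      rw [Finset.mem_Ico] at hl hl'
      exact hC _ _ (by omega)
    · refine (Finset.sum_subset (Finset.Ico_subset_Ico le_rfl (by omega)) fun l hl hl' => ?_).symm
      rw [Finset.mem_Ico] at hl hl'
      exact hm _ _ (by omega)
  have e2 : ∀ k, ∑ l ∈ Finset.Ico A n, G k l = ∑ l ∈ Finset.Ico A m, G k l := fun k =>
    (Finset.sum_subset (Finset.Ico_subset_Ico le_rfl hmn) fun l hl hl' => by
      rw [Finset.mem_Ico] at hl hl'
      exact hm _ _ (by omega)).symm
  have e3 : ∑ k ∈ Finset.Ico (A + q) (n + q), ∑ l ∈ Finset.Ico A m, G k l =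
      ∑ k ∈ Finset.Ico A (n + q), ∑ l ∈ Finset.Ico A m, G k l :=
    Finset.sum_subset (Finset.Ico_subset_Ico (by omega) le_rfl) fun k hk hk' => by
      rw [Finset.mem_Ico] at hk hk'
      refine Finset.sum_eq_zero fun l hl => ?_
      rw [Finset.mem_Ico] at hl
      exact hC _ _ (by omega)
  have e4 : ∀ k ∈ Finset.Ico n (n + q), ∑ l ∈ Finset.Ico A m, G k l =
      ∑ s ∈ Finset.Ico C (2 * m), ν s := by
    intro k hk
    rw [Finset.mem_Ico] at hk
    trans ∑ s ∈ Finset.Ico (A + k) (m + k), ν s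
    · rw [← Finset.sum_Ico_add' ν A m k]
      refine Finset.sum_congr rfl fun l _ => ?_
      rw [add_comm l k, ← hsym k l, hm l k (by omega), add_zero]
    · refine (Finset.sum_subset (Finset.Ico_subset_Ico (by omega) (by omega)) fun s hs hs' => ?_).symm
      rw [Finset.mem_Ico] at hs hs'
      by_cases h : s < C
      · have := hsym s 0
        rw [add_zero, hC s 0 (by omega), hC 0 s (by omega), add_zero] at this
        exact this.symm
      · have := hsym (s - m) m
        rw [sub_add_cancel, hm _ m le_rfl, hm _ (s - m) (by omega), add_zero] at this
        exact this.symm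
  rw [Finset.sum_congr rfl e1, Finset.sum_congr rfl fun k _ => e2 k, e3,
    ← Finset.Ico_union_Ico_eq_Ico hAn (show n ≤ n + q by omega),
    Finset.sum_union (Finset.Ico_disjoint_Ico_consecutive _ _ _), Finset.sum_congr rfl e4,
    Finset.sum_const, Int.card_Ico, add_sub_cancel_left, Int.toNat_natCast, sub_add_cancel_left]

/-- The shift `p` in `sum_shift_sub_sum_shift` may have either sign. -/
theorem sum_shift_sub_sum_shift_int {G : ℤ → ℤ → M} {ν : ℤ → M} {A m n C p : ℤ}
    (hsym : ∀ k l, G k l + G l k = ν (k + l)) (hm : ∀ k l, m ≤ l → G k l = 0)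
    (hC : ∀ k l, k + l < C → G k l = 0) (hmn : m + |p| ≤ n) (hAn : A ≤ n)
    (hA : A + n + |p| ≤ C) :
    ∑ k ∈ Finset.Ico A n, ∑ l ∈ Finset.Ico A n, (G k (l + p) - G (k + p) l) =
      -(p • ∑ s ∈ Finset.Ico C (2 * m), ν s) := by
  have e : ∑ k ∈ Finset.Ico A n, ∑ l ∈ Finset.Ico A n, (G k (l + p) - G (k + p) l) =
      ∑ k ∈ Finset.Ico A n, ∑ l ∈ Finset.Ico (A + p) (n + p), G k l -
        ∑ k ∈ Finset.Ico (A + p) (n + p), ∑ l ∈ Finset.Ico A n, G k l := by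
    simp only [Finset.sum_sub_distrib, Finset.sum_Ico_add' (G _) A n p]
    rw [← Finset.sum_Ico_add' (fun k => ∑ l ∈ Finset.Ico A n, G k l) A n p]
  rw [e]
  obtain ⟨q, rfl | rfl⟩ := p.eq_nat_or_neg
  · rw [Nat.abs_cast] at hmn hA
    rw [sum_shift_sub_sum_shift hsym hm hC (by omega) hAn (by omega), natCast_zsmul]
  · rw [abs_neg, Nat.abs_cast] at hmn hA
    have := sum_shift_sub_sum_shift (A := A + -q) (n := n + -q) (q := q) hsym hm hC (by omega)
      (by omega) (by omega)
    rw [neg_add_cancel_right, neg_add_cancel_right] at this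
    rw [← neg_sub, this, neg_zsmul, natCast_zsmul]

end Telescope

/-! ### The commutators of the Sugawara operators with the loop algebra -/

section Sugawara

variable {k 𝔤 R R' Γ : Type*} [Field k] [IsAlgClosed k] [CharZero k]
  [LieRing 𝔤] [LieAlgebra k 𝔤] [FiniteDimensional k 𝔤] [LieAlgebra.IsSimple k 𝔤]
  [CommRing R] [Algebra k R] [CommRing R'] [Algebra k R'] [Algebra R R'] [IsScalarTower k R R']
  [Group Γ] [Fintype Γ] (P : TwistDatum k 𝔤 R R' Γ)

namespace TwistDatum

/-- The element `c` of `Uĥ_𝓛`. -/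
abbrev cF : FEnv P.hFil := FEnv.ι P.hFil P.cc

theorem cF_mul (x : FEnv P.hFil) : P.cF * x = x * P.cF := by
  have h2 : ∀ x, FEnv.ι P.hFil x ∈ Subalgebra.centralizer R {P.cF} := fun x => by
    rw [Subalgebra.mem_centralizer_iff]
    rintro _ rfl
    rw [FEnv.ι_mul, show ⁅P.cc, x⁆ = 0 from CentralExt.gen_lie _ _, map_zero, add_zero]
  exact (Subalgebra.mem_centralizer_iff R).mp (FEnv.mem_of_subalgebra _ _ h2 x) _ rfl

theorem emb_mul (x y : P.hL) :
    P.emb x * P.emb y = P.emb y * P.emb x + (P.emb ⁅x, y⁆ + P.resForm x y • P.cF) := by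
  have h1 : P.emb x * P.emb y = P.emb y * P.emb x + FEnv.ι P.hFil ⁅P.inc x, P.inc y⁆ :=
    FEnv.ι_mul _ _ _
  have h2 : ⁅P.inc x, P.inc y⁆ = P.inc ⁅x, y⁆ + P.resForm x y • P.cc := CentralExt.inl_lie_inl _ _ _
  rw [h1, h2, map_add, map_smul]
  rfl

theorem emb_tmul_mem {f : R⸨X⸩} {n : ℕ} (hf : f ∈ fil R n) (X : P.hσ) :
    P.emb (P.tmul f X) ∈ leftIdeal P.hFil n :=
  Ideal.subset_span ⟨_, ⟨_, P.tmul_mem_hLFil hf X, rfl⟩, rfl⟩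

theorem tensorWith_mem (f : R⸨X⸩) {g : R⸨X⸩} {n : ℕ} (hg : g ∈ fil R n) (e : P.hσ ⊗[R] P.hσ) :
    P.tensorWith f g e ∈ leftIdeal P.hFil n := by
  induction e with
  | zero => rw [map_zero]; exact zero_mem _
  | add a b ha hb => rw [map_add]; exact add_mem ha hb
  | tmul X Y =>
    rw [tensorWith_tmul]
    exact (leftIdeal P.hFil n).mul_mem_left _ (P.emb_tmul_mem hg Y)

/-- The bilinear map `(f, g) ↦ ∑ f X ∘ g Y` for `e = ∑ X ⊗ Y`. -/
def tensorForm (e : P.hσ ⊗[R] P.hσ) : R⸨X⸩ →ₗ[R] R⸨X⸩ →ₗ[R] FEnv P.hFil :=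
  LinearMap.mk₂ R (fun f g => P.tensorWith f g e)
    (fun f f' g => by
      rw [← LinearMap.add_apply]
      congr 1
      ext X Y
      simp [tensorWith_tmul, add_mul])
    (fun r f g => by
      rw [← LinearMap.smul_apply]
      congr 1
      ext X Y
      simp [tensorWith_tmul])
    (fun f g g' => by
      rw [← LinearMap.add_apply]
      congr 1
      ext X Y
      simp [tensorWith_tmul, mul_add])
    (fun r f g => by
      rw [← LinearMap.smul_apply]
      congr 1
      ext X Y
      simp [tensorWith_tmul])

theorem tensorWith_sub_comm (f g : R⸨X⸩) (e : P.hσ ⊗[R] P.hσ) :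
    P.tensorWith f g e - P.tensorWith g f (TensorProduct.comm R P.hσ P.hσ e) =
      P.emb (P.tmul (f * g) (P.lieMap e)) +
        (resPair R f g * TensorProduct.lift P.formσ e) • P.cF := by
  induction e with
  | zero => simp
  | add a b ha hb =>
    simp only [map_add, mul_add, add_smul]
    rw [add_sub_add_comm, ha, hb]
    abel
  | tmul X Y =>
    rw [TensorProduct.comm_tmul, tensorWith_tmul, tensorWith_tmul, emb_mul, add_sub_cancel_left,
      tmul_lie_tmul, resForm_tmul, mul_comm (P.formσ X Y)]
    rfl

/-- The element `∑ X ⊗ [Y, Z]` for the Casimir element `𝔠 = ∑ X ⊗ Y`. -/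
def adCasimir (Z : P.hσ) : P.hσ ⊗[R] P.hσ := (P.adR Z).lTensor P.hσ P.casimir

theorem comm_adCasimir (Z : P.hσ) :
    TensorProduct.comm R P.hσ P.hσ (P.adCasimir Z) = -P.adCasimir Z := by
  have h : ∀ e, TensorProduct.comm R P.hσ P.hσ ((P.adR Z).lTensor P.hσ e) =
      (P.adR Z).rTensor P.hσ (TensorProduct.comm R P.hσ P.hσ e) := fun e => by
    induction e with
    | zero => simp only [map_zero]
    | add a b ha hb => simp only [map_add, ha, hb]
    | tmul X Y => rfl
  rw [adCasimir, h, casimir_symm, casimir_invariant]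

theorem formσ_adCasimir (Z : P.hσ) : TensorProduct.lift P.formσ (P.adCasimir Z) = 0 := by
  have h : ∀ e, TensorProduct.lift P.formσ ((P.adR Z).lTensor P.hσ e) =
      P.formσ (P.lieMap e) Z := fun e => by
    induction e with
    | zero => simp only [map_zero, LinearMap.zero_apply]
    | add a b ha hb => simp only [map_add, ha, hb, LinearMap.add_apply]
    | tmul X Y => exact (P.formσ_lie X Y Z).symm
  rw [adCasimir, h, lieMap_casimir, map_zero, LinearMap.zero_apply]

/-- Reordering `∑ f X ∘ g [Y, Z]` produces the dual Coxeter number. -/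
theorem tensorWith_adCasimir_add (f g : R⸨X⸩) (Z : P.hσ) :
    P.tensorWith f g (P.adCasimir Z) + P.tensorWith g f (P.adCasimir Z) =
      (2 * algebraMap k R P.hCheck) • P.emb (P.tmul (f * g) Z) := by
  have h := P.tensorWith_sub_comm f g (P.adCasimir Z)
  rw [comm_adCasimir, map_neg, sub_neg_eq_add, formσ_adCasimir, mul_zero, zero_smul, add_zero] at h
  rw [h, adCasimir, tmul_lieMap_casimir, map_smul]

/-- The part of `[γ_𝔠(f ⊗ g), h Z]` which does not involve `c`. -/
def anomaly (h : R⸨X⸩) (Z : P.hσ) : R⸨X⸩ →ₗ[R] R⸨X⸩ →ₗ[R] FEnv P.hFil :=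
  (P.tensorForm (P.adCasimir Z)).compl₂ (LinearMap.mulRight R h) -
    (P.tensorForm (P.adCasimir Z)) ∘ₗ (LinearMap.mulRight R h)

theorem anomaly_apply (h : R⸨X⸩) (Z : P.hσ) (f g : R⸨X⸩) : P.anomaly h Z f g =
    P.tensorWith f (g * h) (P.adCasimir Z) - P.tensorWith (f * h) g (P.adCasimir Z) := rfl

/-- The anomaly is symmetric, because `A(f, gh)` and `A(fh, g)` change under reordering by the same
multiple of `fgh Z`. -/
theorem anomaly_symm (h : R⸨X⸩) (Z : P.hσ) (f g : R⸨X⸩) :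
    P.anomaly h Z f g = P.anomaly h Z g f := by
  have h1 := P.tensorWith_adCasimir_add f (g * h) Z
  have h2 := P.tensorWith_adCasimir_add g (f * h) Z
  rw [show g * (f * h) = f * (g * h) by ring, ← h1] at h2
  rw [anomaly_apply, anomaly_apply, sub_eq_sub_iff_add_eq_add, ← h2]

/-- The commutator of `∑ f X ∘ g Y` with `h Z`. -/
theorem tensorWith_commutator (f g h : R⸨X⸩) (Z : P.hσ) (e : P.hσ ⊗[R] P.hσ) :
    P.tensorWith f g e * P.emb (P.tmul h Z) - P.emb (P.tmul h Z) * P.tensorWith f g e =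
      P.tensorWith f (g * h) ((P.adR Z).lTensor P.hσ e) +
        P.tensorWith (f * h) g ((P.adR Z).rTensor P.hσ e) +
      P.cF * (resPair R f h • P.emb (P.tmul g (P.contract Z e)) + resPair R g h •
        P.emb (P.tmul f (P.contract Z (TensorProduct.comm R P.hσ P.hσ e)))) := by
  induction e with
  | zero => simp
  | add a b ha hb =>
    simp only [map_add, add_mul, mul_add, smul_add] at ha hb ⊢
    rw [add_sub_add_comm, ha, hb]
    abel
  | tmul X Y =>
    rw [TensorProduct.comm_tmul, LinearMap.lTensor_tmul, LinearMap.rTensor_tmul, tensorWith_tmul,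
      tensorWith_tmul, tensorWith_tmul, contract_tmul, contract_tmul, adR_apply, adR_apply,
      mul_assoc, P.emb_mul (P.tmul g Y), mul_add, ← mul_assoc, P.emb_mul (P.tmul f X) (P.tmul h Z),
      tmul_lie_tmul, tmul_lie_tmul, resForm_tmul, resForm_tmul, P.formσ_symm Z X, P.formσ_symm Z Y]
    simp only [map_smul, smul_smul, mul_add, add_mul, mul_smul_comm, smul_mul_assoc, mul_assoc,
      P.cF_mul]
    rw [mul_comm (P.formσ X Z), mul_comm (P.formσ Y Z)]
    abel

theorem gammaForm_commutator (f g h : R⸨X⸩) (Z : P.hσ) :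
    P.gammaForm f g * P.emb (P.tmul h Z) - P.emb (P.tmul h Z) * P.gammaForm f g =
      P.anomaly h Z f g + P.cF * P.emb (P.tmul (adForm h f g) Z) := by
  change P.tensorWith f g P.casimir * _ - _ * P.tensorWith f g P.casimir = _
  rw [tensorWith_commutator, casimir_invariant, casimir_symm, P.casimir_spec, map_neg,
    ← sub_eq_add_neg, anomaly_apply, adForm_apply, map_add, LinearMap.add_apply, map_smul, map_smul,
    LinearMap.smul_apply, LinearMap.smul_apply, map_add, map_smul, map_smul]
  rfl

theorem gammaU_mul (f g : R⸨X⸩) : P.gammaU (ell R f * ell R g) = P.gammaForm f g :=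
  quad_mul _ _ _ f g

theorem gammaU_hbar : P.gammaU (hbarF R) = (Module.finrank k 𝔤 : R) • P.cF := quad_hbar _ _ _

/-- The linear extension of `anomaly` to `𝔩₂`. -/
def anomalyU (h : R⸨X⸩) (Z : P.hσ) : FEnv (lFil R) →ₗ[R] FEnv P.hFil :=
  quad (P.anomaly h Z) 0 (sub_zero_of_symm (P.anomaly_symm h Z))

theorem anomalyU_mul (h : R⸨X⸩) (Z : P.hσ) (f g : R⸨X⸩) :
    P.anomalyU h Z (ell R f * ell R g) = P.anomaly h Z f g := quad_mul _ _ _ f g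

theorem anomalyU_hbar (h : R⸨X⸩) (Z : P.hσ) : P.anomalyU h Z (hbarF R) = 0 := quad_hbar _ _ _

theorem gammaU_commutator (h : R⸨X⸩) (Z : P.hσ) {u : FEnv (lFil R)} (hu : u ∈ lTwo R) :
    P.gammaU u * P.emb (P.tmul h Z) - P.emb (P.tmul h Z) * P.gammaU u =
      P.anomalyU h Z u + P.cF * P.emb (P.tmul (adQuad h u) Z) := by
  refine lTwo_ext
    (φ := (LinearMap.mulRight R (P.emb (P.tmul h Z)) - LinearMap.mulLeft R (P.emb (P.tmul h Z))) ∘ₗ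
      P.gammaU)
    (ψ := P.anomalyU h Z + LinearMap.mulLeft R P.cF ∘ₗ P.emb ∘ₗ P.tmul.flip Z ∘ₗ adQuad h)
    (fun f g => ?_) ?_ hu
  · change P.gammaU (ell R f * ell R g) * P.emb (P.tmul h Z) - P.emb (P.tmul h Z) *
      P.gammaU (ell R f * ell R g) = P.anomalyU h Z (ell R f * ell R g) +
        P.cF * P.emb (P.tmul (adQuad h (ell R f * ell R g)) Z)
    rw [gammaU_mul, anomalyU_mul, adQuad_mul, gammaForm_commutator]
  · change P.gammaU (hbarF R) * P.emb (P.tmul h Z) - P.emb (P.tmul h Z) *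
      P.gammaU (hbarF R) = P.anomalyU h Z (hbarF R) + P.cF * P.emb (P.tmul (adQuad h (hbarF R)) Z)
    rw [gammaU_hbar, anomalyU_hbar, adQuad_hbar, map_zero, LinearMap.zero_apply, map_zero, mul_zero,
      smul_mul_assoc, mul_smul_comm, cF_mul, sub_self, add_zero]

/-- As `R` is a `k`-algebra, positive integers are invertible in it. -/
theorem isUnit_natCast (_P : TwistDatum k 𝔤 R R' Γ) {n : ℕ} (hn : n ≠ 0) : IsUnit (n : R) := by
  have h : IsUnit (n : k) := (Nat.cast_ne_zero.mpr hn).isUnit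
  have := h.map (algebraMap k R)
  rwa [map_natCast] at this

/-- The anomaly of an element of `θ̂` with symbol `D` against `t^p Z` is `-ȟ D(t^p) Z`: after
truncation the sum telescopes, and the boundary terms are reordered. -/
theorem anomalyU_tpow_add_mem (x : Vir R) (p : ℤ) (Z : P.hσ) (m : ℕ) {n : ℕ}
    (hn : m + |p| ≤ n) {u : FEnv (lFil R)} (hu : u ∈ lTwo R)
    (hxu : x.1.2 - CEnv.of (lFil R) u ∈ cIdeal (lFil R) n) :
    P.anomalyU (tpow R p) Z u +
      algebraMap k R P.hCheck • P.emb (P.tmul (x.1.1.1 (tpow R p)) Z) ∈ leftIdeal P.hFil m := by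
  let W : Submodule R (FEnv P.hFil) := (leftIdeal P.hFil m).restrictScalars R
  let Q := W.mkQ
  have hQ : ∀ y, Q y = 0 ↔ y ∈ leftIdeal P.hFil m := fun y => by
    change W.mkQ y = 0 ↔ _
    rw [Submodule.mkQ_apply, Submodule.Quotient.mk_eq_zero]
    rfl
  let B : R⸨X⸩ →ₗ[R] R⸨X⸩ →ₗ[R] (FEnv P.hFil ⧸ W) := (P.anomaly (tpow R p) Z).compr₂ Q
  have hBa : ∀ f g, B f g = Q (P.anomaly (tpow R p) Z f g) := fun _ _ => rfl
  have hB : ∀ f g, B f g = B g f := fun f g => by rw [hBa, hBa, anomaly_symm]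
  have hBn : ∀ f, ∀ s ∈ fil R (n : ℤ), B f s = 0 := fun f s hs => by
    rw [hBa, hQ, anomaly_apply]
    have h1 := neg_abs_le p
    have h2 := abs_nonneg p
    exact sub_mem (P.tensorWith_mem _ (fil_anti (by omega) (mul_mem_fil hs (tpow_mem_fil p))) _)
      (P.tensorWith_mem _ (fil_anti (by omega) hs) _)
  let δ := x.1.1.1 (tpow R 1)
  obtain ⟨N₀, hδ⟩ := exists_mem_fil δ
  -- the sum of `B(t^i, t^j)` against the form of `D` is that of `G i (j + p) - G (i + p) j`, and `G`
  -- satisfies the hypotheses of the telescoping lemma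
  let a : ℤ → ℤ → FEnv P.hFil ⧸ W := fun i j =>
    Q (P.tensorWith (tpow R i) (tpow R j) (P.adCasimir Z))
  let μ : ℤ → FEnv P.hFil ⧸ W := fun i =>
    (2 * algebraMap k R P.hCheck) • Q (P.emb (P.tmul (tpow R i) Z))
  let G : ℤ → ℤ → FEnv P.hFil ⧸ W := fun i j => δ.coeff (i + j + 1 - p) • a i j
  let ν : ℤ → FEnv P.hFil ⧸ W := fun i => δ.coeff (i + 1 - p) • μ i
  have hsym : ∀ i j, G i j + G j i = ν (i + j) := fun i j => by
    change δ.coeff (i + j + 1 - p) • Q _ + δ.coeff (j + i + 1 - p) • Q _ = δ.coeff _ • _ • Q _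
    rw [add_comm j i, ← smul_add, ← map_add, tensorWith_adCasimir_add, tpow_mul, map_smul]
  have hm : ∀ i j, (m : ℤ) ≤ j → G i j = 0 := fun i j hj => by
    change _ • Q _ = 0
    rw [(hQ _).mpr (P.tensorWith_mem _ (fil_anti hj (tpow_mem_fil j)) _), smul_zero]
  have hC : ∀ i j, i + j < p - 1 - N₀ → G i j = 0 := fun i j hij => by
    change _ • Q _ = 0
    rw [hδ _ (by omega), zero_smul]
  obtain ⟨N₁, hN⟩ := two_smul_quad_eq_sum hB hBn hu
  obtain ⟨N, hN₁, hN₂⟩ : ∃ N : ℕ, N₁ ≤ N ∧ -(N : ℤ) + n + |p| ≤ p - 1 - N₀ :=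
    ⟨max N₁ (n + |p| - p + 1 + N₀).toNat, le_max_left _ _, by
      have := Int.self_le_toNat (n + |p| - p + 1 + N₀)
      have := le_max_right N₁ (n + |p| - p + 1 + N₀).toNat
      omega⟩
  have h1 := hN N hN₁
  have h2 : ∀ i ∈ Finset.Ico (-N : ℤ) n, ∀ j ∈ Finset.Ico (-N : ℤ) n,
      pairing R (tau R i) (tau R j) (CEnv.of (lFil R) u) • B (tpow R i) (tpow R j) =
        G i (j + p) - G (i + p) j := by
    intro i hi j hj
    have hτ : ∀ i ∈ Finset.Ico (-N : ℤ) n, tau R i (ddt R) ∈ fil R (-n) := fun i hi => by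
      rw [tau_ddt]
      exact fil_anti (by have := (Finset.mem_Ico.mp hi).2; omega) (tpow_mem_fil _)
    rw [← pairing_eq_of_sub_mem (hτ i hi) (hτ j hj) hxu, x.2.2, res_tau_smul_tau, hBa,
      anomaly_apply, tpow_mul, tpow_mul, map_sub, smul_sub]
    change _ = δ.coeff (i + (j + p) + 1 - p) • Q _ - δ.coeff (i + p + j + 1 - p) • Q _
    rw [show i + (j + p) + 1 - p = i + j + 1 by ring, show i + p + j + 1 - p = i + j + 1 by ring]
  have h3 : quad B 0 (sub_zero_of_symm hB) u = Q (P.anomalyU (tpow R p) Z u) :=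
    lTwo_ext (φ := quad B 0 (sub_zero_of_symm hB)) (ψ := Q ∘ₗ P.anomalyU (tpow R p) Z)
      (fun f g => (quad_mul _ _ _ f g).trans (congrArg Q (P.anomalyU_mul _ Z f g)).symm)
      ((quad_hbar _ _ _).trans ((congrArg Q (P.anomalyU_hbar _ Z)).trans (map_zero _)).symm) hu
  rw [Finset.sum_congr rfl fun i hi => Finset.sum_congr rfl fun j hj => h2 i hi j hj,
    sum_shift_sub_sum_shift_int hsym hm hC hn (by have := abs_nonneg p; omega) hN₂, h3] at h1
  -- the expansion of `D(t^p) = p t^{p-1} δ` modulo `F^m`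
  have h4 : Q (P.emb (P.tmul (x.1.1.1 (tpow R p)) Z)) = (p : R) •
      ∑ s ∈ Finset.Ico (p - 1 - N₀ : ℤ) (2 * m), δ.coeff (s + 1 - p) •
        Q (P.emb (P.tmul (tpow R s) Z)) := by
    have e1 : tpow R (p - 1) * δ ∈ fil R (p - 1 - N₀) :=
      fil_anti (by omega) (mul_mem_fil (tpow_mem_fil _) hδ)
    have e2 := (hQ _).mpr (P.emb_tmul_mem (fil_anti (by omega)
      (sub_sum_tpow_mem_fil (n := 2 * (m : ℤ)) e1)) Z)
    rw [map_sub, LinearMap.sub_apply, map_sub, map_sub, sub_eq_zero] at e2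
    rw [theta_apply, ddtDer_tpow, mul_smul_comm, mul_comm, map_smul, LinearMap.smul_apply, map_smul,
      map_smul, e2]
    simp only [map_sum, LinearMap.sum_apply, map_smul, LinearMap.smul_apply, coeff_tpow_mul]
    congr 1
    exact Finset.sum_congr rfl fun s _ => by rw [show s - (p - 1) = s + 1 - p by ring]
  rw [← hQ]
  obtain ⟨c, hc⟩ := (P.isUnit_natCast two_ne_zero).exists_left_inv
  rw [Nat.cast_ofNat] at hc
  rw [← one_smul R (Q _), ← hc, mul_smul, map_add, smul_add, h1, map_smul, h4, smul_smul,
    smul_comm _ (p : R), neg_add_eq_zero.mpr, smul_zero]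
  rw [← Int.cast_smul_eq_zsmul R]
  congr 1
  rw [Finset.smul_sum]
  exact Finset.sum_congr rfl fun s _ => smul_comm _ _ _

theorem continuous_gammaHat : Continuous P.gammaHat := continuous_extendMap _ _ _ _

theorem gammaHat_mem_cIdeal {n : ℕ} {e : CEnv (lFil R)} (he : e ∈ cIdeal (lFil R) n) :
    P.gammaHat e ∈ cIdeal P.hFil n :=
  extendMap_mem_cIdeal _ _ _ _ (P.gammaU_mem n) he

/-- The map `h ↦ h Z` with values in `Ūĥ_𝓛`. -/
def loop (Z : P.hσ) : R⸨X⸩ →ₗ[R] CEnv P.hFil :=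
  (CEnv.of P.hFil).toLinearMap ∘ₗ P.emb ∘ₗ P.tmul.flip Z

theorem loop_apply (Z : P.hσ) (h : R⸨X⸩) : P.loop Z h = CEnv.of P.hFil (P.emb (P.tmul h Z)) := rfl

theorem loop_mem_cIdeal (Z : P.hσ) {h : R⸨X⸩} {n : ℕ} (hh : h ∈ fil R n) :
    P.loop Z h ∈ cIdeal P.hFil n := of_mem_cIdeal _ (P.emb_tmul_mem hh Z)

theorem cPlus_mul (a : CEnv P.hFil) :
    (P.cPlus : CEnv P.hFil) * a = P.cBar * a + algebraMap k R P.hCheck • a := by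
  change (P.cBar + algebraMap R (CEnv P.hFil) _) * a = _
  rw [add_mul, Algebra.smul_def]

/-- The defect of the commutation relation `[Ĉ_𝔥(D, u), h Z] = -(c + ȟ) D(h) Z`. -/
def defect (x : Vir R) (Z : P.hσ) : R⸨X⸩ →ₗ[R] CEnv P.hFil :=
  (LinearMap.mulLeft R (P.gammaHat x.1.2) - LinearMap.mulRight R (P.gammaHat x.1.2)) ∘ₗ P.loop Z +
    LinearMap.mulLeft R (P.cPlus : CEnv P.hFil) ∘ₗ P.loop Z ∘ₗ x.1.1.1.toLinearMap

theorem defect_apply (x : Vir R) (Z : P.hσ) (h : R⸨X⸩) : P.defect x Z h =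
    P.gammaHat x.1.2 * P.loop Z h - P.loop Z h * P.gammaHat x.1.2 +
      P.cPlus * P.loop Z (x.1.1.1 h) := rfl

theorem defect_tpow (x : Vir R) (Z : P.hσ) (p : ℤ) : P.defect x Z (tpow R p) = 0 := by
  refine eq_zero_of_forall_mem_cIdeal _ fun m => ?_
  obtain ⟨m₁, h₁⟩ := exists_mul_right_mem_cIdeal P.hFil (P.loop Z (tpow R p)) m
  obtain ⟨m₂, h₂⟩ := exists_mem_fil_of_le (ddtDer R (tpow R p))
  let n := m + p.natAbs + m₁ + m₂
  obtain ⟨u, hu, hxu⟩ := exists_mem_lTwo_sub_mem x.2.1 n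
  have e0 := P.gammaHat_mem_cIdeal hxu
  rw [map_sub, gammaHat_of] at e0
  have e1 := h₁ _ (cIdeal_anti _ (show m₁ ≤ n by omega) e0)
  have e2 := mul_mem_cIdeal _ (P.loop Z (tpow R p)) (cIdeal_anti _ (show m ≤ n by omega) e0)
  have e3 := of_mem_cIdeal P.hFil (P.anomalyU_tpow_add_mem x p Z m (n := n)
    (by rw [Int.abs_eq_natAbs]; omega) hu hxu)
  have e4 := mul_mem_cIdeal _ P.cBar (P.loop_mem_cIdeal Z (adQuad_add_mem_fil x
    (show m ≤ n by omega) (h₂ n (by omega)) hu hxu))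
  have e5 := congrArg (CEnv.of P.hFil) (P.gammaU_commutator (tpow R p) Z hu)
  rw [map_sub, map_add, map_mul, map_mul, map_mul] at e5
  rw [map_add, eq_sub_of_add_eq e5.symm, map_smul] at e3
  rw [map_add, mul_add] at e4
  have e6 := add_mem (sub_mem e1 e2) (add_mem e3 e4)
  rw [defect_apply, cPlus_mul]
  convert e6 using 1
  simp only [loop_apply, sub_mul, mul_sub, cBar, cF]
  abel

/-- The Sugawara operators act on `𝔥_𝓛` by derivations of `R((t))`. -/
theorem defect_eq_zero (x : Vir R) (Z : P.hσ) (h : R⸨X⸩) : P.defect x Z h = 0 := by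
  refine eq_zero_of_forall_mem_cIdeal _ fun m => ?_
  obtain ⟨m₁, h₁⟩ := exists_mul_right_mem_cIdeal P.hFil (P.gammaHat x.1.2) m
  obtain ⟨m₂, h₂⟩ := x.1.1.2 m
  obtain ⟨N, hN⟩ := exists_mem_fil h
  let n : ℕ := m + m₁ + m₂.toNat
  have hs := sub_sum_tpow_mem_fil (n := n) hN
  -- `h` is approximated by a Laurent polynomial, on which the defect vanishes
  set s := ∑ i ∈ Finset.Ico (-N : ℤ) n, h.coeff i • tpow R i with hs_def
  have e1 : P.defect x Z s = 0 := by
    rw [hs_def, map_sum]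
    exact Finset.sum_eq_zero fun i _ => by rw [map_smul, defect_tpow, smul_zero]
  rw [← sub_zero (P.defect x Z h), ← e1, ← map_sub, defect_apply]
  refine add_mem (sub_mem (mul_mem_cIdeal _ _ (P.loop_mem_cIdeal Z (fil_anti (by omega) hs)))
    (h₁ _ (P.loop_mem_cIdeal Z (fil_anti (by omega) hs)))) (mul_mem_cIdeal _ _ ?_)
  exact P.loop_mem_cIdeal Z (h₂ _ (fil_anti (by omega) hs))

theorem cHatH_commutator_loop (x : Vir R) (Z : P.hσ) (h : R⸨X⸩) :
    P.gammaHat x.1.2 * P.loop Z h - P.loop Z h * P.gammaHat x.1.2 =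
      -(P.cPlus * P.loop Z (x.1.1.1 h)) :=
  eq_neg_of_add_eq_zero_left (P.defect_eq_zero x Z h)

end TwistDatum
end Sugawara

/-! ### Division by a central element -/

section Away

variable {A : Type*} [Ring A] (R : Type*) [CommRing R] [Algebra R A] (z : Subring.center A)

theorem Away.of_mul (a b : A) : Away.of R z (a * b) = Away.of R z a * Away.of R z b :=
  map_mul OreLocalization.numeratorRingHom a b

theorem Away.inv_mul_of : Away.inv z * Away.of R z (z : A) = 1 :=
  OreLocalization.mul_inv (1 : Submonoid.powers (z : A)) ⟨z, Submonoid.mem_powers _⟩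

theorem Away.of_mul_inv : Away.of R z (z : A) * Away.inv z = 1 :=
  OreLocalization.mul_inv ⟨(z : A), Submonoid.mem_powers _⟩ (1 : Submonoid.powers (z : A))

theorem Away.of_mul_inv_comm (a : A) : Away.of R z a * Away.inv z = Away.inv z * Away.of R z a := by
  have h : Away.of R z a * Away.of R z (z : A) = Away.of R z (z : A) * Away.of R z a := by
    rw [← Away.of_mul, ← Away.of_mul, Subring.mem_center_iff.mp z.2 a]
  calc Away.of R z a * Away.inv z
      = Away.inv z * (Away.of R z (z : A) * Away.of R z a) * Away.inv z := by
        rw [← mul_assoc, Away.inv_mul_of, one_mul]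
    _ = Away.inv z * Away.of R z a := by
        rw [← h, ← mul_assoc, mul_assoc, Away.of_mul_inv, mul_one]

/-- The kernel of `A → A[z⁻¹]` consists of the `z`-torsion. -/
theorem Away.of_eq_zero {a : A} (h : Away.of R z a = 0) : ∃ n : ℕ, (z : A) ^ n * a = 0 := by
  have h1 : OreLocalization.oreDiv a (1 : Submonoid.powers (z : A)) = OreLocalization.oreDiv 0 1 :=
    h.trans (OreLocalization.zero_oreDiv' 1).symm
  obtain ⟨⟨s, n, hs⟩, v, h2, h3⟩ := OreLocalization.oreDiv_eq_iff.mp h1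
  refine ⟨n, ?_⟩
  simp only [smul_zero, smul_eq_mul, Submonoid.coe_one, mul_one] at h2 h3
  change (z : A) ^ n = s at hs
  rw [hs, h3, ← h2]

/-- If `[u, v] = -z w` with `z` central, then `-u/z` and `-v/z` have commutator `-w/z`. -/
theorem Away.commutator {u v w : A} (h : u * v - v * u = -(z * w)) :
    -(Away.inv z * Away.of R z w) =
      -(Away.inv z * Away.of R z u) * -(Away.inv z * Away.of R z v) -
        -(Away.inv z * Away.of R z v) * -(Away.inv z * Away.of R z u) := by
  have h1 : ∀ a b : A, -(Away.inv z * Away.of R z a) * -(Away.inv z * Away.of R z b) =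
      Away.inv z * (Away.inv z * Away.of R z (a * b)) := fun a b => by
    rw [neg_mul_neg, mul_assoc, ← mul_assoc (Away.of R z a), Away.of_mul_inv_comm, Away.of_mul,
      mul_assoc]
  rw [h1, h1, ← mul_sub, ← mul_sub, ← map_sub, h, map_neg, Away.of_mul, mul_neg, mul_neg,
    ← mul_assoc (Away.inv z) (Away.of R z _), Away.inv_mul_of, one_mul]

end Away

/-! ### The Virasoro algebra -/

section Virasoro

variable {R : Type*} [CommRing R]

theorem virT_apply (x : Vir R) :
    virT R x = -(Away.inv (hbarC R) * Away.of R (hbarC R) x.1.2) := rfl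

theorem virT_injective (hR : ∀ n : ℕ, n ≠ 0 → IsUnit (n : R)) :
    Function.Injective (virT R) := by
  suffices hker : ∀ x, virT R x = 0 → x = 0 by
    intro x y hxy
    have h := hker (x + (-1 : R) • y) (by
      rw [map_add, map_smul, hxy, neg_smul, one_smul, add_neg_cancel])
    calc x = x + ((-1 : R) + 1) • y := by rw [neg_add_cancel, zero_smul, add_zero]
      _ = x + (-1 : R) • y + y := by rw [add_smul, one_smul, add_assoc]
      _ = y := by rw [h, zero_add]
  intro x hx
  rw [virT_apply, neg_eq_zero] at hx
  have h1 : Away.of R (hbarC R) x.1.2 = 0 := by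
    rw [← one_mul (Away.of R _ _), ← Away.of_mul_inv R (hbarC R), mul_assoc, hx, mul_zero]
  obtain ⟨n, hn⟩ := Away.of_eq_zero R _ h1
  exact vir_eq_zero_of_hbar_pow_mul hR x hn

/-- The image of `T` is closed under commutators. -/
theorem virT_commutator {x y z : Vir R} (hz : z.1.2 = lieHat x.1.1 y.1.2) :
    virT R z = virT R x * virT R y - virT R y * virT R x := by
  refine Away.commutator R (hbarC R) ?_
  change x.1.2 * y.1.2 - y.1.2 * x.1.2 = -(CEnv.of (lFil R) (hbarF R) * z.1.2)
  rw [hz]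
  exact vir_commutator x y.2.1

theorem virT_virC : virT R (virC R) = 1 := by
  rw [virT_apply]
  change -(Away.inv (hbarC R) * Away.of R (hbarC R) (-(hbarC R : CEnv (lFil R)))) = 1
  rw [map_neg, mul_neg, neg_neg, Away.inv_mul_of]

end Virasoro

/-! ### The Sugawara homomorphism -/

section Sugawara

variable {k 𝔤 R R' Γ : Type*} [Field k] [IsAlgClosed k] [CharZero k]
  [LieRing 𝔤] [LieAlgebra k 𝔤] [FiniteDimensional k 𝔤] [LieAlgebra.IsSimple k 𝔤]
  [CommRing R] [Algebra k R] [CommRing R'] [Algebra k R'] [Algebra R R'] [IsScalarTower k R R']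
  [Group Γ] [Fintype Γ] (P : TwistDatum k 𝔤 R R' Γ)

namespace TwistDatum

theorem gammaHat_commutator_tensorWith (x : Vir R) (f g : R⸨X⸩) (e : P.hσ ⊗[R] P.hσ) :
    P.gammaHat x.1.2 * CEnv.of P.hFil (P.tensorWith f g e) -
      CEnv.of P.hFil (P.tensorWith f g e) * P.gammaHat x.1.2 =
      -(P.cPlus * CEnv.of P.hFil
        (P.tensorWith (x.1.1.1 f) g e + P.tensorWith f (x.1.1.1 g) e)) := by
  induction e with
  | zero => simp only [map_zero, mul_zero, zero_mul, sub_zero, add_zero, neg_zero]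
  | add a b ha hb =>
    simp only [map_add, mul_add, add_mul] at ha hb ⊢
    rw [add_sub_add_comm, ha, hb]
    abel
  | tmul X Y =>
    simp only [tensorWith_tmul, map_add, map_mul, ← loop_apply]
    have h1 := P.cHatH_commutator_loop x X f
    have h2 := P.cHatH_commutator_loop x Y g
    rw [sub_eq_iff_eq_add] at h1 h2
    have h3 : P.loop X f * (P.cPlus : CEnv P.hFil) = P.cPlus * P.loop X f :=
      Subring.mem_center_iff.mp P.cPlus.2 _
    rw [← mul_assoc, h1, add_mul, mul_assoc (P.loop X f), h2, mul_add, mul_neg,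
      ← mul_assoc (P.loop X f) (P.cPlus : CEnv P.hFil), h3]
    noncomm_ring

/-- For `(D, u)` in `θ̂`, the commutator of `γ̂_𝔠(u)` with the image of `γ̂_𝔠` is `-(c + ȟ)` times the
action of `D`. -/
theorem gammaHat_commutator (x : Vir R) {v : CEnv (lFil R)} (hv : v ∈ lTwoBar R) :
    P.gammaHat x.1.2 * P.gammaHat v - P.gammaHat v * P.gammaHat x.1.2 =
      -(P.cPlus * P.gammaHat (lieHat x.1.1 v)) := by
  refine lTwoBar_induction
    (p := fun v => P.gammaHat x.1.2 * P.gammaHat v - P.gammaHat v * P.gammaHat x.1.2 =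
      -(P.cPlus * P.gammaHat (lieHat x.1.1 v)))
    (isClosed_eq (((continuous_const_mul _).comp P.continuous_gammaHat).sub
      ((continuous_mul_const _).comp P.continuous_gammaHat))
      ((continuous_const_mul _).comp (P.continuous_gammaHat.comp (continuous_lieHat _))).neg)
    (fun v hv => ?_) hv
  rw [lieHat_of, gammaHat_of, gammaHat_of]
  refine lTwo_ext
    (φ := (LinearMap.mulLeft R (P.gammaHat x.1.2) - LinearMap.mulRight R (P.gammaHat x.1.2)) ∘ₗ
      (CEnv.of P.hFil).toLinearMap ∘ₗ P.gammaU)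
    (ψ := -(LinearMap.mulLeft R (P.cPlus : CEnv P.hFil) ∘ₗ (CEnv.of P.hFil).toLinearMap ∘ₗ
      P.gammaU ∘ₗ lieU x.1.1)) (fun f g => ?_) ?_ hv
  · change P.gammaHat x.1.2 * CEnv.of P.hFil (P.gammaU (ell R f * ell R g)) -
      CEnv.of P.hFil (P.gammaU (ell R f * ell R g)) * P.gammaHat x.1.2 =
      -(P.cPlus * CEnv.of P.hFil (P.gammaU (lieU x.1.1 (ell R f * ell R g))))
    rw [lieU_mul, map_add, gammaU_mul, gammaU_mul, gammaU_mul]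
    exact P.gammaHat_commutator_tensorWith x f g P.casimir
  · change P.gammaHat x.1.2 * CEnv.of P.hFil (P.gammaU (hbarF R)) -
      CEnv.of P.hFil (P.gammaU (hbarF R)) * P.gammaHat x.1.2 =
      -(P.cPlus * CEnv.of P.hFil (P.gammaU (lieU x.1.1 (hbarF R))))
    have h : P.gammaHat x.1.2 * CEnv.of P.hFil P.cF = CEnv.of P.hFil P.cF * P.gammaHat x.1.2 :=
      Subring.mem_center_iff.mp (of_mem_center P.hFil (CentralExt.gen_lie _)) _
    rw [lieU_hbar, map_zero, map_zero, mul_zero, neg_zero, gammaU_hbar, map_smul, mul_smul_comm,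
      smul_mul_assoc, h, sub_self]

theorem sugawara_commutator {x y z : Vir R} (hz : z.1.2 = lieHat x.1.1 y.1.2) :
    P.sugawara z = P.sugawara x * P.sugawara y - P.sugawara y * P.sugawara x := by
  refine Away.commutator R P.cPlus ?_
  change P.gammaHat x.1.2 * P.gammaHat y.1.2 - P.gammaHat y.1.2 * P.gammaHat x.1.2 =
    -(P.cPlus * P.gammaHat z.1.2)
  rw [hz]
  exact P.gammaHat_commutator x y.2.1

theorem sugawara_virC : P.sugawara (virC R) = Away.inv P.cPlus *
    Away.of R P.cPlus ((Module.finrank k 𝔤 : R) • P.cBar) := by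
  change -(Away.inv P.cPlus * Away.of R P.cPlus
    (P.gammaHat (-CEnv.of (lFil R) (hbarF R)))) = _
  rw [map_neg, map_neg, mul_neg, neg_neg, gammaHat_of, gammaU_hbar, map_smul]
  rfl

/-- The bracket of the Virasoro algebra, for which both `T` and `T_𝔥` are homomorphisms. -/
theorem exists_bracket : ∃ b : Vir R →ₗ[R] Vir R →ₗ[R] Vir R,
    (∀ x y, virT R (b x y) = virT R x * virT R y - virT R y * virT R x) ∧
    (∀ x y, P.sugawara (b x y) =
      P.sugawara x * P.sugawara y - P.sugawara y * P.sugawara x) := by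
  choose b hb using exists_vir_lieHat (R := R)
  have hT := virT_injective (R := R) fun _ hn => P.isUnit_natCast hn
  refine ⟨LinearMap.mk₂ R b (fun x x' y => hT ?_) (fun r x y => hT ?_) (fun x y y' => hT ?_)
    (fun r x y => hT ?_), fun x y => virT_commutator (hb x y),
    fun x y => P.sugawara_commutator (hb x y)⟩
  · simp only [map_add, virT_commutator (hb _ _)]
    noncomm_ring
  · simp only [map_smul, virT_commutator (hb _ _), smul_mul_assoc, mul_smul_comm, smul_sub]
  · simp only [map_add, virT_commutator (hb _ _)]
    noncomm_ring
  · simp only [map_smul, virT_commutator (hb _ _), smul_mul_assoc, mul_smul_comm, smul_sub]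

end TwistDatum
end Sugawara

end TwistedSugawara

end

theorem mainTheorem11 {k 𝔤 R R' : Type*} [Field k] [IsAlgClosed k] [CharZero k]
    [LieRing 𝔤] [LieAlgebra k 𝔤] [FiniteDimensional k 𝔤] [LieAlgebra.IsSimple k 𝔤]
    [CommRing R] [Algebra k R] [CommRing R'] [Algebra k R'] [Algebra R R'] [IsScalarTower k R R']
    (p : ℕ) [Fact p.Prime]
    (P : TwistedSugawara.TwistDatum k 𝔤 R R' (Multiplicative (ZMod p))) :
    (∀ Z : P.hL, P.adTensor Z P.casimir = (2 * algebraMap k R P.hCheck) • Z) ∧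
    Function.Injective (TwistedSugawara.virT R) ∧
    (∃ b : TwistedSugawara.Vir R →ₗ[R] TwistedSugawara.Vir R →ₗ[R] TwistedSugawara.Vir R,
      (∀ x y, TwistedSugawara.virT R (b x y) =
        TwistedSugawara.virT R x * TwistedSugawara.virT R y -
          TwistedSugawara.virT R y * TwistedSugawara.virT R x) ∧
      (∀ x y, P.sugawara (b x y) =
        P.sugawara x * P.sugawara y - P.sugawara y * P.sugawara x)) ∧
    TwistedSugawara.virT R (TwistedSugawara.virC R) = 1 ∧
    P.sugawara (TwistedSugawara.virC R) =
      TwistedSugawara.Away.inv P.cPlus *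
        TwistedSugawara.Away.of R P.cPlus ((Module.finrank k 𝔤 : R) • P.cBar) := by
  exact ⟨P.adTensor_casimir, TwistedSugawara.virT_injective fun _ hn => P.isUnit_natCast hn,
    P.exists_bracket, TwistedSugawara.virT_virC, P.sugawara_virC⟩
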